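/- **Setting.** Let $N\ge 1$, $\ell>0$, $\epsilon>0$, $\Omega=[-\ell,\ell]^3$, and $\mathcal H=L^2(\Omega;\mathbb R)$. Let $\mathcal W_N$ be the set of $L^2$-normalized wavefunctions $\psi:(\Omega\times\mathbb Z_2)^N\to\mathbb C$, antisymmetric under simultaneous permutation of positions and spins, whose $2^N$ spatial components lie in $H^1_0(\Omega^N)$. Let $\rho_\psi(\mathbf r)=N\sum_{s}\int_{\Omega^{N-1}}|\psi_s(\mathbf r,\mathbf r_2,\dots,\mathbf r_N)|^2\,d\mathbf r_2\cdots d\mathbf r_N$ be the one-electron density ($s$ running over the $2^N$ spin configurations) and, for $\lambda\in[0,1]$, let $\mathcal E_0^\lambda[\psi]=\tfrac12\langle\nabla\psi,\nabla\psi\rangle+\lambda\langle\psi,W\psi\rangle$ with $W=\sum_{i<j}|\mathbf r_i-\mathbf r_j|^{-1}$. For $v,\rho\in\mathcal H$ put $$E^\lambda[v]=\inf_{\psi\in\mathcal W_N}\Big(\mathcal E_0^\lambda[\psi]+\int_\Omega\rho_\psi v\Big),\qquad F^\lambda[\rho]=\inf\Big\{\sum_k w_k\mathcal E_0^\lambda[\psi_k]\Big\},$$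 where the second infimum is over all $w_k\ge 0$ with $\sum_k w_k=1$ and orthonormal $\psi_k\in\mathcal W_N$ such that $\sum_k w_k\rho_{\psi_k}=\rho$ a.e. ($F^\lambda[\rho]=+\infty$ if there are none). Put $${}^\epsilon E^\lambda[v]=E^\lambda[v]-\tfrac{\epsilon}{2}\|v\|^2,\qquad {}^\epsilon F^\lambda[\rho]=\inf_{\sigma\in\mathcal H}\Big(F^\lambda[\sigma]+\tfrac1{2\epsilon}\|\rho-\sigma\|^2\Big),$$ ${}^\epsilon F={}^\epsilon F^1$, and ${}^\epsilon v_{\rm Hxc}=\nabla({}^\epsilon F^1-{}^\epsilon F^0)$. Let $\overline\partial g[v]=\{y\in\mathcal H: g[v']\le g[v]+\langle y,v'-v\rangle\ \forall v'\in\mathcal H\}$ denote the superdifferential. **Algorithm (MYKSODA).** Let $v_{\rm ext}\in\mathcal H$. Set $v_{\mathrm{eff},0}=v_{\rm ext}$ and choose $\rho_0\in\overline\partial\,{}^\epsilon E^0[v_{\rm ext}]$. For $i=0,1,\dots$: 1. Set $v_{\mathrm{eff},i+1}=v_{\rm ext}+{}^\epsilon v_{\rm Hxc}[\rho_i]$.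 2. Choose $\tilde\rho_{i+1}\in\overline\partial E^0[v_{\mathrm{eff},i+1}]$ and set $\rho'_{i+1}=\tilde\rho_{i+1}-\epsilon v_{\mathrm{eff},i+1}$. 3. (Damping step.) Choose $t_i\in(0,1]$ such that $\rho_{i+1}=\rho_i+t_i(\rho'_{i+1}-\rho_i)$ satisfies $\langle\nabla{}^\epsilon F[\rho_{i+1}]+v_{\rm ext},\,\rho'_{i+1}-\rho_i\rangle\le 0$. 4. If $v_{\mathrm{eff},i+1}=v_{\rm ext}+{}^\epsilon v_{\rm Hxc}[\rho_{i+1}]$, terminate. Write $e_i={}^\epsilon F[\rho_i]+\langle v_{\rm ext},\rho_i\rangle$, and call $\rho\in\mathcal H$ *stationary* if $\nabla{}^\epsilon F[\rho]+v_{\rm ext}=0$. **Theorem.** * For $\lambda\in[0,1]$, $E^\lambda$ and ${}^\epsilon F^\lambda$ are finite everywhere on $\mathcal H$ and ${}^\epsilon F^\lambda$ is Fréchet differentiable. The sets $\overline\partial\,{}^\epsilon E^0[v_{\rm ext}]$ and $\overline\partial E^0[v]$, $v\in\mathcal H$, are nonempty. * The damping step is well defined: for every current $\rho_i\in\mathcal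 H$ that is not stationary and every choice of $\tilde\rho_{i+1}$ in step 2, a $t_i\in(0,1]$ as required in step 3 exists. If $\rho_i$ is stationary, then it already has the exact energy, ${}^\epsilon F[\rho_i]+\langle v_{\rm ext},\rho_i\rangle+\tfrac{\epsilon}{2}\|v_{\rm ext}\|^2=E^1[v_{\rm ext}]$, and steps 2 and 3 can still be carried out for some choice of $\tilde\rho_{i+1}$. * In every run of the algorithm, finite or infinite and whatever the choices made, $e_{i+1}\le e_i$ for every iteration $i$ carried out, and $e_{i+1}<e_i$ unless iteration $i$ terminates the algorithm and $\rho_i$ is stationary. Moreover $e_i+\tfrac{\epsilon}{2}\|v_{\rm ext}\|^2\ge E^1[v_{\rm ext}]$ for every computed $e_i$. * In particular, if the algorithm does not terminate, $(e_i)_{i\ge0}$ is strictly decreasing and converges to a limit $e\in\mathbb R$ with $$e+\tfrac{\epsilon}{2}\|v_{\rm ext}\|^2\ \ge\ E^1[v_{\rm ext}].$$ -/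

import Mathlib

open MeasureTheory Filter Topology
open scoped ENNReal NNReal RealInnerProductSpace

noncomputable section

namespace MYKS

/-! ### Convex analysis on a real Hilbert space -/

section Convex

variable {H : Type*} [NormedAddCommGroup H] [InnerProductSpace ℝ H]

/-- Superdifferential of an extended-real-valued functional; the dual of the Hilbert space is
identified with the space itself. -/
def superdiff (g : H → EReal) (x : H) : Set H :=
  {y | ∀ x' : H, g x' ≤ g x + ((⟪y, x' - x⟫ : ℝ) : EReal)}

/-- Moreau envelope `x ↦ inf_z (f z + ‖x - z‖² / (2 ε))`. -/
def moreauEnvelope (ε : ℝ) (f : H → EReal) (x : H) : EReal :=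
  ⨅ z : H, f z + ((1 / (2 * ε) * ‖x - z‖ ^ 2 : ℝ) : EReal)

end Convex

/-! ### The box and the one-particle density space -/

/-- Position space `ℝ³`. -/
abbrev Pos : Type := EuclideanSpace ℝ (Fin 3)

/-- The (open) box `(-ℓ, ℓ)³`; its closure `[-ℓ, ℓ]³` has the same `L²` space. -/
def box (ℓ : ℝ) : Set Pos := {r | ∀ a : Fin 3, |r a| < ℓ}

/-- The real Hilbert space `L²(Ω)` of (quasi)densities and of potentials. -/
abbrev DensSpace (ℓ : ℝ) : Type := Lp ℝ 2 ((volume : Measure Pos).restrict (box ℓ))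

/-! ### Wavefunctions of `N` spin-1/2 electrons in the box -/

/-- Spatial configurations of `N` electrons. -/
abbrev Config (N : ℕ) : Type := Fin N → Pos

/-- The configuration box `Ω^N`. -/
def configBox (N : ℕ) (ℓ : ℝ) : Set (Config N) := {r | ∀ i, r i ∈ box ℓ}

/-- `L²(Ω^N; ℂ)`. -/
abbrev SpatialL2 (N : ℕ) (ℓ : ℝ) : Type :=
  Lp ℂ 2 ((volume : Measure (Config N)).restrict (configBox N ℓ))

/-- `L²((Ω × ℤ₂)^N; ℂ)`, given by its `2^N` spatial components `ψ s`, one for each spin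
configuration `s`, with `‖ψ‖² = ∑_s ‖ψ s‖²`. -/
abbrev WaveL2 (N : ℕ) (ℓ : ℝ) : Type :=
  PiLp 2 (fun _ : Fin N → Fin 2 => SpatialL2 N ℓ)

/-- The unit vector of `Config N` in the direction `a` of the `i`-th electron. -/
def coordDir (N : ℕ) (i : Fin N) (a : Fin 3) : Config N :=
  Pi.single i (EuclideanSpace.single a (1 : ℝ))

/-- `u` lies in the Sobolev space `H¹₀(Ω^N)`, the closure of `C_c^∞(Ω^N)` in the `H¹` norm, and
`g i a` is its partial derivative in the direction `a` of the `i`-th electron: `u` and `g i a` are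
the `L²` limits of `φ k` and `∂_{i,a} φ k` for a sequence of test functions `φ k`.
(The limits of the derivatives are the weak derivatives of `u`; in particular they depend only
on `u`.) -/
def HasSobolevGradient (N : ℕ) (ℓ : ℝ) (u : SpatialL2 N ℓ)
    (g : Fin N → Fin 3 → SpatialL2 N ℓ) : Prop :=
  ∃ φ : ℕ → Config N → ℂ,
    (∀ k, ContDiff ℝ ((⊤ : ℕ∞) : WithTop ℕ∞) (φ k) ∧ HasCompactSupport (φ k) ∧
      tsupport (φ k) ⊆ configBox N ℓ) ∧
    Tendsto (fun k => eLpNorm (fun r => φ k r - u r) 2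
      ((volume : Measure (Config N)).restrict (configBox N ℓ))) atTop (𝓝 0) ∧
    ∀ i a, Tendsto (fun k => eLpNorm (fun r => fderiv ℝ (φ k) r (coordDir N i a) - g i a r) 2
      ((volume : Measure (Config N)).restrict (configBox N ℓ))) atTop (𝓝 0)

/-- Pauli principle: antisymmetry under simultaneous permutation of positions and spins. -/
def IsAntisymmetric (N : ℕ) (ℓ : ℝ) (ψ : WaveL2 N ℓ) : Prop :=
  ∀ (σ : Equiv.Perm (Fin N)) (s : Fin N → Fin 2),
    ∀ᵐ r ∂((volume : Measure (Config N)).restrict (configBox N ℓ)),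
      ψ (s ∘ σ) (r ∘ σ) = ((Equiv.Perm.sign σ : ℤ) : ℂ) * ψ s r

/-- `W_N`: normalized antisymmetric wavefunctions with components in `H¹₀(Ω^N)`. -/
def waveSet (N : ℕ) (ℓ : ℝ) : Set (WaveL2 N ℓ) :=
  {ψ | ‖ψ‖ = 1 ∧ IsAntisymmetric N ℓ ψ ∧ ∀ s, ∃ g, HasSobolevGradient N ℓ (ψ s) g}

/-- `⟨∇u, ∇u⟩` for `u ∈ H¹₀(Ω^N)` (the infimum runs over the single gradient of `u`;
the value is `∞` for `u ∉ H¹₀(Ω^N)`). -/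
def gradSq (N : ℕ) (ℓ : ℝ) (u : SpatialL2 N ℓ) : ℝ≥0∞ :=
  ⨅ (g : Fin N → Fin 3 → SpatialL2 N ℓ) (_ : HasSobolevGradient N ℓ u g),
    ∑ i, ∑ a, ‖g i a‖ₑ ^ 2

/-- Coulomb repulsion `W(r) = ∑_{i<j} 1 / |r_i - r_j|`. -/
def coulomb (N : ℕ) (r : Config N) : ℝ≥0∞ :=
  ∑ i : Fin N, ∑ j ∈ Finset.Ioi i, ‖r i - r j‖ₑ⁻¹

/-- `⟨ψ, W ψ⟩`. -/
def repulsion (N : ℕ) (ℓ : ℝ) (ψ : WaveL2 N ℓ) : ℝ≥0∞ :=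
  ∑ s : Fin N → Fin 2, ∫⁻ r in configBox N ℓ, coulomb N r * ‖ψ s r‖ₑ ^ 2

/-- Internal energy `ℰ₀^λ[ψ] = ½ ⟨∇ψ, ∇ψ⟩ + λ ⟨ψ, W ψ⟩`. -/
def internalEnergy (N : ℕ) (ℓ : ℝ) (lam : ℝ≥0) (ψ : WaveL2 N ℓ) : ℝ≥0∞ :=
  2⁻¹ * (∑ s : Fin N → Fin 2, gradSq N ℓ (ψ s)) + (lam : ℝ≥0∞) * repulsion N ℓ ψ

/-- One-electron density of a wavefunction of `N = n + 1` electrons,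
`ρ_ψ(r) = N ∑_s ∫ |ψ_s(r, r₂, …, r_N)|² dr₂ ⋯ dr_N`. -/
def density (n : ℕ) (ℓ : ℝ) (ψ : WaveL2 (n + 1) ℓ) (r : Pos) : ℝ :=
  (n + 1 : ℝ) * ∑ s : Fin (n + 1) → Fin 2,
    ∫ y in configBox n ℓ, ‖ψ s (Fin.cons r y : Config (n + 1))‖ ^ 2

/-! ### Energy functionals, for `N = n + 1` electrons and interaction strength `lam` -/

/-- Ground-state energy `E^λ[v] = inf {ℰ₀^λ[ψ] + ∫ ρ_ψ v | ψ ∈ W_N}`. -/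
def groundEnergy (n : ℕ) (ℓ : ℝ) (lam : ℝ≥0) (v : DensSpace ℓ) : EReal :=
  ⨅ ψ ∈ waveSet (n + 1) ℓ, ((internalEnergy (n + 1) ℓ lam ψ : ℝ≥0∞) : EReal) +
    ((∫ r in box ℓ, density n ℓ ψ r * v r : ℝ) : EReal)

/-- The weights `w` and wavefunctions `ψ` describe the density operator
`γ = ∑_k w_k |ψ_k⟩⟨ψ_k|`, with `ψ_k ∈ W_N` orthonormal. The `ψ_k` of weight zero do not
contribute to `γ` (so that `γ` may have finite rank) and are unconstrained. -/
structure IsDensityOperator (N : ℕ) (ℓ : ℝ) (w : ℕ → ℝ≥0) (ψ : ℕ → WaveL2 N ℓ) : Prop where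
  hasSum_weight : HasSum w 1
  mem_waveSet : ∀ k, w k ≠ 0 → ψ k ∈ waveSet N ℓ
  orthogonal : ∀ j k, w j ≠ 0 → w k ≠ 0 → j ≠ k → inner ℂ (ψ j) (ψ k) = 0

/-- Universal functional `F^λ[ρ] = inf {Tr(Ĥ[0]^λ γ) | γ ↦ ρ}` (density-matrix constrained
search), with `Tr(Ĥ[0]^λ γ) = ∑_k w_k ℰ₀^λ[ψ_k]` and `γ ↦ ρ` meaning `∑_k w_k ρ_{ψ_k} = ρ` a.e. -/
def universalF (n : ℕ) (ℓ : ℝ) (lam : ℝ≥0) (ρ : DensSpace ℓ) : EReal :=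
  ⨅ (w : ℕ → ℝ≥0) (ψ : ℕ → WaveL2 (n + 1) ℓ) (_ : IsDensityOperator (n + 1) ℓ w ψ)
    (_ : ∀ᵐ r ∂((volume : Measure Pos).restrict (box ℓ)),
      HasSum (fun k => (w k : ℝ) * density n ℓ (ψ k) r) (ρ r)),
    ((∑' k, (w k : ℝ≥0∞) * internalEnergy (n + 1) ℓ lam (ψ k) : ℝ≥0∞) : EReal)

/-- Regularized ground-state energy `E^λ[v] - ε ‖v‖² / 2`. -/
def regE (n : ℕ) (ℓ ε : ℝ) (lam : ℝ≥0) (v : DensSpace ℓ) : EReal :=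
  groundEnergy n ℓ lam v - ((ε / 2 * ‖v‖ ^ 2 : ℝ) : EReal)

/-- Regularized universal functional (Moreau envelope of `F^λ`), as a real-valued function. -/
def regF (n : ℕ) (ℓ ε : ℝ) (lam : ℝ≥0) (ρ : DensSpace ℓ) : ℝ :=
  (moreauEnvelope ε (universalF n ℓ lam) ρ).toReal

/-- Regularized Hartree-exchange-correlation potential, the gradient of the regularized
Hartree-exchange-correlation energy. -/
def vHxc (n : ℕ) (ℓ ε : ℝ) (ρ : DensSpace ℓ) : DensSpace ℓ :=
  gradient (fun σ : DensSpace ℓ => regF n ℓ ε 1 σ - regF n ℓ ε 0 σ) ρ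

/-- `t` is an admissible damping parameter for the step from `ρ` towards `ρ'`. -/
def IsDamping (n : ℕ) (ℓ ε : ℝ) (vext ρ ρ' : DensSpace ℓ) (t : ℝ) : Prop :=
  0 < t ∧ t ≤ 1 ∧
    ⟪gradient (regF n ℓ ε 1) (ρ + t • (ρ' - ρ)) + vext, ρ' - ρ⟫ ≤ 0

/-- The sequences `ρ`, `veff`, `ρt` (for `ρ̃`), `ρ'`, `t` record `T` iterations of the optimal
damping algorithm (iterations `0, …, T - 1`; all natural numbers if `T = ⊤`). An iteration is
followed by another one only if the termination criterion was not met at its end. -/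
structure IsRun (n : ℕ) (ℓ ε : ℝ) (vext : DensSpace ℓ) (T : ℕ∞)
    (ρ veff ρt ρ' : ℕ → DensSpace ℓ) (t : ℕ → ℝ) : Prop where
  veff_zero : veff 0 = vext
  rho_zero : ρ 0 ∈ superdiff (regE n ℓ ε 0) vext
  veff_succ : ∀ i : ℕ, (i : ℕ∞) < T → veff (i + 1) = vext + vHxc n ℓ ε (ρ i)
  solve : ∀ i : ℕ, (i : ℕ∞) < T → ρt (i + 1) ∈ superdiff (groundEnergy n ℓ 0) (veff (i + 1))
  quasidensity : ∀ i : ℕ, (i : ℕ∞) < T → ρ' (i + 1) = ρt (i + 1) - ε • veff (i + 1)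
  damping : ∀ i : ℕ, (i : ℕ∞) < T → IsDamping n ℓ ε vext (ρ i) (ρ' (i + 1)) (t i)
  rho_succ : ∀ i : ℕ, (i : ℕ∞) < T → ρ (i + 1) = ρ i + t i • (ρ' (i + 1) - ρ i)
  continued : ∀ i : ℕ, ((i + 1 : ℕ) : ℕ∞) < T →
    veff (i + 1) ≠ vext + vHxc n ℓ ε (ρ (i + 1))

/-- The energy estimate of a quasidensity `ρ`: regularized `F^1[ρ]` plus `⟨vext, ρ⟩`. -/
def energyEstimate (n : ℕ) (ℓ ε : ℝ) (vext ρ : DensSpace ℓ) : ℝ :=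
  regF n ℓ ε 1 ρ + ⟪vext, ρ⟫

end MYKS

end

/-! The algorithm only sees a convex set `P` of pairs (density, energy) in a Hilbert space, its
Moreau envelope `m` and its concave conjugate `e`; `IsMoreauPair` isolates this. Neither closedness
of `P` nor attained infima are needed. The envelope is convex and has a quadratic upper bound
(`semiconcave`), so it is Fréchet differentiable with a cocoercive gradient (`gradient_bounds`,
`gradient_le_strong`, `cocoercive`). Conjugacy gives a dictionary: `x + ε • v` is a supergradient of
`e` at `v` exactly when `gradient m x = -v` (`gradient_of_superdiff`, `superdiff_of_gradient`).

Write `g = gradient m₁ ρ + vext`. By the dictionary, the trial quasidensity `ρ'` satisfies `gradient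
m₀ ρ' - gradient m₀ ρ = -g`. Cocoercivity of `gradient m₀` then gives `⟪g, ρ' - ρ⟫ ≤ -(ε / 2) ‖g‖²`
(`slope_le`): the step is a descent direction unless `g = 0`, and continuity yields a damping
parameter. Strong convexity of `m₁` at the damped point gives descent. If the energy stays equal,
then `g = 0`, so `gradient m₀` agrees at `ρ` and `ρ'`, is constant on the segment between them, and
the effective potential is reproduced, which is termination (`descent`). The upper bound on the
exact energy is the Fenchel inequality `conj_le`; stationarity turns it into the equality `conj_eq`.

It remains to find `P` for the electronic functionals. Finite mixtures of wavefunctions, without any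
orthogonality, form a convex set (`ensembleSet`). Its conjugate is the ground-state energy because
an average is at least one of its terms. Its Moreau envelope is that of `universalF`: a finite
mixture can be made orthogonal by diagonalizing a Gram matrix, without changing the density or
raising the energy (`exists_orthogonal_mixture`), while an infinite ensemble is approximated by
renormalized truncations (`exists_mem_ensembleSet`), which suffices since the quadratic penalty is
continuous.

The Sobolev inequality makes an `L²` potential form bounded relative to the kinetic energy with
arbitrarily small constant (`exists_edensity_bound`). This puts densities in `L²` (`memLp_density`)
and bounds the energy below uniformly on balls of potentials (`exists_lower_bound`). An
antisymmetrized bump with well-separated electrons gives a state of finite energy, so that `P` is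
nonempty. -/

noncomputable section

namespace MYKS

/-! ### Moreau envelopes and concave conjugates in a Hilbert space -/

section Duality

variable {H : Type*} [NormedAddCommGroup H] [InnerProductSpace ℝ H]

/-- A continuous real-valued convex function on a Hilbert space has a subgradient everywhere. -/
theorem exists_subgradient [CompleteSpace H] {m : H → ℝ} (hm : ConvexOn ℝ Set.univ m)
    (hc : Continuous m) (x : H) : ∃ y : H, ∀ z, m x + ⟪y, z - x⟫ ≤ m z := by
  have hconv : Convex ℝ {p : H × ℝ | m p.1 < p.2} := by
    have := hm.convex_strict_epigraph
    simpa using this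
  have hopen : IsOpen {p : H × ℝ | m p.1 < p.2} :=
    isOpen_lt (hc.comp continuous_fst) continuous_snd
  obtain ⟨f, hf⟩ := geometric_hahn_banach_open_point (x := (x, m x)) hconv hopen (by simp)
  have hsplit : ∀ z t, f (z, t) = f (z, 0) + t * f (0, 1) := by
    intro z t
    have : ((z, t) : H × ℝ) = (z, 0) + t • ((0, 1) : H × ℝ) := by simp
    rw [this, map_add, map_smul, smul_eq_mul]
  set b := f (0, 1) with hb
  -- The strict epigraph contains points above `(x, m x)`, so the separating hyperplane is not
  -- vertical.
  have hbneg : b < 0 := by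
    have := hf (x, m x + 1) (by simp)
    rw [hsplit x (m x + 1), hsplit x (m x)] at this
    linarith
  let L : H →L[ℝ] ℝ := f.comp (ContinuousLinearMap.inl ℝ H ℝ)
  have hL : ∀ z, f (z, 0) = L z := fun z => by simp [L]
  refine ⟨(-b)⁻¹ • (InnerProductSpace.toDual ℝ H).symm L, fun z => ?_⟩
  rw [real_inner_smul_left, InnerProductSpace.toDual_symm_apply]
  -- Only the strict epigraph was separated, hence `m z` is approached by values `t` above it.
  refine le_of_forall_gt_imp_ge_of_dense fun t ht => ?_
  have h := hf (z, t) ht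
  rw [hsplit z t, hsplit x (m x), hL, hL] at h
  have h2 : (-b)⁻¹ * L (z - x) ≤ t - m x := by
    rw [inv_mul_le_iff₀ (by linarith), map_sub]
    nlinarith
  linarith

/-- The difference of the two sides is `a * b * ‖u - w‖ ^ 2`. -/
theorem norm_sq_convex_comb (a b : ℝ) (hab : a + b = 1) (ha : 0 ≤ a) (hb : 0 ≤ b) (u w : H) :
    ‖a • u + b • w‖ ^ 2 ≤ a * ‖u‖ ^ 2 + b * ‖w‖ ^ 2 := by
  have h := norm_sub_sq_real u w
  have h2 : ‖a • u + b • w‖ ^ 2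
      = a ^ 2 * ‖u‖ ^ 2 + 2 * (a * b) * ⟪u, w⟫ + b ^ 2 * ‖w‖ ^ 2 := by
    rw [norm_add_sq_real, norm_smul, norm_smul, real_inner_smul_left, real_inner_smul_right,
      mul_pow, mul_pow, Real.norm_eq_abs, Real.norm_eq_abs, sq_abs, sq_abs]
    ring
  obtain rfl : b = 1 - a := by linarith
  rw [h2]
  nlinarith [mul_nonneg (mul_nonneg ha hb) (sq_nonneg ‖u - w‖)]

/-- `m` is the Moreau envelope, and `e` the concave conjugate, of the convex set `P` of pairs
(density, energy), with `e` locally bounded below. -/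
structure IsMoreauPair (ε : ℝ) (P : Set (H × ℝ)) (m e : H → ℝ) : Prop where
  convex : Convex ℝ P
  nonempty : P.Nonempty
  env : ∀ x, IsGLB ((fun p : H × ℝ => p.2 + 1 / (2 * ε) * ‖x - p.1‖ ^ 2) '' P) (m x)
  leg : ∀ v, IsGLB ((fun p : H × ℝ => p.2 + ⟪v, p.1⟫) '' P) (e v)
  bdd : ∀ R : ℝ, ∃ B : ℝ, ∀ v, ‖v‖ ≤ R → B ≤ e v

theorem exists_lt_of_isGLB_image {α : Type*} {P : Set α} {f : α → ℝ} {a r : ℝ}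
    (h : IsGLB (f '' P) a) (hr : a < r) : ∃ p ∈ P, f p < r := by
  obtain ⟨_, ⟨p, hp, rfl⟩, -, hlt⟩ := h.exists_between hr
  exact ⟨p, hp, hlt⟩

namespace IsMoreauPair

variable {ε : ℝ} {P : Set (H × ℝ)} {m e : H → ℝ}

theorem env_le (h : IsMoreauPair ε P m e) {p : H × ℝ} (hp : p ∈ P) (x : H) :
    m x ≤ p.2 + 1 / (2 * ε) * ‖x - p.1‖ ^ 2 := (h.env x).1 ⟨p, hp, rfl⟩

theorem leg_le (h : IsMoreauPair ε P m e) {p : H × ℝ} (hp : p ∈ P) (v : H) :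
    e v ≤ p.2 + ⟪v, p.1⟫ := (h.leg v).1 ⟨p, hp, rfl⟩

/-- Partial minimization of a jointly convex function. Near-minimizers with error `δ` stand in for
minimizers, which need not exist. -/
theorem convexOn (h : IsMoreauPair ε P m e) (hε : 0 < ε) : ConvexOn ℝ Set.univ m := by
  refine ⟨convex_univ, fun x _ y _ a b ha hb hab => ?_⟩
  refine le_of_forall_pos_le_add fun δ hδ => ?_
  obtain ⟨p, hp, hp'⟩ := exists_lt_of_isGLB_image (h.env x) (lt_add_of_pos_right _ hδ)
  obtain ⟨q, hq, hq'⟩ := exists_lt_of_isGLB_image (h.env y) (lt_add_of_pos_right _ hδ)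
  have h1 := h.env_le (h.convex hp hq ha hb hab) (a • x + b • y)
  have h2 := norm_sq_convex_comb a b hab ha hb (x - p.1) (y - q.1)
  have h3 : a • x + b • y - (a • p + b • q).1 = a • (x - p.1) + b • (y - q.1) := by
    simp only [Prod.fst_add, Prod.smul_fst, smul_sub]; abel
  rw [h3] at h1
  have h4 : (a • p + b • q).2 = a * p.2 + b * q.2 := by simp
  rw [h4] at h1
  have h5 : 0 < 1 / (2 * ε) := by positivity
  have h6 := mul_le_mul_of_nonneg_left h2 h5.le
  have h7 := mul_le_mul_of_nonneg_left hp'.le ha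
  have h8 := mul_le_mul_of_nonneg_left hq'.le hb
  have h9 : δ = a * δ + b * δ := by rw [← add_mul, hab, one_mul]
  simp only [smul_eq_mul]
  nlinarith

/-- A single near-minimizer for `x` competes at both `x + d` and `x - d`, and the parallelogram law
adds the two penalties. -/
theorem semiconcave (h : IsMoreauPair ε P m e) (hε : 0 < ε) (x d : H) :
    m (x + d) + m (x - d) ≤ 2 * m x + ‖d‖ ^ 2 / ε := by
  refine le_of_forall_pos_le_add fun δ hδ => ?_
  obtain ⟨p, hp, hp'⟩ := exists_lt_of_isGLB_image (h.env x) (lt_add_of_pos_right _ (half_pos hδ))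
  have h1 := h.env_le hp (x + d)
  have h2 := h.env_le hp (x - d)
  have h3 := parallelogram_law_with_norm ℝ (x - p.1) d
  rw [show x + d - p.1 = x - p.1 + d by abel] at h1
  rw [show x - d - p.1 = x - p.1 - d by abel] at h2
  have h4 : 1 / (2 * ε) * ‖x - p.1 + d‖ ^ 2 + 1 / (2 * ε) * ‖x - p.1 - d‖ ^ 2
      = 2 * (1 / (2 * ε) * ‖x - p.1‖ ^ 2) + ‖d‖ ^ 2 / ε := by
    rw [← mul_add, h3]; field_simp
  linarith

/-- One element of `P` bounds `m` above by a continuous function, and a convex function bounded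
above near one point is continuous. -/
theorem continuous_env (h : IsMoreauPair ε P m e) (hε : 0 < ε) : Continuous m := by
  obtain ⟨p, hp⟩ := h.nonempty
  rw [← continuousOn_univ]
  refine (((h.convexOn hε).continuousOn_tfae isOpen_univ ⟨0, trivial⟩).out 3 1).1 ?_
  refine ⟨p.1, trivial, ?_⟩
  have hc : ContinuousAt (fun x => p.2 + 1 / (2 * ε) * ‖x - p.1‖ ^ 2) p.1 := by fun_prop
  refine (hc.isBoundedUnder_le).mono_le (Eventually.of_forall fun x => h.env_le hp x)

theorem conj_le (h : IsMoreauPair ε P m e) (hε : 0 < ε) (v x : H) :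
    e v - ε / 2 * ‖v‖ ^ 2 ≤ m x + ⟪v, x⟫ := by
  rw [← sub_le_iff_le_add]
  refine (le_isGLB_iff (h.env x)).2 ?_
  rintro _ ⟨p, hp, rfl⟩
  have h1 := h.leg_le hp v
  -- Completing the square: this vanishes where `x` minimizes penalty plus `⟪v, x⟫` for the given
  -- `p`.
  have h2 : 0 ≤ 1 / (2 * ε) * ‖(x - p.1) + ε • v‖ ^ 2 := by positivity
  rw [norm_add_sq_real, real_inner_smul_right, norm_smul, mul_pow, Real.norm_eq_abs, sq_abs,
    real_inner_comm, inner_sub_right] at h2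
  have h3 : 1 / (2 * ε) * (‖x - p.1‖ ^ 2 + 2 * (ε * (⟪v, x⟫ - ⟪v, p.1⟫)) + ε ^ 2 * ‖v‖ ^ 2)
      = 1 / (2 * ε) * ‖x - p.1‖ ^ 2 + (⟪v, x⟫ - ⟪v, p.1⟫) + ε / 2 * ‖v‖ ^ 2 := by
    field_simp
  simp only
  linarith

theorem concaveOn (h : IsMoreauPair ε P m e) : ConcaveOn ℝ Set.univ e := by
  refine ⟨convex_univ, fun x _ y _ a b ha hb hab => ?_⟩
  refine (le_isGLB_iff (h.leg _)).2 ?_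
  rintro _ ⟨p, hp, rfl⟩
  have h1 := mul_le_mul_of_nonneg_left (h.leg_le hp x) ha
  have h2 := mul_le_mul_of_nonneg_left (h.leg_le hp y) hb
  simp only [smul_eq_mul, inner_add_left, real_inner_smul_left]
  have h3 : p.2 = a * p.2 + b * p.2 := by rw [← add_mul, hab, one_mul]
  linarith

variable [CompleteSpace H]

/-- The subgradient inequality at `x - d`, inserted into semiconcavity, bounds `m (x + d)` from
above, which pins `m` to its tangent up to second order. -/
theorem exists_grad (h : IsMoreauPair ε P m e) (hε : 0 < ε) (x : H) :
    ∃ y : H, ∀ d, m x + ⟪y, d⟫ ≤ m (x + d) ∧ m (x + d) ≤ m x + ⟪y, d⟫ + ‖d‖ ^ 2 / ε := by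
  obtain ⟨y, hy⟩ := exists_subgradient (h.convexOn hε) (h.continuous_env hε) x
  refine ⟨y, fun d => ⟨by simpa using hy (x + d), ?_⟩⟩
  have h1 := hy (x - d)
  have h2 := h.semiconcave hε x d
  rw [show x - d - x = -d by abel, inner_neg_right] at h1
  linarith

theorem hasGradientAt_of_bounds {m : H → ℝ} {x y : H} {C : ℝ}
    (hy : ∀ d, m x + ⟪y, d⟫ ≤ m (x + d) ∧ m (x + d) ≤ m x + ⟪y, d⟫ + ‖d‖ ^ 2 / C) :
    HasGradientAt m y x := by
  rw [hasGradientAt_iff_isLittleO_nhds_zero]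
  have : (fun d : H => m (x + d) - m x - ⟪y, d⟫) =O[𝓝 0] fun d => ‖d‖ ^ 2 := by
    refine Asymptotics.IsBigO.of_bound |C⁻¹| (Eventually.of_forall fun d => ?_)
    have h1 := hy d
    rw [Real.norm_eq_abs, abs_of_nonneg (by linarith), norm_pow, norm_norm]
    calc m (x + d) - m x - ⟪y, d⟫ ≤ C⁻¹ * ‖d‖ ^ 2 := by
          have := h1.2; rw [div_eq_inv_mul] at this; linarith
      _ ≤ _ := by gcongr; exact le_abs_self _
  refine this.trans_isLittleO ?_
  have := Asymptotics.isLittleO_norm_pow_id (E' := H) (n := 2) (by norm_num)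
  exact this

theorem gradient_bounds (h : IsMoreauPair ε P m e) (hε : 0 < ε) (x d : H) :
    m x + ⟪gradient m x, d⟫ ≤ m (x + d) ∧
      m (x + d) ≤ m x + ⟪gradient m x, d⟫ + ‖d‖ ^ 2 / ε := by
  obtain ⟨y, hy⟩ := h.exists_grad hε x
  rw [(hasGradientAt_of_bounds hy).gradient]
  exact hy d

theorem hasGradientAt (h : IsMoreauPair ε P m e) (hε : 0 < ε) (x : H) :
    HasGradientAt m (gradient m x) x :=
  hasGradientAt_of_bounds (h.gradient_bounds hε x)

theorem gradient_le (h : IsMoreauPair ε P m e) (hε : 0 < ε) (x z : H) :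
    m x + ⟪gradient m x, z - x⟫ ≤ m z := by
  simpa using (h.gradient_bounds hε x (z - x)).1

theorem gradient_eq_of_le (h : IsMoreauPair ε P m e) (hε : 0 < ε) {x y : H}
    (hy : ∀ z, m x + ⟪y, z - x⟫ ≤ m z) : gradient m x = y := by
  have h1 : ∀ d, m x + ⟪y, d⟫ ≤ m (x + d) ∧ m (x + d) ≤ m x + ⟪y, d⟫ + ‖d‖ ^ 2 / ε := by
    intro d
    have h1 := hy (x - d)
    have h2 := h.semiconcave hε x d
    rw [show x - d - x = -d by abel, inner_neg_right] at h1
    exact ⟨by simpa using hy (x + d), by linarith⟩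
  exact (hasGradientAt_of_bounds h1).gradient

/-- Quantitative convexity of a function with Lipschitz gradient (Baillon--Haddad). -/
theorem gradient_le_strong (h : IsMoreauPair ε P m e) (hε : 0 < ε) (x y : H) :
    m x + ⟪gradient m x, y - x⟫ + ε / 4 * ‖gradient m y - gradient m x‖ ^ 2 ≤ m y := by
  set d := gradient m y - gradient m x with hd
  -- Stepping from `y` by `-s • d` gains `s * ‖d‖ ^ 2 - s ^ 2 * ‖d‖ ^ 2 / ε`; the choice `s = ε / 2`
  -- maximizes this and gives the constant `ε / 4`.
  have h1 := (h.gradient_bounds hε y (-(ε / 2) • d)).2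
  have h2 := h.gradient_le hε x (y + -(ε / 2) • d)
  have h3 : ⟪gradient m y, d⟫ - ⟪gradient m x, d⟫ = ‖d‖ ^ 2 := by
    rw [← inner_sub_left, ← hd, real_inner_self_eq_norm_sq]
  rw [add_sub_right_comm, inner_add_right, real_inner_smul_right] at h2
  rw [real_inner_smul_right, norm_smul, mul_pow, Real.norm_eq_abs, sq_abs] at h1
  have h4 : (-(ε / 2)) ^ 2 * ‖d‖ ^ 2 / ε = ε / 4 * ‖d‖ ^ 2 := by field_simp; ring
  rw [h4] at h1
  have h5 : ε / 2 * ⟪gradient m y, d⟫ - ε / 2 * ⟪gradient m x, d⟫ = ε / 2 * ‖d‖ ^ 2 := by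
    rw [← h3]; ring
  linarith

/-- Sum of `gradient_le_strong` for `(x, y)` and `(y, x)`. This is the source both of the Lipschitz
gradient and of the negative slope in the algorithm. -/
theorem cocoercive (h : IsMoreauPair ε P m e) (hε : 0 < ε) (x y : H) :
    ε / 2 * ‖gradient m y - gradient m x‖ ^ 2 ≤ ⟪gradient m y - gradient m x, y - x⟫ := by
  have h1 := h.gradient_le_strong hε x y
  have h2 := h.gradient_le_strong hε y x
  rw [norm_sub_rev, ← neg_sub y x, inner_neg_right] at h2
  rw [inner_sub_left]
  linarith

theorem continuous_gradient (h : IsMoreauPair ε P m e) (hε : 0 < ε) :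
    Continuous (gradient m) := by
  have : LipschitzWith (Real.toNNReal (2 / ε)) (gradient m) := by
    refine LipschitzWith.of_dist_le_mul fun y x => ?_
    rw [dist_eq_norm, dist_eq_norm, Real.coe_toNNReal _ (by positivity)]
    have h1 := h.cocoercive hε x y
    have h2 := real_inner_le_norm (gradient m y - gradient m x) (y - x)
    rcases (norm_nonneg (gradient m y - gradient m x)).eq_or_lt with h0 | h0
    · rw [← h0]; positivity
    · rw [div_mul_eq_mul_div, le_div_iff₀ hε]
      nlinarith
  exact this.continuous

/-- The equality case of `conj_le`: at a stationary point the regularized energy is exact. -/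
theorem conj_eq (h : IsMoreauPair ε P m e) (hε : 0 < ε) {v x : H} (hx : gradient m x = -v) :
    m x + ⟪v, x⟫ = e v - ε / 2 * ‖v‖ ^ 2 := by
  refine le_antisymm ?_ (h.conj_le hε v x)
  rw [le_sub_iff_add_le]
  refine (le_isGLB_iff (h.leg v)).2 ?_
  rintro _ ⟨p, hp, rfl⟩
  -- For a fixed `p`, the point `p.1 - ε • v` minimizes `1 / (2 * ε) * ‖z - p.1‖ ^ 2 + ⟪v, z⟫` over
  -- `z`.
  have h1 := h.env_le hp (p.1 - ε • v)
  have h2 := h.gradient_le hε x (p.1 - ε • v)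
  rw [hx, inner_neg_left, inner_sub_right, inner_sub_right, real_inner_smul_right,
    real_inner_self_eq_norm_sq] at h2
  rw [show p.1 - ε • v - p.1 = -(ε • v) by abel, norm_neg, norm_smul, mul_pow,
    Real.norm_eq_abs, sq_abs] at h1
  have h3 : 1 / (2 * ε) * (ε ^ 2 * ‖v‖ ^ 2) = ε / 2 * ‖v‖ ^ 2 := by field_simp
  rw [h3] at h1
  simp only
  linarith

/-- Let `-u` be the gradient at `r - ε • v`. Equality in the conjugacy at `u`, the inequality at `v`
and the supergradient inequality from `v` to `u` leave `ε / 2 * ‖u - v‖ ^ 2 ≤ 0`. -/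
theorem gradient_of_superdiff (h : IsMoreauPair ε P m e) (hε : 0 < ε) {v r : H}
    (hr : ∀ v', e v' ≤ e v + ⟪r, v' - v⟫) : gradient m (r - ε • v) = -v := by
  obtain ⟨u, hu⟩ : ∃ u, gradient m (r - ε • v) = -u := ⟨-gradient m (r - ε • v), by simp⟩
  have h1 := h.conj_eq hε hu
  have h2 := h.conj_le hε v (r - ε • v)
  have h3 := hr u
  have h4 : ‖u‖ ^ 2 = ‖v‖ ^ 2 + 2 * ⟪v, u - v⟫ + ‖u - v‖ ^ 2 := by
    rw [← norm_add_sq_real]; simp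
  have h5 : ⟪u, r - ε • v⟫ = ⟪v, r - ε • v⟫ + (⟪r, u - v⟫ - ε * ⟪v, u - v⟫) := by
    rw [← real_inner_smul_left, ← inner_sub_left, real_inner_comm (u - v), ← inner_add_left]
    simp
  have h6 : ε / 2 * ‖u - v‖ ^ 2 ≤ 0 := by
    rw [h5, h4] at h1
    nlinarith
  have h7 : ‖u - v‖ ^ 2 ≤ 0 := by
    by_contra hc
    push Not at hc
    have := mul_pos (half_pos hε) hc
    linarith
  have h8 : u = v := by
    rw [← sub_eq_zero, ← norm_eq_zero]
    exact pow_eq_zero_iff (two_ne_zero) |>.1 (le_antisymm h7 (sq_nonneg _))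
  rw [hu, h8]

/-- Here the field `bdd` enters: `-e` is convex and bounded above on a ball, hence continuous, and
has a subgradient everywhere. -/
theorem exists_superdiff (h : IsMoreauPair ε P m e) (v : H) :
    ∃ r, ∀ v', e v' ≤ e v + ⟪r, v' - v⟫ := by
  have hconv := h.concaveOn.neg
  have hc : Continuous (-e) := by
    rw [← continuousOn_univ]
    refine ((hconv.continuousOn_tfae isOpen_univ ⟨0, trivial⟩).out 3 1).1 ?_
    obtain ⟨B, hB⟩ := h.bdd 1
    refine ⟨0, trivial, ?_⟩
    refine isBoundedUnder_of_eventually_le (a := -B) ?_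
    filter_upwards [Metric.closedBall_mem_nhds (0 : H) one_pos] with x hx
    have := hB x (by simpa using hx)
    simpa using this
  obtain ⟨y, hy⟩ := exists_subgradient hconv hc v
  refine ⟨-y, fun v' => ?_⟩
  have := hy v'
  rw [inner_neg_left]
  simp only [Pi.neg_apply] at this
  linarith

/-- The conjugacy inequality is an equality at `v`, so along `v + s • d` it bounds `e` by its linear
part plus an error of order `s ^ 2`. Concavity bounds `e` below by its chord; dividing by `s` and
letting `s` tend to `0` removes the error. -/
theorem superdiff_of_gradient (h : IsMoreauPair ε P m e) (hε : 0 < ε) {v x : H}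
    (hx : gradient m x = -v) (v' : H) : e v' ≤ e v + ⟪x + ε • v, v' - v⟫ := by
  set d := v' - v with hd
  have key : ∀ s : ℝ, 0 < s → s ≤ 1 → e v' - e v - ⟪x + ε • v, d⟫ ≤ s * (ε / 2 * ‖d‖ ^ 2) := by
    intro s hs hs1
    have h1 := h.concaveOn.2 (x := v) (y := v') trivial trivial
      (sub_nonneg.2 hs1) hs.le (by ring)
    have h2 := h.conj_eq hε hx
    have h3 := h.conj_le hε (v + s • d) x
    rw [show (1 - s) • v + s • v' = v + s • d by rw [hd, sub_smul, smul_sub, one_smul]; abel]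
      at h1
    rw [inner_add_left, norm_add_sq_real, real_inner_smul_left, real_inner_smul_right, norm_smul,
      mul_pow, Real.norm_eq_abs, sq_abs, real_inner_comm x d] at h3
    rw [inner_add_left, real_inner_smul_left]
    simp only [smul_eq_mul] at h1
    have h4 : s * (e v' - e v - (⟪x, d⟫ + ε * ⟪v, d⟫)) ≤ s * (s * (ε / 2 * ‖d‖ ^ 2)) := by
      nlinarith
    exact le_of_mul_le_mul_left h4 hs
  have hlim : Tendsto (fun s : ℝ => s * (ε / 2 * ‖d‖ ^ 2)) (𝓝[>] 0) (𝓝 0) := by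
    have : Tendsto (fun s : ℝ => s * (ε / 2 * ‖d‖ ^ 2)) (𝓝 0) (𝓝 (0 * (ε / 2 * ‖d‖ ^ 2))) :=
      tendsto_id.mul_const _
    rw [zero_mul] at this
    exact this.mono_left nhdsWithin_le_nhds
  have := ge_of_tendsto hlim (by
    filter_upwards [Ioc_mem_nhdsGT (zero_lt_one' ℝ)] with s hs using key s hs.1 hs.2)
  linarith

/-- Along the segment between two points with the same gradient, the gradient is constant. -/
theorem gradient_segment (h : IsMoreauPair ε P m e) (hε : 0 < ε) {x y : H}
    (hxy : gradient m x = gradient m y) {t : ℝ} (h0 : 0 ≤ t) (h1 : t ≤ 1) :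
    gradient m (x + t • (y - x)) = gradient m x := by
  refine h.gradient_eq_of_le hε fun z => ?_
  -- With equal gradients, the tangent inequalities from both ends force `m` to be affine between
  -- `x` and `y`, so the tangent at `x` still supports `m` at the intermediate point.
  have h2 := h.gradient_le hε y x
  have h3 := h.gradient_le hε x z
  have h4 := h.gradient_le hε x (x + t • (y - x))
  have h5 := (h.convexOn hε).2 (x := x) (y := y) trivial trivial (sub_nonneg.2 h1) h0 (by ring)
  rw [show (1 - t) • x + t • y = x + t • (y - x) by rw [sub_smul, smul_sub, one_smul]; abel] at h5
  rw [← hxy, ← neg_sub, inner_neg_right] at h2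
  rw [← sub_sub z, inner_sub_right, real_inner_smul_right]
  simp only [smul_eq_mul] at h5
  nlinarith

end IsMoreauPair

end Duality

/-! ### Descent of the damped iteration for abstract Moreau pairs -/

section Algorithm

variable {H : Type*} [NormedAddCommGroup H] [InnerProductSpace ℝ H] [CompleteSpace H]
  {ε : ℝ} {P₀ P₁ : Set (H × ℝ)} {m₀ e₀ m₁ e₁ : H → ℝ} {vext ρ v ρt : H}

theorem gradient_sub_eq (h0 : IsMoreauPair ε P₀ m₀ e₀) (h1 : IsMoreauPair ε P₁ m₁ e₁)
    (hε : 0 < ε) (x : H) :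
    gradient (fun σ => m₁ σ - m₀ σ) x = gradient m₁ x - gradient m₀ x := by
  refine HasGradientAt.gradient ?_
  have := ((h1.hasGradientAt hε x).hasFDerivAt).sub ((h0.hasGradientAt hε x).hasFDerivAt)
  rw [hasGradientAt_iff_hasFDerivAt, map_sub]
  exact this

/-- The slope of the energy at the start of an iteration. -/
theorem slope_le (h0 : IsMoreauPair ε P₀ m₀ e₀) (h1 : IsMoreauPair ε P₁ m₁ e₁) (hε : 0 < ε)
    (hv : v = vext + gradient (fun σ => m₁ σ - m₀ σ) ρ)
    (hρt : ∀ v', e₀ v' ≤ e₀ v + ⟪ρt, v' - v⟫) :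
    ⟪gradient m₁ ρ + vext, (ρt - ε • v) - ρ⟫ ≤ -(ε / 2 * ‖gradient m₁ ρ + vext‖ ^ 2) := by
  have hg := h0.gradient_of_superdiff hε hρt
  have hc := h0.cocoercive hε ρ (ρt - ε • v)
  -- The `m₀` part of the effective potential cancels `gradient m₀ ρ`, leaving the residual of the
  -- interacting problem.
  have hd : gradient m₀ (ρt - ε • v) - gradient m₀ ρ = -(gradient m₁ ρ + vext) := by
    rw [hg, hv, gradient_sub_eq h0 h1 hε]; abel
  rw [hd, norm_neg, inner_neg_left] at hc
  linarith

/-- The slope is continuous in `t` and strictly negative at `t = 0`, so it stays negative for small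
positive `t`. -/
theorem exists_damping (h0 : IsMoreauPair ε P₀ m₀ e₀) (h1 : IsMoreauPair ε P₁ m₁ e₁)
    (hε : 0 < ε) (hv : v = vext + gradient (fun σ => m₁ σ - m₀ σ) ρ)
    (hρt : ∀ v', e₀ v' ≤ e₀ v + ⟪ρt, v' - v⟫) (hne : gradient m₁ ρ + vext ≠ 0) :
    ∃ t : ℝ, 0 < t ∧ t ≤ 1 ∧
      ⟪gradient m₁ (ρ + t • ((ρt - ε • v) - ρ)) + vext, (ρt - ε • v) - ρ⟫ ≤ 0 := by
  set d := (ρt - ε • v) - ρ with hd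
  have hs := slope_le h0 h1 hε hv hρt
  rw [← hd] at hs
  have hneg : ⟪gradient m₁ ρ + vext, d⟫ < 0 := by
    have : 0 < ‖gradient m₁ ρ + vext‖ := norm_pos_iff.2 hne
    have : 0 < ε / 2 * ‖gradient m₁ ρ + vext‖ ^ 2 := by positivity
    linarith
  have hcont : Continuous fun t : ℝ => ⟪gradient m₁ (ρ + t • d) + vext, d⟫ := by
    have := h1.continuous_gradient hε
    fun_prop
  have hev : ∀ᶠ t : ℝ in 𝓝[>] 0, ⟪gradient m₁ (ρ + t • d) + vext, d⟫ < 0 := by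
    refine (hcont.tendsto 0).mono_left nhdsWithin_le_nhds |>.eventually_lt_const ?_
    simpa using hneg
  obtain ⟨t, ht, ht'⟩ := (hev.and (Ioc_mem_nhdsGT (zero_lt_one' ℝ))).exists
  exact ⟨t, ht'.1, ht'.2, ht.le⟩

/-- The energy does not increase in a damped step, and strictly decreases unless the step starts
at a stationary point and self-consistency is reached. -/
theorem descent (h0 : IsMoreauPair ε P₀ m₀ e₀) (h1 : IsMoreauPair ε P₁ m₁ e₁)
    (hε : 0 < ε) (hv : v = vext + gradient (fun σ => m₁ σ - m₀ σ) ρ)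
    (hρt : ∀ v', e₀ v' ≤ e₀ v + ⟪ρt, v' - v⟫) {t : ℝ} (ht0 : 0 < t) (ht1 : t ≤ 1) {ρn : H}
    (hρn : ρn = ρ + t • ((ρt - ε • v) - ρ))
    (hdamp : ⟪gradient m₁ ρn + vext, (ρt - ε • v) - ρ⟫ ≤ 0) :
    m₁ ρn + ⟪vext, ρn⟫ ≤ m₁ ρ + ⟪vext, ρ⟫ ∧
      (m₁ ρ + ⟪vext, ρ⟫ ≤ m₁ ρn + ⟪vext, ρn⟫ →
        gradient m₁ ρ + vext = 0 ∧ v = vext + gradient (fun σ => m₁ σ - m₀ σ) ρn) := by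
  -- The base point is the new iterate, since the damping condition controls the slope there rather
  -- than at `ρ`.
  have hs := h1.gradient_le_strong hε ρn ρ
  set d := (ρt - ε • v) - ρ with hd
  have hsub : ρ - ρn = -(t • d) := by rw [hρn]; abel
  have hin : ⟪vext, ρ⟫ - ⟪vext, ρn⟫ = -(t * ⟪vext, d⟫) := by
    rw [← inner_sub_right, hsub, inner_neg_right, real_inner_smul_right]
  rw [hsub, inner_neg_right, real_inner_smul_right] at hs
  rw [inner_add_left] at hdamp
  have hmul : t * (⟪gradient m₁ ρn, d⟫ + ⟪vext, d⟫) ≤ 0 :=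
    mul_nonpos_of_nonneg_of_nonpos ht0.le hdamp
  have hq : 0 ≤ ε / 4 * ‖gradient m₁ ρ - gradient m₁ ρn‖ ^ 2 := by positivity
  refine ⟨by linarith, fun hle => ?_⟩
  have hq0 : ε / 4 * ‖gradient m₁ ρ - gradient m₁ ρn‖ ^ 2 = 0 := by linarith
  have hgeq : gradient m₁ ρ = gradient m₁ ρn := by
    have : ‖gradient m₁ ρ - gradient m₁ ρn‖ ^ 2 = 0 := by
      rcases mul_eq_zero.1 hq0 with h | h
      · linarith
      · exact h
    exact sub_eq_zero.1 (norm_eq_zero.1 (pow_eq_zero_iff two_ne_zero |>.1 this))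
  have hzero : t * (⟪gradient m₁ ρn, d⟫ + ⟪vext, d⟫) = 0 := by linarith
  have hslope := slope_le h0 h1 hε hv hρt
  -- The slope vanishes at `ρn`; as the gradients at `ρ` and `ρn` agree, it vanishes at `ρ` too, and
  -- `slope_le` forces the residual to be zero.
  have hstat : gradient m₁ ρ + vext = 0 := by
    rw [← hd, hgeq, inner_add_left, (mul_eq_zero.1 hzero).resolve_left ht0.ne', ← hgeq] at hslope
    have : ‖gradient m₁ ρ + vext‖ ^ 2 ≤ 0 := by
      by_contra hc
      push Not at hc
      have := mul_pos (half_pos hε) hc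
      linarith
    exact norm_eq_zero.1 (pow_eq_zero_iff two_ne_zero |>.1 (le_antisymm this (sq_nonneg _)))
  refine ⟨hstat, ?_⟩
  have hg := h0.gradient_of_superdiff hε hρt
  have hg0 : gradient m₀ ρ = gradient m₀ (ρt - ε • v) := by
    rw [hg, hv, gradient_sub_eq h0 h1 hε, ← sub_eq_zero]
    rw [← hstat]; abel
  have hseg := h0.gradient_segment hε hg0 ht0.le ht1
  rw [gradient_sub_eq h0 h1 hε, ← hgeq, hρn, hseg, hv, gradient_sub_eq h0 h1 hε]

/-- A stationary point has the exact energy and the iteration can be carried out there. -/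
theorem stationary_energy (h0 : IsMoreauPair ε P₀ m₀ e₀) (h1 : IsMoreauPair ε P₁ m₁ e₁)
    (hε : 0 < ε) (hv : v = vext + gradient (fun σ => m₁ σ - m₀ σ) ρ)
    (hstat : gradient m₁ ρ + vext = 0) :
    m₁ ρ + ⟪vext, ρ⟫ + ε * ‖vext‖ ^ 2 / 2 = e₁ vext ∧
      ∃ ρt, (∀ v', e₀ v' ≤ e₀ v + ⟪ρt, v' - v⟫) ∧ ∃ t : ℝ, 0 < t ∧ t ≤ 1 ∧
        ⟪gradient m₁ (ρ + t • ((ρt - ε • v) - ρ)) + vext, (ρt - ε • v) - ρ⟫ ≤ 0 := by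
  constructor
  · have := h1.conj_eq hε (eq_neg_of_add_eq_zero_left hstat)
    linarith
  · have hg : gradient m₀ ρ = -v := by
      rw [hv, gradient_sub_eq h0 h1 hε, ← sub_eq_zero, ← hstat]; abel
    -- This choice makes the step `ρ' - ρ` zero, so any damping parameter is admissible.
    refine ⟨ρ + ε • v, h0.superdiff_of_gradient hε hg, 1, one_pos, le_rfl, ?_⟩
    simp

end Algorithm

/-- The functionals entering the algorithm are represented by convex sets of pairs
(density, energy). -/
theorem main_of_isMoreauPair (n : ℕ) (ℓ ε : ℝ) (hε : 0 < ε) (vext : DensSpace ℓ)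
    (hfin : ∀ lam : ℝ≥0, (∀ v : DensSpace ℓ,
        groundEnergy n ℓ lam v ≠ ⊥ ∧ groundEnergy n ℓ lam v ≠ ⊤) ∧
      (∀ ρ : DensSpace ℓ, moreauEnvelope ε (universalF n ℓ lam) ρ ≠ ⊥ ∧
        moreauEnvelope ε (universalF n ℓ lam) ρ ≠ ⊤))
    (hpair : ∀ lam : ℝ≥0, ∃ P : Set (DensSpace ℓ × ℝ),
      IsMoreauPair ε P (regF n ℓ ε lam) fun v => (groundEnergy n ℓ lam v).toReal) :
    (∀ lam : ℝ≥0, lam ≤ 1 →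
      (∀ v : DensSpace ℓ, groundEnergy n ℓ lam v ≠ ⊥ ∧ groundEnergy n ℓ lam v ≠ ⊤) ∧
      (∀ ρ : DensSpace ℓ,
        moreauEnvelope ε (universalF n ℓ lam) ρ ≠ ⊥ ∧
        moreauEnvelope ε (universalF n ℓ lam) ρ ≠ ⊤ ∧
        DifferentiableAt ℝ (regF n ℓ ε lam) ρ)) ∧
    (superdiff (regE n ℓ ε 0) vext).Nonempty ∧
    (∀ v : DensSpace ℓ, (superdiff (groundEnergy n ℓ 0) v).Nonempty) ∧
    (∀ ρ v ρt : DensSpace ℓ, v = vext + vHxc n ℓ ε ρ →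
      ρt ∈ superdiff (groundEnergy n ℓ 0) v →
      gradient (regF n ℓ ε 1) ρ + vext ≠ 0 →
      ∃ t : ℝ, IsDamping n ℓ ε vext ρ (ρt - ε • v) t) ∧
    (∀ ρ v : DensSpace ℓ, v = vext + vHxc n ℓ ε ρ →
      gradient (regF n ℓ ε 1) ρ + vext = 0 →
      ((energyEstimate n ℓ ε vext ρ + ε * ‖vext‖ ^ 2 / 2 : ℝ) : EReal)
          = groundEnergy n ℓ 1 vext ∧
      ∃ ρt ∈ superdiff (groundEnergy n ℓ 0) v,
        ∃ t : ℝ, IsDamping n ℓ ε vext ρ (ρt - ε • v) t) ∧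
    (∀ (T : ℕ∞) (ρ veff ρt ρ' : ℕ → DensSpace ℓ) (t : ℕ → ℝ),
      IsRun n ℓ ε vext T ρ veff ρt ρ' t →
      (∀ i : ℕ, (i : ℕ∞) < T →
        (veff (i + 1) ≠ vext + vHxc n ℓ ε (ρ (i + 1)) ∨
          gradient (regF n ℓ ε 1) (ρ i) + vext ≠ 0) →
        energyEstimate n ℓ ε vext (ρ (i + 1)) < energyEstimate n ℓ ε vext (ρ i)) ∧
      (∀ i : ℕ, (i : ℕ∞) < T →
        energyEstimate n ℓ ε vext (ρ (i + 1)) ≤ energyEstimate n ℓ ε vext (ρ i)) ∧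
      (∀ i : ℕ, (i : ℕ∞) ≤ T →
        groundEnergy n ℓ 1 vext ≤
          ((energyEstimate n ℓ ε vext (ρ i) + ε * ‖vext‖ ^ 2 / 2 : ℝ) : EReal)) ∧
      (T = ⊤ →
        StrictAnti (fun i => energyEstimate n ℓ ε vext (ρ i)) ∧
        ∃ e : ℝ, Tendsto (fun i => energyEstimate n ℓ ε vext (ρ i)) atTop (𝓝 e) ∧
          groundEnergy n ℓ 1 vext ≤ ((e + ε * ‖vext‖ ^ 2 / 2 : ℝ) : EReal))) := by
  obtain ⟨P₀, h0⟩ := hpair 0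
  obtain ⟨P₁, h1⟩ := hpair 1
  have hcoe : ∀ (lam : ℝ≥0) (v : DensSpace ℓ),
      (((groundEnergy n ℓ lam v).toReal : ℝ) : EReal) = groundEnergy n ℓ lam v := fun lam v =>
    EReal.coe_toReal ((hfin lam).1 v).2 ((hfin lam).1 v).1
  have hsuper : ∀ (v r : DensSpace ℓ), r ∈ superdiff (groundEnergy n ℓ 0) v ↔
      ∀ v', (groundEnergy n ℓ 0 v').toReal ≤ (groundEnergy n ℓ 0 v).toReal + ⟪r, v' - v⟫ := by
    intro v r
    refine forall_congr' fun v' => ?_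
    rw [← hcoe 0 v', ← hcoe 0 v, ← EReal.coe_add, EReal.coe_le_coe_iff, hcoe, hcoe]
  have hsup0 : ∀ v : DensSpace ℓ, (superdiff (groundEnergy n ℓ 0) v).Nonempty := fun v => by
    obtain ⟨r, hr⟩ := h0.exists_superdiff v
    exact ⟨r, (hsuper v r).2 hr⟩
  have hupper : ∀ r : DensSpace ℓ, groundEnergy n ℓ 1 vext ≤
      ((energyEstimate n ℓ ε vext r + ε * ‖vext‖ ^ 2 / 2 : ℝ) : EReal) := fun r => by
    rw [← hcoe 1 vext, EReal.coe_le_coe_iff]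
    have := h1.conj_le hε vext r
    unfold energyEstimate
    linarith
  refine ⟨fun lam _ => ⟨(hfin lam).1, fun ρ => ⟨((hfin lam).2 ρ).1, ((hfin lam).2 ρ).2, ?_⟩⟩,
    ?_, hsup0, ?_, ?_, ?_⟩
  · obtain ⟨P, hP⟩ := hpair lam
    exact (hP.hasGradientAt hε ρ).differentiableAt
  · obtain ⟨r, hr⟩ := h0.exists_superdiff vext
    -- Subtracting the gradient of the quadratic term; the remainder `-(ε / 2) * ‖v' - vext‖ ^ 2`
    -- has the right sign.
    refine ⟨r - ε • vext, fun v' => ?_⟩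
    unfold regE
    rw [← hcoe 0 v', ← hcoe 0 vext, ← EReal.coe_sub, ← EReal.coe_sub, ← EReal.coe_add,
      EReal.coe_le_coe_iff]
    have h3 := hr v'
    have h4 : ‖v'‖ ^ 2 = ‖vext‖ ^ 2 + 2 * ⟪vext, v' - vext⟫ + ‖v' - vext‖ ^ 2 := by
      rw [← norm_add_sq_real]; simp
    rw [inner_sub_left, real_inner_smul_left, h4]
    have : 0 ≤ ε / 2 * ‖v' - vext‖ ^ 2 := by positivity
    linarith
  · intro ρ v ρt hv hρt hne
    exact exists_damping h0 h1 hε hv ((hsuper v ρt).1 hρt) hne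
  · intro ρ v hv hstat
    obtain ⟨h2, ρt, h3, t, h4⟩ := stationary_energy h0 h1 hε hv hstat
    refine ⟨?_, ρt, (hsuper v ρt).2 h3, t, h4⟩
    rw [← hcoe 1 vext, ← h2]
    rfl
  · intro T ρ veff ρt ρ' t hrun
    have hdesc : ∀ i : ℕ, (i : ℕ∞) < T →
        energyEstimate n ℓ ε vext (ρ (i + 1)) ≤ energyEstimate n ℓ ε vext (ρ i) ∧
        (energyEstimate n ℓ ε vext (ρ i) ≤ energyEstimate n ℓ ε vext (ρ (i + 1)) →
          gradient (regF n ℓ ε 1) (ρ i) + vext = 0 ∧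
            veff (i + 1) = vext + vHxc n ℓ ε (ρ (i + 1))) := by
      intro i hi
      obtain ⟨ht0, ht1, hd⟩ := hrun.damping i hi
      have hq := hrun.quasidensity i hi
      have hn := hrun.rho_succ i hi
      rw [← hn] at hd
      rw [hq] at hd hn
      exact descent h0 h1 hε (hrun.veff_succ i hi) ((hsuper _ _).1 (hrun.solve i hi)) ht0 ht1 hn hd
    refine ⟨fun i hi hor => ?_, fun i hi => (hdesc i hi).1, fun i _ => hupper _, fun hT => ?_⟩
    · by_contra hc
      obtain ⟨h2, h3⟩ := (hdesc i hi).2 (not_lt.1 hc)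
      rcases hor with h | h
      · exact h h3
      · exact h h2
    · subst hT
      have hanti : StrictAnti (fun i => energyEstimate n ℓ ε vext (ρ i)) := by
        refine strictAnti_nat_of_succ_lt fun i => ?_
        by_contra hc
        obtain ⟨-, h3⟩ := (hdesc i (ENat.natCast_lt_top i)).2 (not_lt.1 hc)
        exact hrun.continued i (ENat.natCast_lt_top _) h3
      refine ⟨hanti, ?_⟩
      have hlow : ∀ i, (groundEnergy n ℓ 1 vext).toReal - ε * ‖vext‖ ^ 2 / 2
          ≤ energyEstimate n ℓ ε vext (ρ i) := by
        intro i
        have := hupper (ρ i)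
        rw [← hcoe 1 vext, EReal.coe_le_coe_iff] at this
        linarith
      have hbdd : BddBelow (Set.range fun i => energyEstimate n ℓ ε vext (ρ i)) :=
        ⟨_, by rintro _ ⟨i, rfl⟩; exact hlow i⟩
      have hlim := tendsto_atTop_ciInf hanti.antitone hbdd
      refine ⟨_, hlim, ?_⟩
      rw [← hcoe 1 vext, EReal.coe_le_coe_iff]
      have := ge_of_tendsto' hlim hlow
      linarith

/-! ### Form bound of square-integrable potentials relative to the Laplacian -/

section Sobolev

theorem lintegral_enorm_pow_eq {α E : Type*} [MeasurableSpace α] [NormedAddCommGroup E]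
    (μ : Measure α) (f : α → E) (k : ℕ) (hk : k ≠ 0) :
    ∫⁻ x, ‖f x‖ₑ ^ k ∂μ = eLpNorm f k μ ^ k := by
  have h := eLpNorm_nnreal_pow_eq_lintegral (μ := μ) (f := f) (p := (k : ℝ≥0))
    (by exact_mod_cast hk)
  simp only [NNReal.coe_natCast, ENNReal.rpow_natCast, ENNReal.coe_natCast] at h
  exact h.symm

theorem lintegral_mul_sq_le {α : Type*} [MeasurableSpace α] (μ : Measure α) {f g : α → ℝ≥0∞}
    (hf : AEMeasurable f μ) (hg : AEMeasurable g μ) :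
    (∫⁻ x, f x * g x ∂μ) ^ 2 ≤ (∫⁻ x, f x ^ 2 ∂μ) * ∫⁻ x, g x ^ 2 ∂μ := by
  have h := ENNReal.lintegral_mul_le_Lp_mul_Lq μ Real.HolderConjugate.two_two hf hg
  simp only [Pi.mul_apply, ENNReal.rpow_ofNat] at h
  calc (∫⁻ x, f x * g x ∂μ) ^ 2
      ≤ ((∫⁻ x, f x ^ 2 ∂μ) ^ (1 / 2 : ℝ) * (∫⁻ x, g x ^ 2 ∂μ) ^ (1 / 2 : ℝ)) ^ 2 := by gcongr
    _ = _ := by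
      rw [mul_pow, ← ENNReal.rpow_natCast, ← ENNReal.rpow_natCast, ← ENNReal.rpow_mul,
        ← ENNReal.rpow_mul]
      norm_num

/-- The Sobolev inequality on `ℝ³`. -/
theorem exists_sobolev_const : ∃ S : ℝ≥0, ∀ f : Pos → ℂ, ContDiff ℝ 1 f → HasCompactSupport f →
    ∫⁻ x, ‖f x‖ₑ ^ 6 ≤ S * (∫⁻ x, ‖fderiv ℝ f x‖ₑ ^ 2) ^ 3 := by
  refine ⟨SNormLESNormFDerivOfEqConst ℂ (volume : Measure Pos) 2 ^ 6, fun f hf hc => ?_⟩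
  -- The Sobolev exponent of `2` in dimension `3` is `6`.
  have h := eLpNorm_le_eLpNorm_fderiv_of_eq (volume : Measure Pos) hf hc (p := 2) (p' := 6)
    (by norm_num) (by simp) (by simp; norm_num)
  rw [lintegral_enorm_pow_eq _ _ 6 (by norm_num), lintegral_enorm_pow_eq _ _ 2 (by norm_num),
    ← pow_mul]
  calc eLpNorm f (6 : ℕ) volume ^ 6
      ≤ (SNormLESNormFDerivOfEqConst ℂ (volume : Measure Pos) 2 *
        eLpNorm (fderiv ℝ f) (2 : ℕ) volume) ^ 6 := by
        gcongr
        exact_mod_cast h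
    _ = _ := by rw [mul_pow]; push_cast; rfl

/-- Quadratic-form bound of a square-integrable potential relative to the Laplacian on `ℝ³`. -/
theorem lintegral_potential_le {S δ : ℝ≥0}
    (hS : ∀ f : Pos → ℂ, ContDiff ℝ 1 f → HasCompactSupport f →
      ∫⁻ x, ‖f x‖ₑ ^ 6 ≤ S * (∫⁻ x, ‖fderiv ℝ f x‖ₑ ^ 2) ^ 3) (hδ : δ ≠ 0)
    {f : Pos → ℂ} (hf : ContDiff ℝ 1 f) (hc : HasCompactSupport f) {w : Pos → ℝ≥0∞}
    (hw : Measurable w) :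
    ∫⁻ x, w x * ‖f x‖ₑ ^ 2 ≤ (∫⁻ x, w x ^ 2) ^ (1 / 2 : ℝ) *
      (δ * (∫⁻ x, ‖fderiv ℝ f x‖ₑ ^ 2) + (S / (4 * δ ^ 3) : ℝ≥0) * ∫⁻ x, ‖f x‖ₑ ^ 2) := by
  set A := ∫⁻ x, ‖f x‖ₑ ^ 2 with hA
  set D := ∫⁻ x, ‖fderiv ℝ f x‖ₑ ^ 2 with hD
  set C : ℝ≥0 := S / (4 * δ ^ 3) with hC
  have hm : Measurable fun x => ‖f x‖ₑ := hf.continuous.measurable.enorm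
  -- Interpolation of `L⁴` between `L²` and `L⁶`.
  have h1 : (∫⁻ x, ‖f x‖ₑ ^ 4) ^ 2 ≤ A * (S * D ^ 3) := by
    calc (∫⁻ x, ‖f x‖ₑ ^ 4) ^ 2 = (∫⁻ x, ‖f x‖ₑ * ‖f x‖ₑ ^ 3) ^ 2 := by
          congr 2; ext x; ring
      _ ≤ A * ∫⁻ x, (‖f x‖ₑ ^ 3) ^ 2 :=
          lintegral_mul_sq_le _ hm.aemeasurable (hm.pow_const 3).aemeasurable
      _ ≤ _ := by
          gcongr
          simp_rw [← pow_mul]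
          exact hS f hf hc
  -- `C` is chosen so that `A * (S * D ^ 3)` becomes the term `4 * (δ * D) ^ 3 * (C * A)` in the
  -- binomial expansion of `(δ * D + C * A) ^ 4`.
  have hSC : (S : ℝ≥0∞) = 4 * δ ^ 3 * C := by
    rw [hC]
    norm_cast
    field_simp
  have h2 : (∫⁻ x, ‖f x‖ₑ ^ 4) ^ 2 ≤ ((δ * D + C * A) ^ 2) ^ 2 := by
    refine h1.trans ?_
    rw [hSC]
    calc A * (4 * δ ^ 3 * C * D ^ 3) = 4 * ((δ * D) ^ 3 * (C * A)) := by ring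
      _ ≤ 4 * ((δ * D) ^ 3 * (C * A)) + ((δ * D) ^ 4 + 6 * (δ * D) ^ 2 * (C * A) ^ 2
            + 4 * (δ * D) * (C * A) ^ 3 + (C * A) ^ 4) := le_self_add
      _ = _ := by ring
  have h3 : ∫⁻ x, ‖f x‖ₑ ^ 4 ≤ (δ * D + C * A) ^ 2 :=
    (ENNReal.pow_le_pow_left_iff two_ne_zero).1 h2
  have h4 : (∫⁻ x, w x * ‖f x‖ₑ ^ 2) ^ 2
      ≤ ((∫⁻ x, w x ^ 2) ^ (1 / 2 : ℝ) * (δ * D + C * A)) ^ 2 := by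
    refine (lintegral_mul_sq_le _ hw.aemeasurable (hm.pow_const 2).aemeasurable).trans ?_
    rw [mul_pow, ← ENNReal.rpow_natCast, ← ENNReal.rpow_mul]
    norm_num
    gcongr
    simp_rw [← pow_mul]
    exact h3
  exact (ENNReal.pow_le_pow_left_iff two_ne_zero).1 h4

/-- The operator norm is at most the Hilbert–Schmidt norm. -/
theorem enorm_clm_sq_le (L : Pos →L[ℝ] ℂ) :
    ‖L‖ₑ ^ 2 ≤ ∑ a : Fin 3, ‖L (EuclideanSpace.single a 1)‖ₑ ^ 2 := by
  have h : ‖L‖ ≤ √(∑ a : Fin 3, ‖L (EuclideanSpace.single a 1)‖ ^ 2) := by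
    refine L.opNorm_le_bound (Real.sqrt_nonneg _) fun x => ?_
    have hx : x = ∑ a : Fin 3, x a • EuclideanSpace.single a (1 : ℝ) := by
      ext b; simp [Finset.sum_apply, Pi.single_apply]
    calc ‖L x‖ = ‖∑ a : Fin 3, x a • L (EuclideanSpace.single a 1)‖ := by
          conv_lhs => rw [hx, map_sum]
          simp
      _ ≤ ∑ a : Fin 3, ‖L (EuclideanSpace.single a 1)‖ * ‖x a‖ := by
          refine (norm_sum_le _ _).trans (Finset.sum_le_sum fun a _ => ?_)
          rw [norm_smul, mul_comm]
      _ ≤ _ := by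
          rw [EuclideanSpace.norm_eq]
          exact Real.sum_mul_le_sqrt_mul_sqrt _ _ _
  have h2 : ‖L‖ ^ 2 ≤ ∑ a : Fin 3, ‖L (EuclideanSpace.single a 1)‖ ^ 2 := by
    rw [← Real.sqrt_le_sqrt_iff (by positivity), Real.sqrt_sq (norm_nonneg _)]
    exact h
  simp only [← ofReal_norm, ← ENNReal.ofReal_pow (norm_nonneg _)]
  rw [← ENNReal.ofReal_sum_of_nonneg (fun a _ => by positivity)]
  exact ENNReal.ofReal_le_ofReal h2

/-! ### Splitting off the first electron -/

theorem measurable_cons (n : ℕ) :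
    Measurable fun p : Pos × Config n => (Fin.cons p.1 p.2 : Config (n + 1)) := by
  refine measurable_pi_lambda _ fun i => ?_
  refine Fin.cases ?_ (fun j => ?_) i
  · exact measurable_fst
  · exact (measurable_pi_apply j).comp measurable_snd

theorem lintegral_config_succ {n : ℕ} (F : Config (n + 1) → ℝ≥0∞) :
    ∫⁻ r, F r = ∫⁻ p : Pos × Config n, F (Fin.cons p.1 p.2) := by
  have h := (volume_preserving_piFinSuccAbove (fun _ : Fin (n + 1) => Pos) 0).symm
  rw [← h.lintegral_comp_emb (MeasurableEquiv.measurableEmbedding _)]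
  refine lintegral_congr fun p => congrArg F ?_
  exact Fin.insertNth_zero' p.1 p.2

theorem lintegral_config_succ_left {n : ℕ} {F : Config (n + 1) → ℝ≥0∞} (hF : Measurable F) :
    ∫⁻ r, F r = ∫⁻ x : Pos, ∫⁻ y : Config n, F (Fin.cons x y) := by
  rw [lintegral_config_succ F, Measure.volume_eq_prod,
    lintegral_prod (fun p : Pos × Config n => F (Fin.cons p.1 p.2))
      (hF.comp (measurable_cons n)).aemeasurable]

theorem lintegral_config_succ_right {n : ℕ} {F : Config (n + 1) → ℝ≥0∞} (hF : Measurable F) :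
    ∫⁻ r, F r = ∫⁻ y : Config n, ∫⁻ x : Pos, F (Fin.cons x y) := by
  rw [lintegral_config_succ F, Measure.volume_eq_prod,
    lintegral_prod_symm (fun p : Pos × Config n => F (Fin.cons p.1 p.2))
      (hF.comp (measurable_cons n)).aemeasurable]

/-- Exhibits the slice map as affine, which yields the smoothness and the derivative of slices. -/
theorem cons_eq_add_single {n : ℕ} (y : Config n) :
    (fun x : Pos => (Fin.cons x y : Config (n + 1)))
      = fun x => Fin.cons 0 y + ContinuousLinearMap.single ℝ (fun _ : Fin (n + 1) => Pos) 0 x := by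
  ext x i : 2
  refine Fin.cases ?_ (fun j => ?_) i <;> simp

theorem fderiv_slice {n : ℕ} {φ : Config (n + 1) → ℂ} (hφ : ContDiff ℝ 1 φ) (y : Config n)
    (x : Pos) (a : Fin 3) :
    fderiv ℝ (fun x => φ (Fin.cons x y)) x (EuclideanSpace.single a 1)
      = fderiv ℝ φ (Fin.cons x y) (coordDir (n + 1) 0 a) := by
  have h1 : HasFDerivAt (fun x : Pos => (Fin.cons x y : Config (n + 1)))
      (ContinuousLinearMap.single ℝ (fun _ : Fin (n + 1) => Pos) 0) x := by
    rw [cons_eq_add_single y]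
    exact (ContinuousLinearMap.hasFDerivAt _).const_add _
  have h2 := ((hφ.differentiable one_ne_zero) (Fin.cons x y)).hasFDerivAt.comp x h1
  have h3 : fderiv ℝ (fun x => φ (Fin.cons x y)) x = _ := h2.fderiv
  rw [h3]
  rfl

theorem contDiff_slice {n : ℕ} {φ : Config (n + 1) → ℂ} (hφ : ContDiff ℝ 1 φ) (y : Config n) :
    ContDiff ℝ 1 fun x : Pos => φ (Fin.cons x y) := by
  refine hφ.comp (g := φ) (f := fun x : Pos => (Fin.cons x y : Config (n + 1))) ?_
  rw [cons_eq_add_single y]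
  exact contDiff_const.add (ContinuousLinearMap.contDiff _)

theorem hasCompactSupport_slice {n : ℕ} {φ : Config (n + 1) → ℂ} (hφ : HasCompactSupport φ)
    (y : Config n) : HasCompactSupport fun x : Pos => φ (Fin.cons x y) := by
  have hcont : Continuous fun x : Pos => (Fin.cons x y : Config (n + 1)) := by
    rw [cons_eq_add_single y]
    fun_prop
  have hcl : IsClosedEmbedding fun x : Pos => (Fin.cons x y : Config (n + 1)) :=
    Topology.IsClosedEmbedding.of_continuous_injective_isClosedMap hcont
      (fun a b h => by simpa using congrFun h 0) (by
        intro s hs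
        have : (fun x : Pos => (Fin.cons x y : Config (n + 1))) '' s
            = {r | r 0 ∈ s ∧ ∀ j : Fin n, r j.succ = y j} := by
          ext r
          constructor
          · rintro ⟨x, hx, rfl⟩
            simpa using hx
          · rintro ⟨h0, h1⟩
            refine ⟨r 0, h0, ?_⟩
            ext i : 1
            refine Fin.cases ?_ (fun j => ?_) i
            · simp
            · simp [h1]
        rw [this]
        have h2 : IsClosed {r : Config (n + 1) | ∀ j : Fin n, r j.succ = y j} := by
          rw [Set.ofPred_forall]
          exact isClosed_iInter fun j => isClosed_eq (continuous_apply _) continuous_const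
        exact (hs.preimage (continuous_apply 0)).inter h2)
  exact hφ.comp_isClosedEmbedding hcl

/-- The bound on `ℝ³`, applied to each slice in the first electron and integrated over the others;
only the gradient of the first electron appears. -/
theorem lintegral_potential_config_le {S δ : ℝ≥0}
    (hS : ∀ f : Pos → ℂ, ContDiff ℝ 1 f → HasCompactSupport f →
      ∫⁻ x, ‖f x‖ₑ ^ 6 ≤ S * (∫⁻ x, ‖fderiv ℝ f x‖ₑ ^ 2) ^ 3) (hδ : δ ≠ 0)
    {n : ℕ} {φ : Config (n + 1) → ℂ} (hφ : ContDiff ℝ 1 φ) (hc : HasCompactSupport φ)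
    {w : Pos → ℝ≥0∞} (hw : Measurable w) :
    ∫⁻ r, w (r 0) * ‖φ r‖ₑ ^ 2 ≤ (∫⁻ x, w x ^ 2) ^ (1 / 2 : ℝ) *
      (δ * (∑ a : Fin 3, ∫⁻ r, ‖fderiv ℝ φ r (coordDir (n + 1) 0 a)‖ₑ ^ 2)
        + (S / (4 * δ ^ 3) : ℝ≥0) * ∫⁻ r, ‖φ r‖ₑ ^ 2) := by
  have hm : Measurable fun r => ‖φ r‖ₑ ^ 2 := (hφ.continuous.measurable.enorm).pow_const 2
  have hmd : ∀ a, Measurable fun r => ‖fderiv ℝ φ r (coordDir (n + 1) 0 a)‖ₑ ^ 2 := fun a =>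
    (((hφ.continuous_fderiv one_ne_zero).clm_apply continuous_const).measurable.enorm).pow_const 2
  have hmc : ∀ {F : Config (n + 1) → ℝ≥0∞}, Measurable F →
      Measurable fun y : Config n => ∫⁻ x : Pos, F (Fin.cons x y) := fun hF =>
    (hF.comp (measurable_cons n)).lintegral_prod_left'
  have hM : Measurable fun y : Config n => (δ : ℝ≥0∞) *
      (∫⁻ x : Pos, ∑ a : Fin 3, ‖fderiv ℝ φ (Fin.cons x y) (coordDir (n + 1) 0 a)‖ₑ ^ 2)
        + (S / (4 * δ ^ 3) : ℝ≥0) * ∫⁻ x : Pos, ‖φ (Fin.cons x y)‖ₑ ^ 2 :=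
    ((hmc (Finset.measurable_fun_sum _ fun a _ => hmd a)).const_mul _).add ((hmc hm).const_mul _)
  rw [lintegral_config_succ_right (F := fun r => w (r 0) * ‖φ r‖ₑ ^ 2)
      ((hw.comp (measurable_pi_apply 0)).mul hm),
    lintegral_config_succ_right hm, ← lintegral_finsetSum _ (fun a _ => hmd a),
    lintegral_config_succ_right (Finset.measurable_fun_sum _ fun a _ => hmd a),
    ← lintegral_const_mul _ (hmc hm),
    ← lintegral_const_mul _ (hmc (Finset.measurable_fun_sum _ fun a _ => hmd a)),
    ← lintegral_add_right _ ((hmc hm).const_mul _), ← lintegral_const_mul _ hM]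
  refine lintegral_mono fun y => ?_
  simp only [Fin.cons_zero]
  refine (lintegral_potential_le hS hδ (contDiff_slice hφ y) (hasCompactSupport_slice hc y)
    hw).trans ?_
  gcongr with x
  refine (enorm_clm_sq_le _).trans (le_of_eq (Finset.sum_congr rfl fun a _ => ?_))
  rw [fderiv_slice hφ]

/-! ### Extension to the Sobolev space -/

theorem isOpen_box (ℓ : ℝ) : IsOpen (box ℓ) := by
  have : box ℓ = ⋂ a : Fin 3, {r : Pos | |r a| < ℓ} := by ext; simp [box]
  rw [this]
  exact isOpen_iInter_of_finite fun a => isOpen_lt (by fun_prop) continuous_const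

theorem isOpen_configBox (N : ℕ) (ℓ : ℝ) : IsOpen (configBox N ℓ) := by
  have : configBox N ℓ = ⋂ i : Fin N, (fun r : Config N => r i) ⁻¹' box ℓ := by
    ext; simp [configBox]
  rw [this]
  exact isOpen_iInter_of_finite fun i => (isOpen_box ℓ).preimage (continuous_apply i)

theorem lintegral_enorm_sq_Lp {α E : Type*} [MeasurableSpace α] [NormedAddCommGroup E]
    {μ : Measure α} (u : Lp E 2 μ) :
    ∫⁻ x, ‖u x‖ₑ ^ 2 ∂μ = ‖u‖ₑ ^ 2 := by
  rw [lintegral_enorm_pow_eq _ _ 2 two_ne_zero, Lp.enorm_def]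
  rfl

theorem tendsto_lintegral_enorm_sq {α : Type*} [MeasurableSpace α] {μ : Measure α}
    {φ : ℕ → α → ℂ} (hφ : ∀ k, AEStronglyMeasurable (φ k) μ) {u : Lp ℂ 2 μ}
    (h : Tendsto (fun k => eLpNorm (fun r => φ k r - u r) 2 μ) atTop (𝓝 0)) :
    Tendsto (fun k => ∫⁻ r, ‖φ k r‖ₑ ^ 2 ∂μ) atTop (𝓝 (‖u‖ₑ ^ 2)) := by
  have hlp : ∀ k, ∫⁻ r, ‖φ k r‖ₑ ^ 2 ∂μ = eLpNorm (φ k) 2 μ ^ 2 := fun k =>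
    lintegral_enorm_pow_eq _ _ 2 two_ne_zero
  simp_rw [hlp]
  refine ENNReal.Tendsto.pow ?_
  rw [Lp.enorm_def]
  have hu := Lp.aestronglyMeasurable u
  have hfin : eLpNorm u 2 μ ≠ ⊤ := Lp.eLpNorm_ne_top u
  refine tendsto_of_tendsto_of_tendsto_of_le_of_le
    (g := fun k => eLpNorm u 2 μ - eLpNorm (fun r => φ k r - u r) 2 μ)
    (h := fun k => eLpNorm u 2 μ + eLpNorm (fun r => φ k r - u r) 2 μ) ?_ ?_ ?_ ?_
  · simpa using ENNReal.Tendsto.sub tendsto_const_nhds h (Or.inl hfin)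
  · simpa using (tendsto_const_nhds (x := eLpNorm u 2 μ)).add h
  · intro k
    simp only [tsub_le_iff_right]
    have := eLpNorm_sub_le (p := 2) (hφ k) ((hφ k).sub hu) (by norm_num)
    rwa [sub_sub_cancel] at this
  · intro k
    have := eLpNorm_add_le (p := 2) hu ((hφ k).sub hu) (by norm_num)
    rwa [add_sub_cancel] at this

/-- Fatou's lemma along an almost everywhere convergent subsequence of test functions; the
right-hand sides converge by definition of the Sobolev gradient. -/
theorem lintegral_potential_sobolev_le {S δ : ℝ≥0}
    (hS : ∀ f : Pos → ℂ, ContDiff ℝ 1 f → HasCompactSupport f →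
      ∫⁻ x, ‖f x‖ₑ ^ 6 ≤ S * (∫⁻ x, ‖fderiv ℝ f x‖ₑ ^ 2) ^ 3) (hδ : δ ≠ 0)
    {n : ℕ} {ℓ : ℝ} {u : SpatialL2 (n + 1) ℓ} {g : Fin (n + 1) → Fin 3 → SpatialL2 (n + 1) ℓ}
    (hu : HasSobolevGradient (n + 1) ℓ u g) {w : Pos → ℝ≥0∞} (hw : Measurable w)
    (hwfin : ∫⁻ x, w x ^ 2 ≠ ⊤) :
    ∫⁻ r in configBox (n + 1) ℓ, w (r 0) * ‖u r‖ₑ ^ 2 ≤ (∫⁻ x, w x ^ 2) ^ (1 / 2 : ℝ) *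
      (δ * (∑ i, ∑ a, ‖g i a‖ₑ ^ 2) + (S / (4 * δ ^ 3) : ℝ≥0) * ‖u‖ₑ ^ 2) := by
  obtain ⟨φ, hφ, hφu, hφg⟩ := hu
  have hcd : ∀ k, ContDiff ℝ 1 (φ k) := fun k => (hφ k).1.of_le (by exact_mod_cast le_top)
  have hmeas : ∀ k, Measurable (φ k) := fun k => (hφ k).1.continuous.measurable
  have hcfd : ∀ k a, Continuous fun r => fderiv ℝ (φ k) r (coordDir (n + 1) 0 a) := fun k a =>
    ((hcd k).continuous_fderiv one_ne_zero).clm_apply continuous_const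
  obtain ⟨ns, hns, hae⟩ := (tendstoInMeasure_of_tendsto_eLpNorm (p := 2) (by norm_num)
    (fun k => (hmeas k).aestronglyMeasurable) (Lp.aestronglyMeasurable u)
    hφu).exists_seq_tendsto_ae
  set μ := (volume : Measure (Config (n + 1))).restrict (configBox (n + 1) ℓ) with hμ
  have hbound : ∀ k, ∫⁻ r, w (r 0) * ‖φ k r‖ₑ ^ 2 ∂μ ≤ (∫⁻ x, w x ^ 2) ^ (1 / 2 : ℝ) *
      (δ * (∑ a : Fin 3, ∫⁻ r, ‖fderiv ℝ (φ k) r (coordDir (n + 1) 0 a)‖ₑ ^ 2 ∂μ)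
        + (S / (4 * δ ^ 3) : ℝ≥0) * ∫⁻ r, ‖φ k r‖ₑ ^ 2 ∂μ) := by
    intro k
    refine (setLIntegral_le_lintegral _ _).trans ?_
    refine (lintegral_potential_config_le hS hδ (hcd k) (hφ k).2.1 hw).trans (le_of_eq ?_)
    -- Test functions and their derivatives are supported in `Ω^N`, so integrals over the box and
    -- over all space agree.
    have e1 : ∫⁻ r, ‖φ k r‖ₑ ^ 2 ∂μ = ∫⁻ r, ‖φ k r‖ₑ ^ 2 := by
      refine setLIntegral_eq_of_support_subset fun r hr => (hφ k).2.2 (subset_tsupport _ ?_)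
      intro h0
      simp [h0] at hr
    have e2 : ∀ a, ∫⁻ r, ‖fderiv ℝ (φ k) r (coordDir (n + 1) 0 a)‖ₑ ^ 2 ∂μ
        = ∫⁻ r, ‖fderiv ℝ (φ k) r (coordDir (n + 1) 0 a)‖ₑ ^ 2 := by
      intro a
      refine setLIntegral_eq_of_support_subset fun r hr => (hφ k).2.2 ?_
      refine support_fderiv_subset ℝ (f := φ k) ?_
      intro h0
      simp [h0] at hr
    rw [e1]
    simp_rw [e2]
  have hlim : Tendsto (fun k => (∫⁻ x, w x ^ 2) ^ (1 / 2 : ℝ) *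
      (δ * (∑ a : Fin 3, ∫⁻ r, ‖fderiv ℝ (φ k) r (coordDir (n + 1) 0 a)‖ₑ ^ 2 ∂μ)
        + (S / (4 * δ ^ 3) : ℝ≥0) * ∫⁻ r, ‖φ k r‖ₑ ^ 2 ∂μ)) atTop
      (𝓝 ((∫⁻ x, w x ^ 2) ^ (1 / 2 : ℝ) *
      (δ * (∑ a : Fin 3, ‖g 0 a‖ₑ ^ 2) + (S / (4 * δ ^ 3) : ℝ≥0) * ‖u‖ₑ ^ 2))) := by
    refine ENNReal.Tendsto.const_mul (Tendsto.add ?_ ?_)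
      (Or.inr (ENNReal.rpow_ne_top_of_nonneg (by norm_num) hwfin))
    · refine ENNReal.Tendsto.const_mul ?_ (Or.inr ENNReal.coe_ne_top)
      refine tendsto_finsetSum _ fun a _ => ?_
      exact tendsto_lintegral_enorm_sq (fun k => (hcfd k a).aestronglyMeasurable) (hφg 0 a)
    · refine ENNReal.Tendsto.const_mul ?_ (Or.inr ENNReal.coe_ne_top)
      exact tendsto_lintegral_enorm_sq (fun k => (hmeas k).aestronglyMeasurable) hφu
  have hfatou : ∫⁻ r, w (r 0) * ‖u r‖ₑ ^ 2 ∂μ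
      ≤ liminf (fun j => ∫⁻ r, w (r 0) * ‖φ (ns j) r‖ₑ ^ 2 ∂μ) atTop := by
    refine le_trans (lintegral_mono_ae ?_) (lintegral_liminf_le fun j =>
      (hw.comp (measurable_pi_apply 0)).mul ((hmeas (ns j)).enorm.pow_const 2))
    -- Multiplication by `⊤` is not continuous at `0` in `ℝ≥0∞`, so `w` has to be finite for the
    -- pointwise limit.
    have hwae : ∀ᵐ r ∂μ, w (r 0) ≠ ⊤ := by
      have h0 : ∀ᵐ x : Pos, w x ≠ ⊤ := by
        filter_upwards [ae_lt_top (hw.pow_const 2) hwfin] with x hx h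
        simp [h] at hx
      exact ae_restrict_of_ae ((Measure.quasiMeasurePreserving_eval
        (fun _ : Fin (n + 1) => (volume : Measure Pos)) 0).ae h0)
    filter_upwards [hae, hwae] with r hr hwr
    refine le_of_eq (Tendsto.liminf_eq ?_).symm
    refine ENNReal.Tendsto.const_mul (ENNReal.Tendsto.pow ?_) (Or.inr hwr)
    exact hr.enorm
  refine hfatou.trans ((liminf_le_liminf (Eventually.of_forall fun j => hbound (ns j))).trans ?_)
  refine (hlim.comp hns.tendsto_atTop).liminf_eq.le.trans ?_
  gcongr
  exact Finset.single_le_sum (f := fun i => ∑ a, ‖g i a‖ₑ ^ 2) (fun i _ => zero_le)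
    (Finset.mem_univ 0)

end Sobolev

/-! ### One-electron densities belong to `L²` -/

section Density

variable {n N : ℕ} {ℓ : ℝ}

theorem isBounded_box (ℓ : ℝ) : Bornology.IsBounded (box ℓ) := by
  refine (Metric.isBounded_iff_subset_closedBall 0).2 ⟨√(3 * ℓ ^ 2), fun r hr => ?_⟩
  rw [mem_closedBall_zero_iff, EuclideanSpace.norm_eq]
  refine Real.sqrt_le_sqrt ?_
  have h : ∀ a : Fin 3, ‖r a‖ ^ 2 ≤ ℓ ^ 2 := fun a => by
    rw [Real.norm_eq_abs]
    exact pow_le_pow_left₀ (abs_nonneg _) (hr a).le 2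
  calc ∑ a : Fin 3, ‖r a‖ ^ 2 ≤ ∑ _a : Fin 3, ℓ ^ 2 := Finset.sum_le_sum fun a _ => h a
    _ = 3 * ℓ ^ 2 := by simp

instance isFiniteMeasure_box (ℓ : ℝ) : IsFiniteMeasure ((volume : Measure Pos).restrict (box ℓ)) :=
  ⟨by simpa using (isBounded_box ℓ).measure_lt_top⟩

/-- The quadratic form of a multiplication operator. -/
def potentialForm (N : ℕ) (ℓ : ℝ) (q : Config N → ℝ≥0∞) (ψ : WaveL2 N ℓ) : ℝ≥0∞ :=
  ∑ s : Fin N → Fin 2, ∫⁻ r in configBox N ℓ, q r * ‖ψ s r‖ₑ ^ 2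

/-- The quadratic form of the Dirichlet Laplacian. -/
def kineticForm (N : ℕ) (ℓ : ℝ) (ψ : WaveL2 N ℓ) : ℝ≥0∞ :=
  ∑ s : Fin N → Fin 2, gradSq N ℓ (ψ s)

theorem potentialForm_one (ψ : WaveL2 N ℓ) : potentialForm N ℓ (fun _ => 1) ψ = ‖ψ‖ₑ ^ 2 := by
  have h : ‖ψ‖ ^ 2 = ∑ s, ‖ψ s‖ ^ 2 := PiLp.norm_sq_eq_of_L2 _ ψ
  simp only [potentialForm, one_mul, lintegral_enorm_sq_Lp]
  simp only [← ofReal_norm, ← ENNReal.ofReal_pow (norm_nonneg _)]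
  rw [h, ENNReal.ofReal_sum_of_nonneg fun s _ => by positivity]

theorem measurable_wave (ψ : WaveL2 N ℓ) (s : Fin N → Fin 2) : Measurable (ψ s) :=
  (Lp.stronglyMeasurable (ψ s)).measurable

/-- The one-electron density as an extended nonnegative function. -/
def edensity (n : ℕ) (ℓ : ℝ) (ψ : WaveL2 (n + 1) ℓ) (r : Pos) : ℝ≥0∞ :=
  (n + 1 : ℝ≥0∞) * ∑ s : Fin (n + 1) → Fin 2,
    ∫⁻ y in configBox n ℓ, ‖ψ s (Fin.cons r y : Config (n + 1))‖ₑ ^ 2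

theorem measurable_edensity (ψ : WaveL2 (n + 1) ℓ) : Measurable (edensity n ℓ ψ) := by
  refine Measurable.const_mul (Finset.measurable_fun_sum _ fun s _ => ?_) _
  exact Measurable.lintegral_prod_right'
    (f := fun p : Pos × Config n => ‖ψ s (Fin.cons p.1 p.2 : Config (n + 1))‖ₑ ^ 2)
    ((((measurable_wave ψ s).comp (measurable_cons n)).enorm).pow_const 2)

theorem setLIntegral_config_succ {F : Config (n + 1) → ℝ≥0∞} (hF : Measurable F) :
    ∫⁻ r in configBox (n + 1) ℓ, F r
      = ∫⁻ x in box ℓ, ∫⁻ y in configBox n ℓ, F (Fin.cons x y) := by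
  have hm : MeasurableSet (configBox (n + 1) ℓ) := (isOpen_configBox _ _).measurableSet
  have hm' : MeasurableSet (configBox n ℓ) := (isOpen_configBox _ _).measurableSet
  have hb : MeasurableSet (box ℓ) := (isOpen_box ℓ).measurableSet
  rw [← lintegral_indicator hm, lintegral_config_succ_left (hF.indicator hm),
    ← lintegral_indicator hb]
  refine lintegral_congr fun x => ?_
  by_cases hx : x ∈ box ℓ
  · rw [Set.indicator_of_mem hx, ← lintegral_indicator hm']
    refine lintegral_congr fun y => ?_
    have hiff : (Fin.cons x y : Config (n + 1)) ∈ configBox (n + 1) ℓ ↔ y ∈ configBox n ℓ := by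
      simp [configBox, Fin.forall_fin_succ, hx]
    by_cases hy : y ∈ configBox n ℓ
    · rw [Set.indicator_of_mem hy, Set.indicator_of_mem (hiff.2 hy)]
    · rw [Set.indicator_of_notMem hy, Set.indicator_of_notMem (hiff.not.2 hy)]
  · rw [Set.indicator_of_notMem hx]
    have h0 : ∀ y : Config n, (configBox (n + 1) ℓ).indicator F (Fin.cons x y) = 0 := fun y =>
      Set.indicator_of_notMem (fun h => hx (by simpa using h 0)) _
    simp [h0]

/-- Tonelli's theorem; antisymmetry plays no role because the density is defined through the first
electron. -/
theorem lintegral_mul_edensity (ψ : WaveL2 (n + 1) ℓ) {w : Pos → ℝ≥0∞} (hw : Measurable w) :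
    ∫⁻ x in box ℓ, w x * edensity n ℓ ψ x
      = (n + 1 : ℝ≥0∞) * potentialForm (n + 1) ℓ (fun r => w (r 0)) ψ := by
  have hms : ∀ s, Measurable fun p : Pos × Config n =>
      ‖ψ s (Fin.cons p.1 p.2 : Config (n + 1))‖ₑ ^ 2 := fun s =>
    (((measurable_wave ψ s).comp (measurable_cons n)).enorm).pow_const 2
  have hmi : ∀ s, Measurable fun x : Pos =>
      ∫⁻ y in configBox n ℓ, ‖ψ s (Fin.cons x y : Config (n + 1))‖ₑ ^ 2 := fun s =>
    Measurable.lintegral_prod_right' (hms s)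
  have hmw : ∀ s, Measurable fun x : Pos =>
      w x * ∫⁻ y in configBox n ℓ, ‖ψ s (Fin.cons x y : Config (n + 1))‖ₑ ^ 2 := fun s =>
    hw.mul (hmi s)
  have hsl : ∀ s (x : Pos), Measurable fun y : Config n =>
      ‖ψ s (Fin.cons x y : Config (n + 1))‖ₑ ^ 2 := fun s x =>
    ((((measurable_wave ψ s).comp (measurable_cons n)).comp
      (measurable_prodMk_left (x := x))).enorm).pow_const 2
  have hF : ∀ s, Measurable fun r : Config (n + 1) => w (r 0) * ‖ψ s r‖ₑ ^ 2 := fun s =>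
    (hw.comp (measurable_pi_apply 0)).mul ((measurable_wave ψ s).enorm.pow_const 2)
  calc ∫⁻ x in box ℓ, w x * edensity n ℓ ψ x
      = ∫⁻ x in box ℓ, (n + 1 : ℝ≥0∞) * ∑ s : Fin (n + 1) → Fin 2,
        w x * ∫⁻ y in configBox n ℓ, ‖ψ s (Fin.cons x y : Config (n + 1))‖ₑ ^ 2 := by
        refine lintegral_congr fun x => ?_
        rw [edensity, Finset.mul_sum, Finset.mul_sum, Finset.mul_sum]
        exact Finset.sum_congr rfl fun s _ => by ring
    _ = (n + 1 : ℝ≥0∞) * ∑ s : Fin (n + 1) → Fin 2, ∫⁻ x in box ℓ,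
        w x * ∫⁻ y in configBox n ℓ, ‖ψ s (Fin.cons x y : Config (n + 1))‖ₑ ^ 2 := by
        rw [lintegral_const_mul _ (Finset.measurable_fun_sum _ fun s _ => hmw s),
          lintegral_finsetSum _ fun s _ => hmw s]
    _ = _ := by
        congr 1
        refine Finset.sum_congr rfl fun s _ => ?_
        rw [setLIntegral_config_succ (hF s)]
        refine lintegral_congr fun x => ?_
        simp only [Fin.cons_zero]
        exact (lintegral_const_mul (w x) (hsl s x)).symm

theorem edensity_ae_lt_top (ψ : WaveL2 (n + 1) ℓ) :
    ∀ᵐ r ∂((volume : Measure Pos).restrict (box ℓ)), edensity n ℓ ψ r < ⊤ := by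
  refine ae_lt_top (measurable_edensity ψ) ?_
  have h := lintegral_mul_edensity ψ (w := fun _ => 1) measurable_const
  simp only [one_mul] at h
  rw [h, potentialForm_one]
  exact ENNReal.mul_ne_top (by exact_mod_cast ENNReal.natCast_ne_top (n + 1))
    (ENNReal.pow_ne_top enorm_ne_top)

/-- Finiteness matters: the Bochner integral is `0` for a component that is not integrable. -/
theorem density_eq_toReal_of_lt_top (ψ : WaveL2 (n + 1) ℓ) {r : Pos} (h : edensity n ℓ ψ r < ⊤) :
    density n ℓ ψ r = (edensity n ℓ ψ r).toReal := by
  have hsum : ∑ s : Fin (n + 1) → Fin 2,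
      ∫⁻ y in configBox n ℓ, ‖ψ s (Fin.cons r y : Config (n + 1))‖ₑ ^ 2 ≠ ⊤ := by
    intro h0
    rw [edensity, h0, ENNReal.mul_top (by simp)] at h
    exact lt_irrefl _ h
  rw [density, edensity, ENNReal.toReal_mul, ENNReal.toReal_sum]
  · congr 1
    refine Finset.sum_congr rfl fun s _ => ?_
    have hm : Measurable fun y : Config n => ψ s (Fin.cons r y : Config (n + 1)) :=
      ((measurable_wave ψ s).comp (measurable_cons n)).comp measurable_prodMk_left
    rw [integral_eq_lintegral_of_nonneg_ae (Eventually.of_forall fun y => by positivity)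
      (hm.norm.pow_const 2).aestronglyMeasurable]
    congr 1
    refine lintegral_congr fun y => ?_
    rw [ENNReal.ofReal_pow (norm_nonneg _), ofReal_norm]
  · exact fun s hs => (ENNReal.sum_ne_top.1 hsum) s hs

theorem density_ae_eq (ψ : WaveL2 (n + 1) ℓ) :
    density n ℓ ψ =ᵐ[(volume : Measure Pos).restrict (box ℓ)]
      fun r => (edensity n ℓ ψ r).toReal := by
  filter_upwards [edensity_ae_lt_top ψ] with r hr using density_eq_toReal_of_lt_top ψ hr

theorem enorm_density_ae_eq (ψ : WaveL2 (n + 1) ℓ) :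
    (fun r => ‖density n ℓ ψ r‖ₑ) =ᵐ[(volume : Measure Pos).restrict (box ℓ)]
      edensity n ℓ ψ := by
  filter_upwards [edensity_ae_lt_top ψ] with r hr
  rw [density_eq_toReal_of_lt_top ψ hr, Real.enorm_eq_ofReal ENNReal.toReal_nonneg,
    ENNReal.ofReal_toReal hr.ne]

theorem gradSq_le {u : SpatialL2 N ℓ} {g : Fin N → Fin 3 → SpatialL2 N ℓ}
    (h : HasSobolevGradient N ℓ u g) : gradSq N ℓ u ≤ ∑ i, ∑ a, ‖g i a‖ₑ ^ 2 :=
  iInf₂_le g h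

theorem gradSq_ne_top {u : SpatialL2 N ℓ} (h : ∃ g, HasSobolevGradient N ℓ u g) :
    gradSq N ℓ u ≠ ⊤ := by
  obtain ⟨g, hg⟩ := h
  refine ne_top_of_le_ne_top ?_ (gradSq_le hg)
  exact ENNReal.sum_ne_top.2 fun i _ => ENNReal.sum_ne_top.2 fun a _ =>
    ENNReal.pow_ne_top enorm_ne_top

theorem exists_gradient_lt {u : SpatialL2 N ℓ} {x : ℝ≥0∞} (h : gradSq N ℓ u < x) :
    ∃ g, HasSobolevGradient N ℓ u g ∧ ∑ i, ∑ a, ‖g i a‖ₑ ^ 2 < x := by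
  simpa only [gradSq, iInf_lt_iff, exists_prop] using h

theorem kineticForm_ne_top {ψ : WaveL2 N ℓ} (h : ∀ s, ∃ g, HasSobolevGradient N ℓ (ψ s) g) :
    kineticForm N ℓ ψ ≠ ⊤ :=
  ENNReal.sum_ne_top.2 fun s _ => gradSq_ne_top (h s)

/-- Relative form bound of a one-electron potential with respect to the kinetic energy. -/
theorem exists_edensity_bound {δ : ℝ≥0} (hδ : δ ≠ 0) : ∃ C : ℝ≥0, ∀ (n : ℕ) (ℓ : ℝ)
    (ψ : WaveL2 (n + 1) ℓ), (∀ s, ∃ g, HasSobolevGradient (n + 1) ℓ (ψ s) g) →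
    ∀ w : Pos → ℝ≥0∞, Measurable w → ∫⁻ x in box ℓ, w x ^ 2 ≠ ⊤ →
    ∫⁻ x in box ℓ, w x * edensity n ℓ ψ x ≤ (n + 1 : ℝ≥0∞) *
      ((∫⁻ x in box ℓ, w x ^ 2) ^ (1 / 2 : ℝ) * (δ * kineticForm (n + 1) ℓ ψ + C * ‖ψ‖ₑ ^ 2)) := by
  obtain ⟨S, hS⟩ := exists_sobolev_const
  refine ⟨S / (4 * δ ^ 3), fun n ℓ ψ hψ w hw hwfin => ?_⟩
  have hb : MeasurableSet (box ℓ) := (isOpen_box ℓ).measurableSet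
  rw [lintegral_mul_edensity ψ hw]
  refine mul_le_mul_right ?_ _
  rw [← potentialForm_one ψ, kineticForm, potentialForm, potentialForm, Finset.mul_sum,
    Finset.mul_sum, ← Finset.sum_add_distrib, Finset.mul_sum]
  refine Finset.sum_le_sum fun s _ => ?_
  simp only [one_mul, lintegral_enorm_sq_Lp]
  -- The bound on `ℝ³` needs a potential that is square integrable on the whole space.
  set w' : Pos → ℝ≥0∞ := (box ℓ).indicator w with hw'
  have hsq : ∫⁻ x, w' x ^ 2 = ∫⁻ x in box ℓ, w x ^ 2 := by
    rw [← lintegral_indicator hb]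
    refine lintegral_congr fun x => ?_
    by_cases hx : x ∈ box ℓ <;> simp [hw', hx]
  have hLHS : ∫⁻ r in configBox (n + 1) ℓ, w (r 0) * ‖ψ s r‖ₑ ^ 2
      = ∫⁻ r in configBox (n + 1) ℓ, w' (r 0) * ‖ψ s r‖ₑ ^ 2 := by
    refine setLIntegral_congr_fun (isOpen_configBox _ _).measurableSet fun r hr => ?_
    simp only [hw', Set.indicator_of_mem (hr 0)]
  rw [hLHS, ← hsq]
  -- `gradSq` is an infimum, so a gradient is chosen with slack `1 / k` and `k` tends to infinity;
  -- at `k = 0` the slack is `⊤`.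
  have hbound : ∀ k : ℕ, ∫⁻ r in configBox (n + 1) ℓ, w' (r 0) * ‖ψ s r‖ₑ ^ 2
      ≤ (∫⁻ x, w' x ^ 2) ^ (1 / 2 : ℝ) * (δ * (gradSq (n + 1) ℓ (ψ s) + (k : ℝ≥0∞)⁻¹)
        + (S / (4 * δ ^ 3) : ℝ≥0) * ‖ψ s‖ₑ ^ 2) := by
    intro k
    obtain ⟨g, hg, hlt⟩ := exists_gradient_lt
      (ENNReal.lt_add_right (gradSq_ne_top (hψ s))
        (ENNReal.inv_ne_zero.2 (ENNReal.natCast_ne_top k)))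
    refine (lintegral_potential_sobolev_le hS hδ hg (hw.indicator hb) (hsq ▸ hwfin)).trans ?_
    gcongr
  refine ge_of_tendsto' (x := atTop) ?_ hbound
  refine ENNReal.Tendsto.const_mul (Tendsto.add_const _ ?_)
    (Or.inr (ENNReal.rpow_ne_top_of_nonneg (by norm_num) (hsq ▸ hwfin)))
  refine ENNReal.Tendsto.const_mul ?_ (Or.inr ENNReal.coe_ne_top)
  simpa using ENNReal.tendsto_inv_nat_nhds_zero.const_add (gradSq (n + 1) ℓ (ψ s))

/-- Converse of Hölder's inequality. -/
theorem lintegral_sq_le_of_pairing {α : Type*} [MeasurableSpace α] {μ : Measure α}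
    [IsFiniteMeasure μ] {f : α → ℝ≥0∞} (hf : Measurable f) {K : ℝ≥0∞}
    (h : ∀ w : α → ℝ≥0∞, Measurable w → ∫⁻ x, w x ^ 2 ∂μ ≠ ⊤ →
      ∫⁻ x, w x * f x ∂μ ≤ K * (∫⁻ x, w x ^ 2 ∂μ) ^ (1 / 2 : ℝ)) :
    ∫⁻ x, f x ^ 2 ∂μ ≤ K ^ 2 := by
  -- The truncation is its own test function. On a finite measure its square integral is finite and
  -- can be cancelled.
  have hk : ∀ k : ℕ, ∫⁻ x, min (f x) k ^ 2 ∂μ ≤ K ^ 2 := by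
    intro k
    have hm : Measurable fun x => min (f x) (k : ℝ≥0∞) := hf.min measurable_const
    set X := ∫⁻ x, min (f x) k ^ 2 ∂μ with hX
    have hXfin : X ≠ ⊤ := by
      refine ne_top_of_le_ne_top (b := ∫⁻ _x, (k : ℝ≥0∞) ^ 2 ∂μ) ?_ ?_
      · rw [lintegral_const]
        exact ENNReal.mul_ne_top (ENNReal.pow_ne_top (ENNReal.natCast_ne_top k))
          (measure_ne_top μ _)
      · exact lintegral_mono fun x => by gcongr; exact min_le_right _ _
    have h1 : X ≤ K * X ^ (1 / 2 : ℝ) := by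
      refine le_trans (lintegral_mono fun x => ?_) (h _ hm hXfin)
      rw [pow_two]
      gcongr
      exact min_le_left _ _
    have h2 : X ^ 2 ≤ K ^ 2 * X := by
      calc X ^ 2 ≤ (K * X ^ (1 / 2 : ℝ)) ^ 2 := by gcongr
        _ = K ^ 2 * X := by
          rw [mul_pow, ← ENNReal.rpow_natCast (X ^ (1 / 2 : ℝ)), ← ENNReal.rpow_mul]
          norm_num
    rcases eq_or_ne X 0 with h0 | h0
    · rw [h0]; exact zero_le
    · rw [pow_two] at h2
      exact (ENNReal.mul_le_mul_iff_left h0 hXfin).1 h2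
  have hsup : ∀ x, f x ^ 2 = ⨆ k : ℕ, min (f x) k ^ 2 := by
    intro x
    refine le_antisymm ?_ (iSup_le fun k => by gcongr; exact min_le_left _ _)
    refine le_of_tendsto' (x := atTop) (f := fun k : ℕ => min (f x) (k : ℝ≥0∞) ^ 2) ?_
      (fun k => le_iSup (fun k : ℕ => min (f x) (k : ℝ≥0∞) ^ 2) k)
    refine ENNReal.Tendsto.pow ?_
    have := (tendsto_const_nhds (x := f x)).min ENNReal.tendsto_nat_nhds_top
    simpa using this
  simp_rw [hsup]
  rw [lintegral_iSup (fun k => (hf.min measurable_const).pow_const 2)]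
  · exact iSup_le hk
  · intro j k hjk x
    simp only
    gcongr

/-- The form bound with `δ = 1` makes pairing with the density a bounded functional on `L²`. -/
theorem memLp_density {ψ : WaveL2 (n + 1) ℓ}
    (hψ : ∀ s, ∃ g, HasSobolevGradient (n + 1) ℓ (ψ s) g) :
    MemLp (density n ℓ ψ) 2 ((volume : Measure Pos).restrict (box ℓ)) := by
  refine (memLp_congr_ae (density_ae_eq ψ)).2
    ⟨(measurable_edensity ψ).ennreal_toReal.aestronglyMeasurable, ?_⟩
  obtain ⟨C, hC⟩ := exists_edensity_bound (one_ne_zero (α := ℝ≥0))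
  have hK : (n + 1 : ℝ≥0∞) * ((1 : ℝ≥0) * kineticForm (n + 1) ℓ ψ + C * ‖ψ‖ₑ ^ 2) ≠ ⊤ := by
    refine ENNReal.mul_ne_top (by exact_mod_cast ENNReal.natCast_ne_top (n + 1)) ?_
    refine ENNReal.add_ne_top.2 ⟨ENNReal.mul_ne_top ENNReal.coe_ne_top (kineticForm_ne_top hψ),
      ENNReal.mul_ne_top ENNReal.coe_ne_top (ENNReal.pow_ne_top enorm_ne_top)⟩
  have h := lintegral_sq_le_of_pairing (μ := (volume : Measure Pos).restrict (box ℓ))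
    (measurable_edensity ψ) (K := (n + 1 : ℝ≥0∞) *
      ((1 : ℝ≥0) * kineticForm (n + 1) ℓ ψ + C * ‖ψ‖ₑ ^ 2)) (fun w hw hwfin => by
        refine (hC n ℓ ψ hψ w hw hwfin).trans (le_of_eq (by ring)))
  have h2 : eLpNorm (fun r => (edensity n ℓ ψ r).toReal) 2
      ((volume : Measure Pos).restrict (box ℓ)) ^ 2 < ⊤ := by
    have := lintegral_enorm_pow_eq ((volume : Measure Pos).restrict (box ℓ))
      (fun r => (edensity n ℓ ψ r).toReal) 2 two_ne_zero
    rw [Nat.cast_ofNat] at this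
    rw [← this]
    refine lt_of_le_of_lt (lintegral_mono fun r => ?_) (h.trans_lt (ENNReal.pow_lt_top hK.lt_top))
    rw [Real.enorm_eq_ofReal ENNReal.toReal_nonneg]
    gcongr
    exact ENNReal.ofReal_toReal_le
  by_contra hc
  rw [not_lt, top_le_iff] at hc
  simp [hc] at h2

end Density

/-! ### Finite-energy wavefunctions and unitary mixing of ensembles -/

section Mixing

variable {n N : ℕ} {ℓ : ℝ}

/-! ### The wavefunctions of finite kinetic energy form a subspace -/

theorem HasSobolevGradient.zero : HasSobolevGradient N ℓ 0 fun _ _ => 0 := by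
  have h0 := Lp.coeFn_zero ℂ 2 ((volume : Measure (Config N)).restrict (configBox N ℓ))
  refine ⟨fun _ _ => 0, fun k => ⟨contDiff_const, HasCompactSupport.zero, ?_⟩, ?_, fun i a => ?_⟩
  · simp [tsupport]
  · refine tendsto_const_nhds.congr fun k => ?_
    rw [eLpNorm_congr_ae (g := 0) (h0.mono fun r hr => by rw [hr]; simp)]
    simp
  · refine tendsto_const_nhds.congr fun k => ?_
    rw [eLpNorm_congr_ae (g := 0) (h0.mono fun r hr => by rw [hr]; simp)]
    simp

theorem HasSobolevGradient.add {u u' : SpatialL2 N ℓ} {g g' : Fin N → Fin 3 → SpatialL2 N ℓ}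
    (h : HasSobolevGradient N ℓ u g) (h' : HasSobolevGradient N ℓ u' g') :
    HasSobolevGradient N ℓ (u + u') fun i a => g i a + g' i a := by
  obtain ⟨φ, h1, h2, h3⟩ := h
  obtain ⟨φ', h1', h2', h3'⟩ := h'
  have hlim : ∀ {f f' : ℕ → Config N → ℂ} {v v' : SpatialL2 N ℓ},
      (∀ k, Continuous (f k)) → (∀ k, Continuous (f' k)) →
      Tendsto (fun k => eLpNorm (fun r => f k r - v r) 2
        ((volume : Measure (Config N)).restrict (configBox N ℓ))) atTop (𝓝 0) →
      Tendsto (fun k => eLpNorm (fun r => f' k r - v' r) 2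
        ((volume : Measure (Config N)).restrict (configBox N ℓ))) atTop (𝓝 0) →
      Tendsto (fun k => eLpNorm (fun r => f k r + f' k r - (v + v' : SpatialL2 N ℓ) r) 2
        ((volume : Measure (Config N)).restrict (configBox N ℓ))) atTop (𝓝 0) := by
    intro f f' v v' hf hf' ht ht'
    refine tendsto_of_tendsto_of_tendsto_of_le_of_le tendsto_const_nhds
      (by simpa using ht.add ht') (fun k => zero_le) fun k => ?_
    rw [eLpNorm_congr_ae (g := (fun r => f k r - v r) + fun r => f' k r - v' r)]
    · exact eLpNorm_add_le (((hf k).aestronglyMeasurable).sub (Lp.aestronglyMeasurable v))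
        (((hf' k).aestronglyMeasurable).sub (Lp.aestronglyMeasurable v')) (by norm_num)
    · filter_upwards [Lp.coeFn_add v v'] with r hr
      rw [hr]
      simp only [Pi.add_apply]
      ring
  have hc : ∀ {f : Config N → ℂ}, ContDiff ℝ ((⊤ : ℕ∞) : WithTop ℕ∞) f → ∀ i a,
      Continuous fun r => fderiv ℝ f r (coordDir N i a) := fun hf i a =>
    (hf.continuous_fderiv (by simp)).clm_apply continuous_const
  refine ⟨fun k r => φ k r + φ' k r, fun k => ⟨(h1 k).1.add (h1' k).1,
    (h1 k).2.1.add (h1' k).2.1, ?_⟩, hlim (fun k => (h1 k).1.continuous)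
    (fun k => (h1' k).1.continuous) h2 h2', fun i a => ?_⟩
  · exact (tsupport_add (φ k) (φ' k)).trans (Set.union_subset (h1 k).2.2 (h1' k).2.2)
  · refine (hlim (fun k => hc (h1 k).1 i a) (fun k => hc (h1' k).1 i a) (h3 i a)
      (h3' i a)).congr fun k => ?_
    congr 1
    ext r
    rw [fderiv_fun_add ((h1 k).1.differentiable (by simp) r)
      ((h1' k).1.differentiable (by simp) r)]
    rfl

theorem HasSobolevGradient.smul {u : SpatialL2 N ℓ} {g : Fin N → Fin 3 → SpatialL2 N ℓ}
    (h : HasSobolevGradient N ℓ u g) (c : ℂ) :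
    HasSobolevGradient N ℓ (c • u) fun i a => c • g i a := by
  obtain ⟨φ, h1, h2, h3⟩ := h
  have hlim : ∀ {f : ℕ → Config N → ℂ} {v : SpatialL2 N ℓ},
      Tendsto (fun k => eLpNorm (fun r => f k r - v r) 2
        ((volume : Measure (Config N)).restrict (configBox N ℓ))) atTop (𝓝 0) →
      Tendsto (fun k => eLpNorm (fun r => c * f k r - (c • v : SpatialL2 N ℓ) r) 2
        ((volume : Measure (Config N)).restrict (configBox N ℓ))) atTop (𝓝 0) := by
    intro f v ht
    have := ENNReal.Tendsto.const_mul (a := ‖c‖ₑ) ht (Or.inr enorm_ne_top)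
    rw [mul_zero] at this
    refine this.congr fun k => ?_
    rw [← eLpNorm_const_smul]
    refine eLpNorm_congr_ae ?_
    filter_upwards [Lp.coeFn_smul c v] with r hr
    rw [hr]
    simp [mul_sub]
  refine ⟨fun k r => c * φ k r, fun k => ⟨contDiff_const.mul (h1 k).1,
    (h1 k).2.1.mul_left, ?_⟩, hlim h2, fun i a => ?_⟩
  · exact (tsupport_mul_subset_right (f := fun _ => c) (g := φ k)).trans (h1 k).2.2
  · refine (hlim (h3 i a)).congr fun k => ?_
    congr 1
    ext r
    rw [fderiv_const_mul ((h1 k).1.differentiable (by simp) r)]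
    rfl

theorem HasSobolevGradient.sum {ι : Type*} (t : Finset ι) {u : ι → SpatialL2 N ℓ}
    {g : ι → Fin N → Fin 3 → SpatialL2 N ℓ} (h : ∀ k, HasSobolevGradient N ℓ (u k) (g k)) :
    HasSobolevGradient N ℓ (∑ k ∈ t, u k) fun i a => ∑ k ∈ t, g k i a := by
  classical
  induction t using Finset.induction_on with
  | empty => simpa using HasSobolevGradient.zero
  | insert k t hk ih =>
    simp only [Finset.sum_insert hk]
    exact (h k).add ih

/-- Allows almost everywhere identities to be evaluated at permuted configurations. -/
theorem measurePreserving_comp_perm (σ : Equiv.Perm (Fin N)) :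
    MeasurePreserving (fun r : Config N => r ∘ σ)
      ((volume : Measure (Config N)).restrict (configBox N ℓ))
      ((volume : Measure (Config N)).restrict (configBox N ℓ)) := by
  have h := volume_measurePreserving_piCongrLeft (fun _ : Fin N => Pos) σ.symm
  have he : ⇑(MeasurableEquiv.piCongrLeft (fun _ : Fin N => Pos) σ.symm)
      = fun r : Config N => r ∘ σ := by
    ext r i : 2
    have := MeasurableEquiv.piCongrLeft_apply_apply σ.symm (β := fun _ : Fin N => Pos) r (σ i)
    simpa using this
  rw [he] at h
  have h2 := h.restrict_preimage (isOpen_configBox N ℓ).measurableSet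
  have h3 : (fun r : Config N => r ∘ σ) ⁻¹' configBox N ℓ = configBox N ℓ := by
    ext r
    simp only [Set.mem_preimage, configBox]
    exact σ.forall_congr_left.trans (by simp)
  rwa [h3] at h2

/-- Antisymmetric wavefunctions with components in `H¹₀`. -/
def finiteEnergyWaves (N : ℕ) (ℓ : ℝ) : Submodule ℂ (WaveL2 N ℓ) where
  carrier := {ψ | IsAntisymmetric N ℓ ψ ∧ ∀ s, ∃ g, HasSobolevGradient N ℓ (ψ s) g}
  zero_mem' := by
    refine ⟨fun σ s => ?_, fun s => ⟨_, HasSobolevGradient.zero⟩⟩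
    have h0 := Lp.coeFn_zero ℂ 2 ((volume : Measure (Config N)).restrict (configBox N ℓ))
    filter_upwards [h0, (measurePreserving_comp_perm σ).quasiMeasurePreserving.ae h0]
      with r hr hr'
    change (0 : SpatialL2 N ℓ) (r ∘ σ) = _ * (0 : SpatialL2 N ℓ) r
    rw [hr, hr']
    simp
  add_mem' := by
    rintro ψ φ ⟨h1, h2⟩ ⟨h1', h2'⟩
    refine ⟨fun σ s => ?_, fun s => ?_⟩
    · filter_upwards [h1 σ s, h1' σ s, Lp.coeFn_add (ψ s) (φ s),
        (measurePreserving_comp_perm σ).quasiMeasurePreserving.ae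
          (Lp.coeFn_add (ψ (s ∘ σ)) (φ (s ∘ σ)))] with r e1 e2 e3 e4
      simp only [PiLp.add_apply, Pi.add_apply] at e3 e4 ⊢
      rw [e3, e4, e1, e2, mul_add]
    · obtain ⟨g, hg⟩ := h2 s
      obtain ⟨g', hg'⟩ := h2' s
      exact ⟨_, hg.add hg'⟩
  smul_mem' := by
    rintro c ψ ⟨h1, h2⟩
    refine ⟨fun σ s => ?_, fun s => ?_⟩
    · filter_upwards [h1 σ s, Lp.coeFn_smul c (ψ s),
        (measurePreserving_comp_perm σ).quasiMeasurePreserving.ae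
          (Lp.coeFn_smul c (ψ (s ∘ σ)))] with r e1 e2 e3
      simp only [PiLp.smul_apply, Pi.smul_apply, smul_eq_mul] at e2 e3 ⊢
      rw [e3, e2, e1]
      ring
    · obtain ⟨g, hg⟩ := h2 s
      exact ⟨_, hg.smul c⟩

theorem mem_waveSet_iff {ψ : WaveL2 N ℓ} :
    ψ ∈ waveSet N ℓ ↔ ‖ψ‖ = 1 ∧ ψ ∈ finiteEnergyWaves N ℓ := Iff.rfl

/-! ### Homogeneity of the energies -/

theorem gradSq_zero : gradSq N ℓ 0 = 0 := by
  have := gradSq_le (HasSobolevGradient.zero (N := N) (ℓ := ℓ))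
  simpa using this

theorem gradSq_smul_le {c : ℂ} (hc : c ≠ 0) (u : SpatialL2 N ℓ) :
    gradSq N ℓ (c • u) ≤ ‖c‖ₑ ^ 2 * gradSq N ℓ u := by
  have h0 : ‖c‖ₑ ^ 2 ≠ 0 := pow_ne_zero 2 (by simpa using hc)
  have h1 : ‖c‖ₑ ^ 2 ≠ ⊤ := ENNReal.pow_ne_top enorm_ne_top
  conv_rhs => rw [gradSq]
  rw [ENNReal.mul_iInf_of_ne h0 h1]
  refine le_iInf fun g => ?_
  rw [ENNReal.mul_iInf_of_ne h0 h1]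
  refine le_iInf fun hg => ?_
  refine (gradSq_le (hg.smul c)).trans (le_of_eq ?_)
  simp_rw [enorm_smul, mul_pow, ← Finset.mul_sum]

theorem potentialForm_smul (q : Config N → ℝ≥0∞) (c : ℂ) (ψ : WaveL2 N ℓ) :
    potentialForm N ℓ q (c • ψ) = ‖c‖ₑ ^ 2 * potentialForm N ℓ q ψ := by
  rw [potentialForm, potentialForm, Finset.mul_sum]
  refine Finset.sum_congr rfl fun s _ => ?_
  rw [← lintegral_const_mul' _ _ (ENNReal.pow_ne_top enorm_ne_top)]
  refine lintegral_congr_ae ?_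
  filter_upwards [Lp.coeFn_smul c (ψ s)] with r hr
  simp only [PiLp.smul_apply, hr, Pi.smul_apply, enorm_smul]
  ring

theorem measurable_coulomb (N : ℕ) : Measurable (coulomb N) := by
  refine Finset.measurable_fun_sum _ fun i _ => Finset.measurable_fun_sum _ fun j _ => ?_
  exact ((measurable_pi_apply i).sub (measurable_pi_apply j)).enorm.inv

theorem internalEnergy_eq (lam : ℝ≥0) (ψ : WaveL2 N ℓ) : internalEnergy N ℓ lam ψ
    = 2⁻¹ * kineticForm N ℓ ψ + lam * potentialForm N ℓ (coulomb N) ψ := rfl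

theorem internalEnergy_smul_le {c : ℂ} (hc : c ≠ 0) (lam : ℝ≥0) (ψ : WaveL2 N ℓ) :
    internalEnergy N ℓ lam (c • ψ) ≤ ‖c‖ₑ ^ 2 * internalEnergy N ℓ lam ψ := by
  rw [internalEnergy_eq, internalEnergy_eq, potentialForm_smul, mul_add, mul_left_comm,
    mul_left_comm (‖c‖ₑ ^ 2) (2⁻¹)]
  gcongr
  rw [kineticForm, kineticForm, Finset.mul_sum]
  exact Finset.sum_le_sum fun s _ => gradSq_smul_le hc (ψ s)

theorem internalEnergy_zero (lam : ℝ≥0) : internalEnergy N ℓ lam 0 = 0 := by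
  have h := potentialForm_smul (coulomb N) 0 (0 : WaveL2 N ℓ)
  rw [smul_zero] at h
  rw [internalEnergy_eq, h, kineticForm]
  simp [gradSq_zero]

/-! ### Unitary mixing -/

/-- Expanding the squares and using that `U` is unitary. Applied pointwise to wavefunctions and to
gradients in `L²`, it shows that mixing leaves densities unchanged and does not raise energies. -/
theorem sum_enorm_sq_unitary {ι E : Type*} [Fintype ι] [DecidableEq ι] [NormedAddCommGroup E]
    [InnerProductSpace ℂ E] {U : Matrix ι ι ℂ} (hU : U ∈ Matrix.unitaryGroup ι ℂ) (x : ι → E) :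
    ∑ j, ‖∑ k, U k j • x k‖ₑ ^ 2 = ∑ k, ‖x k‖ₑ ^ 2 := by
  have hUU : ∀ k l, ∑ j, U l j * (starRingEnd ℂ) (U k j) = if l = k then 1 else 0 := by
    intro k l
    have := congrFun (congrFun (Matrix.mem_unitaryGroup_iff.1 hU) l) k
    rw [Matrix.mul_apply, Matrix.one_apply] at this
    exact this
  have key : ∑ j, ‖∑ k, U k j • x k‖ ^ 2 = ∑ k, ‖x k‖ ^ 2 := by
    have : ((∑ j, ‖∑ k, U k j • x k‖ ^ 2 : ℝ) : ℂ) = ((∑ k, ‖x k‖ ^ 2 : ℝ) : ℂ) := by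
      push_cast
      have h1 : ∀ y : E, ((‖y‖ : ℂ)) ^ 2 = inner ℂ y y := fun y =>
        (inner_self_eq_norm_sq_to_K y).symm
      simp_rw [h1, sum_inner, inner_sum, inner_smul_left, inner_smul_right]
      rw [Finset.sum_comm]
      refine Finset.sum_congr rfl fun k _ => ?_
      rw [Finset.sum_comm]
      calc ∑ l, ∑ j, (starRingEnd ℂ) (U k j) * (U l j * inner ℂ (x k) (x l))
          = ∑ l, (∑ j, U l j * (starRingEnd ℂ) (U k j)) * inner ℂ (x k) (x l) := by
            refine Finset.sum_congr rfl fun l _ => ?_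
            rw [Finset.sum_mul]
            exact Finset.sum_congr rfl fun j _ => by ring
        _ = inner ℂ (x k) (x k) := by simp [hUU]
    exact_mod_cast this
  simp only [← ofReal_norm, ← ENNReal.ofReal_pow (norm_nonneg _)]
  rw [← ENNReal.ofReal_sum_of_nonneg fun j _ => by positivity,
    ← ENNReal.ofReal_sum_of_nonneg fun j _ => by positivity, key]

variable {ι : Type*} [Fintype ι] [DecidableEq ι] {U : Matrix ι ι ℂ}

theorem potentialForm_unitary (hU : U ∈ Matrix.unitaryGroup ι ℂ) {q : Config N → ℝ≥0∞}
    (hq : Measurable q) (χ : ι → WaveL2 N ℓ) :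
    ∑ j, potentialForm N ℓ q (∑ k, U k j • χ k) = ∑ k, potentialForm N ℓ q (χ k) := by
  simp only [potentialForm]
  rw [Finset.sum_comm, Finset.sum_comm (s := Finset.univ (α := ι))]
  refine Finset.sum_congr rfl fun s _ => ?_
  have hm : ∀ φ : WaveL2 N ℓ, Measurable fun r => q r * ‖φ s r‖ₑ ^ 2 := fun φ =>
    hq.mul ((measurable_wave φ s).enorm.pow_const 2)
  rw [← lintegral_finsetSum _ fun j _ => hm (∑ k, U k j • χ k),
    ← lintegral_finsetSum _ fun j _ => hm (χ j)]
  refine lintegral_congr_ae ?_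
  have h1 : ∀ j, ∀ᵐ r ∂((volume : Measure (Config N)).restrict (configBox N ℓ)),
      (∑ k, U k j • χ k) s r = ∑ k, U k j • χ k s r := by
    intro j
    have e : (∑ k, U k j • χ k) s = ∑ k, U k j • χ k s := by
      simp [WithLp.ofLp_sum, Finset.sum_apply]
    rw [e]
    have h2 : ∀ k, ∀ᵐ r ∂((volume : Measure (Config N)).restrict (configBox N ℓ)),
      (U k j • χ k s : SpatialL2 N ℓ) r = U k j • χ k s r := fun k => Lp.coeFn_smul _ _
    filter_upwards [Lp.coeFn_finsetSum Finset.univ fun k => U k j • χ k s, ae_all_iff.2 h2]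
      with r hr hr2
    rw [hr, Finset.sum_apply]
    exact Finset.sum_congr rfl fun k _ => hr2 k
  filter_upwards [ae_all_iff.2 h1] with r hr
  simp_rw [hr, ← Finset.mul_sum]
  rw [sum_enorm_sq_unitary hU]

/-- Mixing near-optimal gradients of the `u k` gives admissible gradients of the mixtures. One
inequality is enough for the infimum. -/
theorem gradSq_unitary_le (hU : U ∈ Matrix.unitaryGroup ι ℂ) (u : ι → SpatialL2 N ℓ) :
    ∑ j, gradSq N ℓ (∑ k, U k j • u k) ≤ ∑ k, gradSq N ℓ (u k) := by
  by_cases htop : ∃ k, gradSq N ℓ (u k) = ⊤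
  · obtain ⟨k, hk⟩ := htop
    exact le_top.trans_eq (ENNReal.sum_eq_top.2 ⟨k, Finset.mem_univ k, hk⟩).symm
  push Not at htop
  have hbound : ∀ m : ℕ, ∑ j, gradSq N ℓ (∑ k, U k j • u k)
      ≤ ∑ k, (gradSq N ℓ (u k) + (m : ℝ≥0∞)⁻¹) := by
    intro m
    have hg : ∀ k, ∃ g, HasSobolevGradient N ℓ (u k) g ∧
        ∑ i, ∑ a, ‖g i a‖ₑ ^ 2 < gradSq N ℓ (u k) + (m : ℝ≥0∞)⁻¹ := fun k =>
      exists_gradient_lt (ENNReal.lt_add_right (htop k)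
        (ENNReal.inv_ne_zero.2 (ENNReal.natCast_ne_top m)))
    choose g hg hlt using hg
    calc ∑ j, gradSq N ℓ (∑ k, U k j • u k)
        ≤ ∑ j, ∑ i, ∑ a, ‖∑ k, U k j • g k i a‖ₑ ^ 2 := Finset.sum_le_sum fun j _ =>
          gradSq_le (HasSobolevGradient.sum Finset.univ fun k => (hg k).smul (U k j))
      _ = ∑ k, ∑ i, ∑ a, ‖g k i a‖ₑ ^ 2 := by
          rw [Finset.sum_comm, Finset.sum_comm (s := Finset.univ (α := ι))]
          refine Finset.sum_congr rfl fun i _ => ?_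
          rw [Finset.sum_comm, Finset.sum_comm (s := Finset.univ (α := ι))]
          exact Finset.sum_congr rfl fun a _ => sum_enorm_sq_unitary hU _
      _ ≤ _ := Finset.sum_le_sum fun k _ => (hlt k).le
  refine ge_of_tendsto' (x := atTop) ?_ hbound
  refine tendsto_finsetSum _ fun k _ => ?_
  simpa using ENNReal.tendsto_inv_nat_nhds_zero.const_add (gradSq N ℓ (u k))

theorem internalEnergy_unitary_le (hU : U ∈ Matrix.unitaryGroup ι ℂ) (lam : ℝ≥0)
    (χ : ι → WaveL2 N ℓ) :
    ∑ j, internalEnergy N ℓ lam (∑ k, U k j • χ k) ≤ ∑ k, internalEnergy N ℓ lam (χ k) := by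
  simp_rw [internalEnergy_eq, Finset.sum_add_distrib, ← Finset.mul_sum]
  rw [potentialForm_unitary hU (measurable_coulomb N)]
  refine add_le_add (mul_le_mul_right ?_ _) le_rfl
  simp only [kineticForm]
  rw [Finset.sum_comm, Finset.sum_comm (s := Finset.univ (α := ι))]
  refine Finset.sum_le_sum fun s _ => ?_
  have e : ∀ j, (∑ k, U k j • χ k) s = ∑ k, U k j • χ k s := fun j => by
    simp [WithLp.ofLp_sum, Finset.sum_apply]
  simp_rw [e]
  exact gradSq_unitary_le hU fun k => χ k s

/-- Vectors of an inner product space can be made orthogonal by a unitary mixing. -/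
theorem exists_unitary_orthogonal {E : Type*} [NormedAddCommGroup E] [InnerProductSpace ℂ E]
    (χ : ι → E) : ∃ U ∈ Matrix.unitaryGroup ι ℂ,
      ∀ i j, i ≠ j → inner ℂ (∑ k, U k i • χ k) (∑ k, U k j • χ k) = 0 := by
  -- The eigenvectors of the Gram matrix diagonalize it, and its off-diagonal entries become the
  -- inner products of the mixed vectors.
  let M : Matrix ι ι ℂ := Matrix.of fun k l => inner ℂ (χ k) (χ l)
  have hM : M.IsHermitian := by
    ext k l
    simp [M, Matrix.conjTranspose_apply]
  refine ⟨hM.eigenvectorUnitary, hM.eigenvectorUnitary.2, fun i j hij => ?_⟩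
  have h := hM.conjStarAlgAut_star_eigenvectorUnitary
  rw [Unitary.conjStarAlgAut_apply] at h
  have h2 := congrFun (congrFun h i) j
  rw [Matrix.diagonal_apply_ne _ hij] at h2
  rw [← h2]
  simp_rw [sum_inner, inner_sum, inner_smul_left, inner_smul_right]
  simp only [star_star, Unitary.coe_star, Matrix.mul_apply, Matrix.star_apply, M, Matrix.of_apply]
  rw [Finset.sum_comm]
  refine Finset.sum_congr rfl fun l _ => ?_
  rw [Finset.sum_mul]
  refine Finset.sum_congr rfl fun k _ => ?_
  rw [starRingEnd_apply]
  ring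

/-- A finite mixture of wavefunctions can be rewritten as a mixture of orthogonal ones, with the
same density and no larger energy. -/
theorem exists_orthogonal_mixture (lam : ℝ≥0) {w : ι → ℝ≥0} {ψ : ι → WaveL2 N ℓ}
    (hw : ∑ k, w k = 1) (hψ : ∀ k, w k ≠ 0 → ψ k ∈ waveSet N ℓ) :
    ∃ (p : ι → ℝ≥0) (φ : ι → WaveL2 N ℓ), ∑ k, p k = 1 ∧ (∀ k, p k ≠ 0 → φ k ∈ waveSet N ℓ) ∧
      (∀ j k, j ≠ k → inner ℂ (φ j) (φ k) = 0) ∧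
      (∀ q, Measurable q → ∑ k, (p k : ℝ≥0∞) * potentialForm N ℓ q (φ k)
        = ∑ k, (w k : ℝ≥0∞) * potentialForm N ℓ q (ψ k)) ∧
      ∑ k, (p k : ℝ≥0∞) * internalEnergy N ℓ lam (φ k)
        ≤ ∑ k, (w k : ℝ≥0∞) * internalEnergy N ℓ lam (ψ k) := by
  -- The weights are absorbed as `√w` into the vectors, so that the mixture becomes an unweighted
  -- sum of squares, which is invariant under mixing.
  let c : ι → ℂ := fun k => (NNReal.sqrt (w k) : ℝ)
  have hc : ∀ k, ‖c k‖ₑ ^ 2 = w k := by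
    intro k
    have : ‖c k‖ₑ = (NNReal.sqrt (w k) : ℝ≥0∞) := by
      rw [← ofReal_norm, Complex.norm_real, Real.norm_of_nonneg (NNReal.coe_nonneg _),
        ENNReal.ofReal_coe_nnreal]
    rw [this]
    exact_mod_cast NNReal.sq_sqrt (w k)
  have hc0 : ∀ k, w k = 0 → c k = 0 := fun k hk => by simp [c, hk]
  let χ : ι → WaveL2 N ℓ := fun k => c k • ψ k
  obtain ⟨U, hU, horth⟩ := exists_unitary_orthogonal χ
  let η : ι → WaveL2 N ℓ := fun j => ∑ k, U k j • χ k
  have hχmem : ∀ k, χ k ∈ finiteEnergyWaves N ℓ := by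
    intro k
    by_cases hk : w k = 0
    · simp [χ, hc0 k hk]
    · exact Submodule.smul_mem _ _ (mem_waveSet_iff.1 (hψ k hk)).2
  have hηmem : ∀ j, η j ∈ finiteEnergyWaves N ℓ := fun j =>
    Submodule.sum_mem _ fun k _ => Submodule.smul_mem _ _ (hχmem k)
  have hscale : ∀ j, (((‖η j‖⁻¹ : ℝ) : ℂ)) = 0 ∨ ‖(((‖η j‖⁻¹ : ℝ) : ℂ))‖ₑ ^ 2 * ‖η j‖ₑ ^ 2 = 1 := by
    intro j
    rcases eq_or_ne ‖η j‖ 0 with h | h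
    · left; simp [h]
    · right
      rw [← mul_pow, ← ofReal_norm, ← ofReal_norm, ← ENNReal.ofReal_mul (norm_nonneg _)]
      simp [h]
  have hp : ∀ j, ((‖η j‖₊ ^ 2 : ℝ≥0) : ℝ≥0∞) = ‖η j‖ₑ ^ 2 := fun j => by
    push_cast; rfl
  -- The squared norms become the new weights. If `η j = 0`, its weight is zero and the inverse
  -- takes the value `0`, so the vector is harmless.
  refine ⟨fun j => ‖η j‖₊ ^ 2, fun j => ((‖η j‖⁻¹ : ℝ) : ℂ) • η j, ?_, ?_, ?_, ?_, ?_⟩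
  · have h1 := sum_enorm_sq_unitary hU χ
    have h2 : ∑ k, ‖χ k‖ₑ ^ 2 = 1 := by
      calc ∑ k, ‖χ k‖ₑ ^ 2 = ∑ k, (w k : ℝ≥0∞) := by
            refine Finset.sum_congr rfl fun k _ => ?_
            simp only [χ, enorm_smul, mul_pow, hc]
            by_cases hk : w k = 0
            · simp [hk]
            · have := (hψ k hk).1
              rw [← ofReal_norm, this]
              simp
        _ = 1 := by exact_mod_cast congrArg ((↑) : ℝ≥0 → ℝ≥0∞) hw
    rw [h2] at h1
    have h3 : ((∑ j, ‖η j‖₊ ^ 2 : ℝ≥0) : ℝ≥0∞) = 1 := by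
      rw [← h1, ENNReal.ofNNReal_finsetSum]
      exact Finset.sum_congr rfl fun j _ => hp j
    exact_mod_cast h3
  · intro j hj
    have hj' : ‖η j‖ ≠ 0 := by
      intro h0
      apply hj
      simp [nnnorm_eq_zero.2 (norm_eq_zero.1 h0)]
    refine mem_waveSet_iff.2 ⟨?_, Submodule.smul_mem _ _ (hηmem j)⟩
    rw [norm_smul]
    simp [hj']
  · intro i j hij
    rw [inner_smul_left, inner_smul_right, horth i j hij]
    simp
  · intro q hq
    have h1 := potentialForm_unitary hU hq χ
    have h2 : ∑ k, potentialForm N ℓ q (χ k) = ∑ k, (w k : ℝ≥0∞) * potentialForm N ℓ q (ψ k) :=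
      Finset.sum_congr rfl fun k _ => by rw [potentialForm_smul, hc]
    rw [← h2, ← h1]
    refine Finset.sum_congr rfl fun j _ => ?_
    rw [potentialForm_smul, hp]
    change _ = potentialForm N ℓ q (η j)
    rcases eq_or_ne (η j) 0 with h | h
    · rw [h]
      have := potentialForm_smul q 0 (0 : WaveL2 N ℓ)
      rw [smul_zero] at this
      rw [this]
      simp
    · rcases hscale j with h' | h'
      · simp [h] at h'
      · rw [← mul_assoc, mul_comm (‖η j‖ₑ ^ 2), h', one_mul]
  · have h1 := internalEnergy_unitary_le hU lam χ
    have h2 : ∑ k, internalEnergy N ℓ lam (χ k)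
        ≤ ∑ k, (w k : ℝ≥0∞) * internalEnergy N ℓ lam (ψ k) := by
      refine Finset.sum_le_sum fun k _ => ?_
      by_cases hk : w k = 0
      · simp [χ, hc0 k hk, internalEnergy_zero]
      · rw [← hc k]
        exact internalEnergy_smul_le (by simpa [c] using hk) lam (ψ k)
    refine le_trans (le_trans (Finset.sum_le_sum fun j _ => ?_) h1) h2
    rw [hp]
    change _ ≤ internalEnergy N ℓ lam (η j)
    rcases eq_or_ne (η j) 0 with h | h
    · simp [h]
    · rcases hscale j with h' | h'
      · simp [h] at h'
      · calc ‖η j‖ₑ ^ 2 * internalEnergy N ℓ lam ((((‖η j‖⁻¹ : ℝ) : ℂ)) • η j)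
            ≤ ‖η j‖ₑ ^ 2 * (‖(((‖η j‖⁻¹ : ℝ) : ℂ))‖ₑ ^ 2 * internalEnergy N ℓ lam (η j)) := by
              gcongr
              exact internalEnergy_smul_le (by simpa using h) lam (η j)
          _ = _ := by rw [← mul_assoc, mul_comm (‖η j‖ₑ ^ 2), h', one_mul]

end Mixing

/-! ### The convex set of finite mixtures and its two transforms -/

section Ensembles

variable {n : ℕ} {ℓ : ℝ}

theorem density_nonneg (ψ : WaveL2 (n + 1) ℓ) (r : Pos) : 0 ≤ density n ℓ ψ r :=
  mul_nonneg (by positivity) (Finset.sum_nonneg fun s _ => integral_nonneg fun y => by positivity)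

open Classical in
/-- The density of a wavefunction as an element of `L²`. -/
def densityLp (n : ℕ) (ℓ : ℝ) (ψ : WaveL2 (n + 1) ℓ) : DensSpace ℓ :=
  if h : MemLp (density n ℓ ψ) 2 ((volume : Measure Pos).restrict (box ℓ)) then h.toLp else 0

theorem densityLp_ae_eq {ψ : WaveL2 (n + 1) ℓ} (hψ : ψ ∈ waveSet (n + 1) ℓ) :
    densityLp n ℓ ψ =ᵐ[(volume : Measure Pos).restrict (box ℓ)] density n ℓ ψ := by
  have h := memLp_density hψ.2.2
  rw [densityLp, dif_pos h]
  exact h.coeFn_toLp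

theorem mixture_ae_eq {ι : Type*} (t : Finset ι) {w : ι → ℝ≥0} {ψ : ι → WaveL2 (n + 1) ℓ}
    (hψ : ∀ k, w k ≠ 0 → ψ k ∈ waveSet (n + 1) ℓ) :
    (∑ k ∈ t, (w k : ℝ) • densityLp n ℓ (ψ k) : DensSpace ℓ)
      =ᵐ[(volume : Measure Pos).restrict (box ℓ)]
      fun r => ∑ k ∈ t, (w k : ℝ) * density n ℓ (ψ k) r := by
  classical
  induction t using Finset.induction_on with
  | empty =>
    simp only [Finset.sum_empty]
    exact Lp.coeFn_zero ℝ 2 ((volume : Measure Pos).restrict (box ℓ))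
  | insert k t hk ih =>
    simp only [Finset.sum_insert hk]
    have h1 : ∀ᵐ r ∂((volume : Measure Pos).restrict (box ℓ)),
        (w k : ℝ) * densityLp n ℓ (ψ k) r = (w k : ℝ) * density n ℓ (ψ k) r := by
      by_cases h0 : w k = 0
      · simp [h0]
      · filter_upwards [densityLp_ae_eq (hψ k h0)] with r hr
        rw [hr]
    filter_upwards [Lp.coeFn_add ((w k : ℝ) • densityLp n ℓ (ψ k))
      (∑ k ∈ t, (w k : ℝ) • densityLp n ℓ (ψ k)), Lp.coeFn_smul (w k : ℝ) (densityLp n ℓ (ψ k)),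
      h1, ih] with r e1 e2 e3 e4
    rw [e1, Pi.add_apply, e2, e4, Pi.smul_apply, smul_eq_mul, e3]

theorem integral_density_mul {ψ : WaveL2 (n + 1) ℓ} (hψ : ψ ∈ waveSet (n + 1) ℓ)
    (v : DensSpace ℓ) : ∫ r in box ℓ, density n ℓ ψ r * v r = ⟪v, densityLp n ℓ ψ⟫ := by
  rw [L2.inner_def]
  refine integral_congr_ae ?_
  filter_upwards [densityLp_ae_eq hψ] with r hr
  rw [← hr]
  simp [mul_comm]

/-- Pairs (density, upper bound of the energy) of finite mixtures of wavefunctions. -/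
def ensembleSet (n : ℕ) (ℓ : ℝ) (lam : ℝ≥0) : Set (DensSpace ℓ × ℝ) :=
  {p | ∃ (ι : Type) (_ : Fintype ι) (w : ι → ℝ≥0) (ψ : ι → WaveL2 (n + 1) ℓ),
    ∑ k, w k = 1 ∧ (∀ k, w k ≠ 0 → ψ k ∈ waveSet (n + 1) ℓ) ∧
    p.1 = ∑ k, (w k : ℝ) • densityLp n ℓ (ψ k) ∧ 0 ≤ p.2 ∧
    ∑ k, (w k : ℝ≥0∞) * internalEnergy (n + 1) ℓ lam (ψ k) ≤ ENNReal.ofReal p.2}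

/-- Two mixtures combine over the disjoint union of their index sets. This would fail if the
wavefunctions had to be orthogonal. -/
theorem convex_ensembleSet (n : ℕ) (ℓ : ℝ) (lam : ℝ≥0) : Convex ℝ (ensembleSet n ℓ lam) := by
  rintro p ⟨ι, _, w, ψ, h1, h2, h3, h4, h5⟩ q ⟨ι', _, w', ψ', h1', h2', h3', h4', h5'⟩ a b ha hb
    hab
  refine ⟨ι ⊕ ι', inferInstance, Sum.elim (fun k => a.toNNReal * w k) fun k => b.toNNReal * w' k,
    Sum.elim ψ ψ', ?_, ?_, ?_, ?_, ?_⟩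
  · rw [Fintype.sum_sum_type]
    simp only [Sum.elim_inl, Sum.elim_inr, ← Finset.mul_sum, h1, h1', mul_one]
    rw [← Real.toNNReal_add ha hb, hab, Real.toNNReal_one]
  · rintro (k | k) hk
    · exact h2 k (right_ne_zero_of_mul hk)
    · exact h2' k (right_ne_zero_of_mul hk)
  · rw [Fintype.sum_sum_type]
    simp only [Sum.elim_inl, Sum.elim_inr, NNReal.coe_mul, Real.coe_toNNReal _ ha,
      Real.coe_toNNReal _ hb, mul_smul, ← Finset.smul_sum, ← h3, ← h3']
    rfl
  · exact add_nonneg (mul_nonneg ha h4) (mul_nonneg hb h4')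
  · rw [Fintype.sum_sum_type]
    simp only [Sum.elim_inl, Sum.elim_inr, ENNReal.coe_mul, mul_assoc, ← Finset.mul_sum]
    have e : (a • p + b • q).2 = a * p.2 + b * q.2 := rfl
    rw [e, ENNReal.ofReal_add (mul_nonneg ha h4) (mul_nonneg hb h4'), ENNReal.ofReal_mul ha,
      ENNReal.ofReal_mul hb]
    exact add_le_add (mul_le_mul_right h5 _) (mul_le_mul_right h5' _)

theorem mem_ensembleSet_of_mem_waveSet {lam : ℝ≥0} {ψ : WaveL2 (n + 1) ℓ}
    (hψ : ψ ∈ waveSet (n + 1) ℓ) (hfin : internalEnergy (n + 1) ℓ lam ψ ≠ ⊤) :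
    (densityLp n ℓ ψ, (internalEnergy (n + 1) ℓ lam ψ).toReal) ∈ ensembleSet n ℓ lam := by
  refine ⟨Unit, inferInstance, fun _ => 1, fun _ => ψ, by simp, fun _ _ => hψ, by simp,
    ENNReal.toReal_nonneg, ?_⟩
  simp [ENNReal.ofReal_toReal hfin]

/-! ### The universal functional -/

/-- Testing with indicators of measurable sets in the first coordinate recovers the integral of the
density over every such set. -/
theorem sum_density_ae_eq {ι : Type*} [Fintype ι] {p w : ι → ℝ≥0}
    {φ ψ : ι → WaveL2 (n + 1) ℓ}
    (h : ∀ q, Measurable q → ∑ k, (p k : ℝ≥0∞) * potentialForm (n + 1) ℓ q (φ k)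
        = ∑ k, (w k : ℝ≥0∞) * potentialForm (n + 1) ℓ q (ψ k)) :
    ∀ᵐ r ∂((volume : Measure Pos).restrict (box ℓ)),
      ∑ k, (p k : ℝ) * density n ℓ (φ k) r = ∑ k, (w k : ℝ) * density n ℓ (ψ k) r := by
  have hmeas : ∀ (p : ι → ℝ≥0) (φ : ι → WaveL2 (n + 1) ℓ),
      Measurable fun r => ∑ k, (p k : ℝ≥0∞) * edensity n ℓ (φ k) r := fun p φ =>
    Finset.measurable_fun_sum _ fun k _ => (measurable_edensity (φ k)).const_mul _
  have hint : ∀ (p : ι → ℝ≥0) (φ : ι → WaveL2 (n + 1) ℓ) (s : Set Pos), MeasurableSet s →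
      ∫⁻ r in s, ∑ k, (p k : ℝ≥0∞) * edensity n ℓ (φ k) r ∂((volume : Measure Pos).restrict (box ℓ))
      = (n + 1 : ℝ≥0∞) * ∑ k, (p k : ℝ≥0∞) *
        potentialForm (n + 1) ℓ (fun r => s.indicator 1 (r 0)) (φ k) := by
    intro p φ s hs
    rw [lintegral_finsetSum _ fun k _ => (measurable_edensity (φ k)).const_mul _, Finset.mul_sum]
    refine Finset.sum_congr rfl fun k _ => ?_
    rw [lintegral_const_mul _ (measurable_edensity (φ k)), mul_left_comm,
      ← lintegral_mul_edensity _ (measurable_one.indicator hs), ← lintegral_indicator hs]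
    congr 1
    refine lintegral_congr fun r => ?_
    by_cases hr : r ∈ s <;> simp [hr]
  have hae := ae_eq_of_forall_setLIntegral_eq_of_sigmaFinite
    (μ := (volume : Measure Pos).restrict (box ℓ)) (hmeas p φ) (hmeas w ψ) (fun s hs _ => by
      rw [hint p φ s hs, hint w ψ s hs]
      exact congrArg _ (h _ ((measurable_one.indicator hs).comp (measurable_pi_apply 0))))
  have hreal : ∀ (p : ι → ℝ≥0) (φ : ι → WaveL2 (n + 1) ℓ),
      ∀ᵐ r ∂((volume : Measure Pos).restrict (box ℓ)), ∑ k, (p k : ℝ) * density n ℓ (φ k) r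
        = (∑ k, (p k : ℝ≥0∞) * edensity n ℓ (φ k) r).toReal := by
    intro p φ
    filter_upwards [ae_all_iff.2 fun k => edensity_ae_lt_top (φ k)] with r hr
    rw [ENNReal.toReal_sum fun k _ => ENNReal.mul_ne_top ENNReal.coe_ne_top (hr k).ne]
    refine Finset.sum_congr rfl fun k _ => ?_
    rw [ENNReal.toReal_mul, density_eq_toReal_of_lt_top _ (hr k), ENNReal.coe_toReal]
  filter_upwards [hae, hreal p φ, hreal w ψ] with r e1 e2 e3
  rw [e2, e3, e1]

theorem universalF_le_of_mem {lam : ℝ≥0} {p : DensSpace ℓ × ℝ} (hp : p ∈ ensembleSet n ℓ lam) :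
    universalF n ℓ lam p.1 ≤ (p.2 : EReal) := by
  classical
  obtain ⟨ι, _, w, ψ, h1, h2, h3, h4, h5⟩ := hp
  obtain ⟨a, φ, ha, hmem, horth, hpot, hen⟩ := exists_orthogonal_mixture lam h1 h2
  -- The finite family is embedded in a sequence and continued with weight zero, for which
  -- `IsDensityOperator` imposes nothing on the wavefunctions.
  let e : ι → ℕ := fun k => (Fintype.equivFin ι k : ℕ)
  have he : Function.Injective e := Fin.val_injective.comp (Fintype.equivFin ι).injective
  let w' : ℕ → ℝ≥0 := Function.extend e a 0
  let φ' : ℕ → WaveL2 (n + 1) ℓ := Function.extend e φ 0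
  have hw' : ∀ k, w' (e k) = a k := fun k => he.extend_apply _ _ _
  have hφ' : ∀ k, φ' (e k) = φ k := fun k => he.extend_apply _ _ _
  have hw0 : ∀ j, j ∉ Set.range e → w' j = 0 := fun j hj =>
    Function.extend_apply' _ _ _ hj
  have hex : ∀ j, w' j ≠ 0 → ∃ k, e k = j := fun j hj => by
    by_contra hc
    exact hj (hw0 j hc)
  have hens : IsDensityOperator (n + 1) ℓ w' φ' := by
    refine ⟨?_, fun j hj => ?_, fun i j hi hj hij => ?_⟩
    · rw [← he.hasSum_iff hw0, ← ha]
      convert hasSum_fintype a using 1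
      ext k
      simp [hw']
    · obtain ⟨k, rfl⟩ := hex j hj
      rw [hφ']
      exact hmem k (hw' k ▸ hj)
    · obtain ⟨k, rfl⟩ := hex i hi
      obtain ⟨l, rfl⟩ := hex j hj
      rw [hφ', hφ']
      exact horth k l fun h => hij (by rw [h])
  have hdens : ∀ᵐ r ∂((volume : Measure Pos).restrict (box ℓ)),
      HasSum (fun k => (w' k : ℝ) * density n ℓ (φ' k) r) (p.1 r) := by
    have hm := mixture_ae_eq Finset.univ h2
    rw [← h3] at hm
    filter_upwards [hm, sum_density_ae_eq hpot] with r e1 e2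
    rw [e1, ← e2, ← he.hasSum_iff fun j hj => by simp [hw0 j hj]]
    convert hasSum_fintype (fun k => (a k : ℝ) * density n ℓ (φ k) r) using 1
    ext k
    simp [hw', hφ']
  refine iInf_le_of_le w' (iInf_le_of_le φ' (iInf_le_of_le hens (iInf_le_of_le hdens ?_)))
  have hts : ∑' k, (w' k : ℝ≥0∞) * internalEnergy (n + 1) ℓ lam (φ' k)
      = ∑ k, (a k : ℝ≥0∞) * internalEnergy (n + 1) ℓ lam (φ k) := by
    refine HasSum.tsum_eq ?_
    rw [← he.hasSum_iff fun j hj => by simp [hw0 j hj]]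
    convert hasSum_fintype (fun k => (a k : ℝ≥0∞) * internalEnergy (n + 1) ℓ lam (φ k)) using 1
    ext k
    simp [hw', hφ']
  rw [hts]
  calc ((∑ k, (a k : ℝ≥0∞) * internalEnergy (n + 1) ℓ lam (φ k) : ℝ≥0∞) : EReal)
      ≤ ((ENNReal.ofReal p.2 : ℝ≥0∞) : EReal) :=
        EReal.coe_ennreal_le_coe_ennreal_iff.2 (hen.trans h5)
    _ = (p.2 : EReal) := by rw [EReal.coe_ennreal_ofReal, max_eq_left h4]

theorem tendsto_of_hasSum_ae {α : Type*} [MeasurableSpace α] {μ : Measure α} {ρ : Lp ℝ 2 μ}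
    {R : ℕ → Lp ℝ 2 μ} {f : ℕ → α → ℝ} (hf : ∀ k x, 0 ≤ f k x)
    (hR : ∀ m, R m =ᵐ[μ] fun x => ∑ k ∈ Finset.range m, f k x)
    (hsum : ∀ᵐ x ∂μ, HasSum (fun k => f k x) (ρ x)) : Tendsto R atTop (𝓝 ρ) := by
  have hlim : Tendsto (fun m => ∫⁻ x, ‖(R m - ρ : Lp ℝ 2 μ) x‖ₑ ^ 2 ∂μ) atTop
      (𝓝 (∫⁻ _x, 0 ∂μ)) := by
    have hsub : ∀ m, ∀ᵐ x ∂μ, (R m - ρ : Lp ℝ 2 μ) x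
        = (∑ k ∈ Finset.range m, f k x) - ρ x := fun m => by
      filter_upwards [Lp.coeFn_sub (R m) ρ, hR m] with x e1 e2
      rw [e1, Pi.sub_apply, e2]
    -- Partial sums of nonnegative terms lie between `0` and `ρ`, so `‖ρ‖ₑ ^ 2` dominates the
    -- squared error.
    refine tendsto_lintegral_of_dominated_convergence (fun x => ‖ρ x‖ₑ ^ 2)
      (fun m => ((Lp.stronglyMeasurable _).measurable.enorm.pow_const 2)) (fun m => ?_) ?_ ?_
    · filter_upwards [hsub m, hsum] with x e1 e2
      rw [e1]
      have h1 : ∑ k ∈ Finset.range m, f k x ≤ ρ x := sum_le_hasSum _ (fun k _ => hf k x) e2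
      have h2 : 0 ≤ ∑ k ∈ Finset.range m, f k x := Finset.sum_nonneg fun k _ => hf k x
      gcongr
      rw [enorm_le_iff_norm_le, Real.norm_eq_abs, Real.norm_eq_abs, abs_of_nonpos (by linarith),
        abs_of_nonneg (by linarith)]
      linarith
    · rw [lintegral_enorm_sq_Lp]
      exact ENNReal.pow_ne_top enorm_ne_top
    · filter_upwards [ae_all_iff.2 hsub, hsum] with x e1 e2
      simp_rw [e1]
      have h1 : Tendsto (fun m => (∑ k ∈ Finset.range m, f k x) - ρ x) atTop (𝓝 0) := by
        simpa using e2.tendsto_sum_nat.sub_const (ρ x)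
      have h2 := ENNReal.Tendsto.pow (n := 2) h1.enorm
      simpa using h2
  simp_rw [lintegral_enorm_sq_Lp, lintegral_zero] at hlim
  rw [tendsto_iff_norm_sub_tendsto_zero]
  have h3 := (ENNReal.tendsto_toReal ENNReal.zero_ne_top).comp hlim
  have h4 : Tendsto (fun m => ‖R m - ρ‖ ^ 2) atTop (𝓝 0) := by
    simpa [Function.comp_def] using h3
  have h5 := h4.sqrt
  simpa [Real.sqrt_sq (norm_nonneg _)] using h5

/-- A truncated ensemble, renormalized by its total weight `W m`, has density tending to `ρ` and
energy at most the full energy divided by `W m`, with `W m` tending to `1`. -/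
theorem exists_mem_ensembleSet {lam : ℝ≥0} {ρ : DensSpace ℓ} {c : ℝ}
    (h : universalF n ℓ lam ρ < (c : EReal)) {V : Set (DensSpace ℓ)} (hV : V ∈ 𝓝 ρ) :
    ∃ p ∈ ensembleSet n ℓ lam, p.1 ∈ V ∧ p.2 ≤ c := by
  simp only [universalF, iInf_lt_iff] at h
  obtain ⟨w, ψ, hens, hdens, hlt⟩ := h
  set S := ∑' k, (w k : ℝ≥0∞) * internalEnergy (n + 1) ℓ lam (ψ k) with hS
  have hStop : S ≠ ⊤ := by
    intro h0
    rw [h0] at hlt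
    simp at hlt
  have hSc : S.toReal < c := by
    rw [← EReal.coe_lt_coe_iff, EReal.coe_ennreal_toReal hStop]
    exact hlt
  let W : ℕ → ℝ≥0 := fun m => ∑ k ∈ Finset.range m, w k
  have hW : Tendsto W atTop (𝓝 1) := hens.hasSum_weight.tendsto_sum_nat
  have hWr : Tendsto (fun m => ((W m)⁻¹ : ℝ)) atTop (𝓝 1) := by
    have := ((NNReal.continuous_coe.tendsto 1).comp hW).inv₀ (by simp)
    simpa [Function.comp_def] using this
  let R : ℕ → DensSpace ℓ := fun m => ∑ k ∈ Finset.range m, (w k : ℝ) • densityLp n ℓ (ψ k)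
  have hR : Tendsto R atTop (𝓝 ρ) :=
    tendsto_of_hasSum_ae (fun k x => mul_nonneg (w k).2 (density_nonneg (ψ k) x))
      (fun m => mixture_ae_eq (Finset.range m) hens.mem_waveSet) hdens
  have hlim1 : Tendsto (fun m => ((W m)⁻¹ : ℝ) • R m) atTop (𝓝 ρ) := by
    simpa using hWr.smul hR
  have hlim2 : Tendsto (fun m => ((W m)⁻¹ : ℝ) * S.toReal) atTop (𝓝 S.toReal) := by
    simpa using hWr.mul_const S.toReal
  have hpos : ∀ᶠ m in atTop, W m ≠ 0 := by
    filter_upwards [hW.eventually_ne one_ne_zero] with m hm using hm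
  obtain ⟨m, hm1, hm2, hm3⟩ := ((hlim1.eventually_mem hV).and
    ((hlim2.eventually_lt_const hSc).and hpos)).exists
  refine ⟨(((W m)⁻¹ : ℝ) • R m, ((W m)⁻¹ : ℝ) * S.toReal), ?_, hm1, hm2.le⟩
  refine ⟨Fin m, inferInstance, fun k => (W m)⁻¹ * w k, fun k => ψ k, ?_, ?_, ?_, ?_, ?_⟩
  · rw [← Finset.mul_sum, Fin.sum_univ_eq_sum_range w m]
    exact inv_mul_cancel₀ hm3
  · exact fun k hk => hens.mem_waveSet k (right_ne_zero_of_mul hk)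
  · simp only [NNReal.coe_mul, mul_smul, ← Finset.smul_sum, NNReal.coe_inv]
    rw [Fin.sum_univ_eq_sum_range (fun k => (w k : ℝ) • densityLp n ℓ (ψ k)) m]
  · exact mul_nonneg (by positivity) ENNReal.toReal_nonneg
  · simp only [ENNReal.coe_mul, mul_assoc, ← Finset.mul_sum]
    rw [Fin.sum_univ_eq_sum_range
      (fun k => (w k : ℝ≥0∞) * internalEnergy (n + 1) ℓ lam (ψ k)) m]
    rw [ENNReal.ofReal_mul (by positivity), ENNReal.ofReal_toReal hStop]
    have e : ENNReal.ofReal ((W m : ℝ)⁻¹) = (((W m)⁻¹ : ℝ≥0) : ℝ≥0∞) := by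
      rw [← NNReal.coe_inv, ENNReal.ofReal_coe_nnreal]
    rw [e]
    exact mul_le_mul_right (ENNReal.sum_le_tsum _) _

/-! ### The Moreau envelope -/

theorem moreauEnvelope_le {ε : ℝ} {lam : ℝ≥0} {p : DensSpace ℓ × ℝ}
    (hp : p ∈ ensembleSet n ℓ lam) (x : DensSpace ℓ) :
    moreauEnvelope ε (universalF n ℓ lam) x
      ≤ ((p.2 + 1 / (2 * ε) * ‖x - p.1‖ ^ 2 : ℝ) : EReal) := by
  refine iInf_le_of_le p.1 ?_
  rw [EReal.coe_add]
  exact add_le_add_left (universalF_le_of_mem hp) _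

theorem universalF_nonneg (lam : ℝ≥0) (ρ : DensSpace ℓ) : 0 ≤ universalF n ℓ lam ρ :=
  le_iInf fun _ => le_iInf fun _ => le_iInf fun _ => le_iInf fun _ => EReal.coe_ennreal_nonneg _

/-- The mixtures reach the density `z` only approximately. Continuity of the penalty makes up for
this: half of the gap `d` is spent on the energy and half on the penalty. -/
theorem le_moreauEnvelope {ε : ℝ} {lam : ℝ≥0} {x : DensSpace ℓ} {b : ℝ}
    (hb : ∀ p ∈ ensembleSet n ℓ lam, b ≤ p.2 + 1 / (2 * ε) * ‖x - p.1‖ ^ 2) :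
    (b : EReal) ≤ moreauEnvelope ε (universalF n ℓ lam) x := by
  refine le_iInf fun z => ?_
  by_contra hc
  rw [not_le] at hc
  have hne : universalF n ℓ lam z ≠ ⊤ := by
    intro h0
    rw [h0, EReal.top_add_coe] at hc
    simp at hc
  have hnb : universalF n ℓ lam z ≠ ⊥ :=
    ne_of_gt (lt_of_lt_of_le EReal.bot_lt_zero (universalF_nonneg lam z))
  have hF := EReal.coe_toReal hne hnb
  set f := (universalF n ℓ lam z).toReal
  rw [← hF, ← EReal.coe_add, EReal.coe_lt_coe_iff] at hc
  set d := b - (f + 1 / (2 * ε) * ‖x - z‖ ^ 2) with hd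
  have hdpos : 0 < d := by linarith
  have hcont : ContinuousAt (fun y : DensSpace ℓ => 1 / (2 * ε) * ‖x - y‖ ^ 2) z := by fun_prop
  have hV : {y : DensSpace ℓ |
      1 / (2 * ε) * ‖x - y‖ ^ 2 < 1 / (2 * ε) * ‖x - z‖ ^ 2 + d / 2} ∈ 𝓝 z :=
    hcont.eventually_lt_const (by linarith)
  obtain ⟨p, hp, hp1, hp2⟩ := exists_mem_ensembleSet (c := f + d / 2)
    (by rw [← hF, EReal.coe_lt_coe_iff]; linarith) hV
  have := hb p hp
  have hp1' : 1 / (2 * ε) * ‖x - p.1‖ ^ 2 < 1 / (2 * ε) * ‖x - z‖ ^ 2 + d / 2 := hp1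
  linarith

theorem moreauEnvelope_finite {ε : ℝ} (hε : 0 < ε) {lam : ℝ≥0}
    (hne : (ensembleSet n ℓ lam).Nonempty) (x : DensSpace ℓ) :
    moreauEnvelope ε (universalF n ℓ lam) x ≠ ⊥ ∧
      moreauEnvelope ε (universalF n ℓ lam) x ≠ ⊤ := by
  constructor
  · refine ne_of_gt (lt_of_lt_of_le (EReal.bot_lt_coe 0) (le_moreauEnvelope ?_))
    rintro p ⟨-, -, -, -, -, -, -, h4, -⟩
    have : 0 ≤ 1 / (2 * ε) * ‖x - p.1‖ ^ 2 := by positivity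
    linarith
  · obtain ⟨p, hp⟩ := hne
    exact ne_of_lt ((moreauEnvelope_le hp x).trans_lt (EReal.coe_lt_top _))

theorem isGLB_regF {ε : ℝ} (hε : 0 < ε) {lam : ℝ≥0}
    (hne : (ensembleSet n ℓ lam).Nonempty) (x : DensSpace ℓ) :
    IsGLB ((fun p : DensSpace ℓ × ℝ => p.2 + 1 / (2 * ε) * ‖x - p.1‖ ^ 2) '' ensembleSet n ℓ lam)
      (regF n ℓ ε lam x) := by
  obtain ⟨h1, h2⟩ := moreauEnvelope_finite hε hne x
  have hcoe := EReal.coe_toReal h2 h1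
  constructor
  · rintro _ ⟨p, hp, rfl⟩
    rw [← EReal.coe_le_coe_iff, regF, hcoe]
    exact moreauEnvelope_le hp x
  · intro b hb
    rw [← EReal.coe_le_coe_iff, regF, hcoe]
    exact le_moreauEnvelope fun p hp => hb ⟨p, hp, rfl⟩

/-! ### The ground-state energy -/

/-- A weighted average is at least one of the terms with nonzero weight, so some pure state does no
worse than the mixture. -/
theorem groundEnergy_le_of_mem {lam : ℝ≥0} {p : DensSpace ℓ × ℝ} (hp : p ∈ ensembleSet n ℓ lam)
    (v : DensSpace ℓ) : groundEnergy n ℓ lam v ≤ ((p.2 + ⟪v, p.1⟫ : ℝ) : EReal) := by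
  obtain ⟨ι, _, w, ψ, h1, h2, h3, h4, h5⟩ := hp
  have hterm : ∀ k, (w k : ℝ≥0∞) * internalEnergy (n + 1) ℓ lam (ψ k) ≠ ⊤ := fun k =>
    ne_top_of_le_ne_top ENNReal.ofReal_ne_top
      ((Finset.single_le_sum (f := fun k => (w k : ℝ≥0∞) * internalEnergy (n + 1) ℓ lam (ψ k))
        (fun _ _ => zero_le) (Finset.mem_univ k)).trans h5)
  have hEfin : ∀ k, w k ≠ 0 → internalEnergy (n + 1) ℓ lam (ψ k) ≠ ⊤ := fun k hk h0 => by
    apply hterm k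
    rw [h0, ENNReal.mul_top (by exact_mod_cast hk)]
  set x : ι → ℝ := fun k => (internalEnergy (n + 1) ℓ lam (ψ k)).toReal
    + ⟪v, densityLp n ℓ (ψ k)⟫ with hx
  have hsum : ∑ k, (w k : ℝ) * x k ≤ p.2 + ⟪v, p.1⟫ := by
    rw [h3, inner_sum]
    simp only [hx, mul_add, Finset.sum_add_distrib, real_inner_smul_right]
    gcongr
    have := ENNReal.toReal_mono ENNReal.ofReal_ne_top h5
    rw [ENNReal.toReal_ofReal h4, ENNReal.toReal_sum fun k _ => hterm k] at this
    simpa [ENNReal.toReal_mul] using this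
  have hw1 : ∑ k, (w k : ℝ) = 1 := by exact_mod_cast congrArg ((↑) : ℝ≥0 → ℝ) h1
  obtain ⟨k, hk, hkx⟩ : ∃ k, w k ≠ 0 ∧ x k ≤ ∑ j, (w j : ℝ) * x j := by
    by_contra hc
    push Not at hc
    obtain ⟨k₀, hk₀⟩ : ∃ k, w k ≠ 0 := by
      by_contra hc'
      push Not at hc'
      simp [hc'] at h1
    have : ∑ k, (w k : ℝ) * (∑ j, (w j : ℝ) * x j) < ∑ k, (w k : ℝ) * x k := by
      refine Finset.sum_lt_sum (fun k _ => ?_) ⟨k₀, Finset.mem_univ _, ?_⟩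
      · by_cases hk : w k = 0
        · simp [hk]
        · exact mul_le_mul_of_nonneg_left (hc k hk).le (w k).2
      · exact mul_lt_mul_of_pos_left (hc k₀ hk₀) (NNReal.coe_pos.2 (pos_iff_ne_zero.2 hk₀))
    rw [← Finset.sum_mul, hw1, one_mul] at this
    exact lt_irrefl _ this
  refine (iInf₂_le (ψ k) (h2 k hk)).trans ?_
  rw [integral_density_mul (h2 k hk), ← EReal.coe_ennreal_toReal (hEfin k hk), ← EReal.coe_add,
    EReal.coe_le_coe_iff]
  exact hkx.trans hsum

theorem le_groundEnergy {lam : ℝ≥0} {v : DensSpace ℓ} {b : ℝ}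
    (hb : ∀ p ∈ ensembleSet n ℓ lam, b ≤ p.2 + ⟪v, p.1⟫) :
    (b : EReal) ≤ groundEnergy n ℓ lam v := by
  refine le_iInf₂ fun ψ hψ => ?_
  by_cases hfin : internalEnergy (n + 1) ℓ lam ψ = ⊤
  · rw [hfin, EReal.coe_ennreal_top, EReal.top_add_coe]
    exact le_top
  · rw [integral_density_mul hψ, ← EReal.coe_ennreal_toReal hfin, ← EReal.coe_add,
      EReal.coe_le_coe_iff]
    exact hb _ (mem_ensembleSet_of_mem_waveSet hψ hfin)

theorem inner_densityLp_ge {ψ : WaveL2 (n + 1) ℓ} (hψ : ψ ∈ waveSet (n + 1) ℓ)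
    (v : DensSpace ℓ) :
    -(∫⁻ r in box ℓ, ‖v r‖ₑ * edensity n ℓ ψ r).toReal ≤ ⟪v, densityLp n ℓ ψ⟫ := by
  rw [← integral_density_mul hψ v]
  refine (abs_le.1 ?_).1
  refine (norm_integral_le_lintegral_norm (fun r => density n ℓ ψ r * v r)).trans (le_of_eq ?_)
  congr 1
  refine lintegral_congr_ae ?_
  filter_upwards [enorm_density_ae_eq ψ] with r hr
  rw [← hr, ofReal_norm, enorm_mul, mul_comm]

/-- The potential energy is absorbed into the kinetic energy. The repulsion is nonnegative and is
dropped, so the bound does not depend on `lam`. -/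
theorem exists_lower_bound (n : ℕ) (ℓ : ℝ) (R : ℝ) : ∃ B : ℝ, ∀ (lam : ℝ≥0) (v : DensSpace ℓ),
    ‖v‖ ≤ R → (B : EReal) ≤ groundEnergy n ℓ lam v := by
  -- Chosen so that `(n + 1) * R * δ ≤ 1 / 2`, the coefficient of the kinetic energy; the `+ 1`
  -- keeps the inverse meaningful for `R ≤ 0`.
  set δ : ℝ≥0 := (2 * (n + 1) * (Real.toNNReal R + 1))⁻¹ with hδ
  have hδ0 : δ ≠ 0 := by positivity
  obtain ⟨C, hC⟩ := exists_edensity_bound hδ0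
  refine ⟨-((n + 1) * (Real.toNNReal R * C)), fun lam v hv => le_iInf₂ fun ψ hψ => ?_⟩
  by_cases hfin : internalEnergy (n + 1) ℓ lam ψ = ⊤
  · rw [hfin, EReal.coe_ennreal_top, EReal.top_add_coe]
    exact le_top
  rw [integral_density_mul hψ, ← EReal.coe_ennreal_toReal hfin, ← EReal.coe_add,
    EReal.coe_le_coe_iff]
  have hT := kineticForm_ne_top hψ.2.2
  have hvm : Measurable fun r => ‖v r‖ₑ := (Lp.stronglyMeasurable v).measurable.enorm
  have hv2 : ∫⁻ r in box ℓ, ‖v r‖ₑ ^ 2 = ‖v‖ₑ ^ 2 := lintegral_enorm_sq_Lp v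
  have hb := hC n ℓ ψ hψ.2.2 (fun r => ‖v r‖ₑ) hvm
    (by rw [hv2]; exact ENNReal.pow_ne_top enorm_ne_top)
  have hψ1 : ‖ψ‖ₑ = 1 := by rw [← ofReal_norm, hψ.1, ENNReal.ofReal_one]
  have hsqrt : (‖v‖ₑ ^ 2) ^ (1 / 2 : ℝ) = ‖v‖ₑ := by
    rw [← ENNReal.rpow_natCast, ← ENNReal.rpow_mul]
    norm_num
  rw [hv2, hψ1, hsqrt, one_pow, mul_one] at hb
  have hKfin : (n + 1 : ℝ≥0∞) * (‖v‖ₑ * (δ * kineticForm (n + 1) ℓ ψ + C)) ≠ ⊤ :=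
    ENNReal.mul_ne_top (by exact_mod_cast ENNReal.natCast_ne_top (n + 1))
      (ENNReal.mul_ne_top enorm_ne_top (ENNReal.add_ne_top.2
        ⟨ENNReal.mul_ne_top ENNReal.coe_ne_top hT, ENNReal.coe_ne_top⟩))
  have hb' := ENNReal.toReal_mono hKfin hb
  have hcast : (n + 1 : ℝ≥0∞).toReal = n + 1 := by
    have : (n + 1 : ℝ≥0∞) = ((n + 1 : ℕ) : ℝ≥0∞) := by push_cast; rfl
    rw [this, ENNReal.toReal_natCast]
    push_cast
    rfl
  rw [ENNReal.toReal_mul, ENNReal.toReal_mul, toReal_enorm, hcast,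
    ENNReal.toReal_add (ENNReal.mul_ne_top ENNReal.coe_ne_top hT) ENNReal.coe_ne_top,
    ENNReal.toReal_mul, ENNReal.coe_toReal, ENNReal.coe_toReal] at hb'
  have hE : (kineticForm (n + 1) ℓ ψ).toReal / 2 ≤ (internalEnergy (n + 1) ℓ lam ψ).toReal := by
    have h1 : 2⁻¹ * kineticForm (n + 1) ℓ ψ ≤ internalEnergy (n + 1) ℓ lam ψ := by
      rw [internalEnergy_eq]
      exact le_self_add
    have h2 := ENNReal.toReal_mono hfin h1
    rw [ENNReal.toReal_mul] at h2
    simp only [ENNReal.toReal_inv, ENNReal.toReal_ofNat] at h2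
    linarith
  have hin := inner_densityLp_ge hψ v
  set T := (kineticForm (n + 1) ℓ ψ).toReal with hTdef
  have hT0 : 0 ≤ T := ENNReal.toReal_nonneg
  have hR : ‖v‖ ≤ (Real.toNNReal R : ℝ) := hv.trans (Real.le_coe_toNNReal R)
  have hδR : ((n : ℝ) + 1) * ((Real.toNNReal R : ℝ) * δ) ≤ 1 / 2 := by
    rw [hδ]
    push_cast
    have hr : (0 : ℝ) ≤ (Real.toNNReal R : ℝ) := NNReal.coe_nonneg _
    rw [← div_eq_mul_inv, ← mul_div_assoc, div_le_iff₀ (by positivity)]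
    nlinarith [Nat.cast_nonneg (α := ℝ) n]
  have h3 : ((n : ℝ) + 1) * (‖v‖ * (δ * T + C))
      ≤ ((n : ℝ) + 1) * ((Real.toNNReal R : ℝ) * (δ * T + C)) := by gcongr
  have h4 : ((n : ℝ) + 1) * ((Real.toNNReal R : ℝ) * (δ * T + C))
      = ((n : ℝ) + 1) * ((Real.toNNReal R : ℝ) * δ) * T
        + (n + 1) * (Real.toNNReal R * C) := by ring
  have h5 := mul_le_mul_of_nonneg_right hδR hT0
  linarith

theorem groundEnergy_finite {lam : ℝ≥0} (hne : (ensembleSet n ℓ lam).Nonempty)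
    (v : DensSpace ℓ) : groundEnergy n ℓ lam v ≠ ⊥ ∧ groundEnergy n ℓ lam v ≠ ⊤ := by
  constructor
  · obtain ⟨B, hB⟩ := exists_lower_bound n ℓ ‖v‖
    exact ne_of_gt (lt_of_lt_of_le (EReal.bot_lt_coe B) (hB lam v le_rfl))
  · obtain ⟨p, hp⟩ := hne
    exact ne_of_lt ((groundEnergy_le_of_mem hp v).trans_lt (EReal.coe_lt_top _))

theorem isMoreauPair {ε : ℝ} (hε : 0 < ε) {lam : ℝ≥0} (hne : (ensembleSet n ℓ lam).Nonempty) :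
    IsMoreauPair ε (ensembleSet n ℓ lam) (regF n ℓ ε lam)
      fun v => (groundEnergy n ℓ lam v).toReal := by
  have hcoe : ∀ v : DensSpace ℓ,
      (((groundEnergy n ℓ lam v).toReal : ℝ) : EReal) = groundEnergy n ℓ lam v := fun v =>
    EReal.coe_toReal (groundEnergy_finite hne v).2 (groundEnergy_finite hne v).1
  refine ⟨convex_ensembleSet n ℓ lam, hne, isGLB_regF hε hne, fun v => ⟨?_, fun b hb => ?_⟩,
    fun R => ?_⟩
  · rintro _ ⟨p, hp, rfl⟩
    rw [← EReal.coe_le_coe_iff, hcoe]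
    exact groundEnergy_le_of_mem hp v
  · rw [← EReal.coe_le_coe_iff, hcoe]
    exact le_groundEnergy fun p hp => hb ⟨p, hp, rfl⟩
  · obtain ⟨B, hB⟩ := exists_lower_bound n ℓ R
    refine ⟨B, fun v hv => ?_⟩
    rw [← EReal.coe_le_coe_iff, hcoe]
    exact hB lam v hv

end Ensembles

/-! ### A normalizable antisymmetric state of finite energy -/

section Slater

variable {n N : ℕ} {ℓ : ℝ}

/-- Well-separated positions of the electrons in the box. -/
def sites (N : ℕ) (ℓ : ℝ) : Config N := fun i =>
  EuclideanSpace.single 0 (ℓ * ((i : ℝ) + 1) / (N + 1))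

/-- A quarter of the distance of neighbouring sites. -/
def siteRadius (N : ℕ) (ℓ : ℝ) : ℝ := ℓ / (4 * (N + 1))

theorem siteRadius_pos (hℓ : 0 < ℓ) : 0 < siteRadius N ℓ := by
  unfold siteRadius; positivity

theorem dist_sites (hℓ : 0 < ℓ) {i j : Fin N} (hij : i ≠ j) :
    4 * siteRadius N ℓ ≤ dist (sites N ℓ i) (sites N ℓ j) := by
  have h1 : dist (sites N ℓ i) (sites N ℓ j) = ℓ / (N + 1) * |(i : ℝ) - j| := by
    rw [sites, sites, PiLp.dist_single_same, Real.dist_eq]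
    have : ℓ * ((i : ℝ) + 1) / (N + 1) - ℓ * ((j : ℝ) + 1) / (N + 1)
        = ℓ / (N + 1) * ((i : ℝ) - j) := by ring
    rw [this, abs_mul, abs_of_pos (by positivity)]
  have h2 : (1 : ℝ) ≤ |(i : ℝ) - j| := by
    have h3 : (i : ℤ) - j ≠ 0 := by
      intro h
      exact hij (Fin.ext (by omega))
    have := Int.one_le_abs h3
    exact_mod_cast this
  rw [h1]
  calc 4 * siteRadius N ℓ = ℓ / (N + 1) * 1 := by unfold siteRadius; field_simp
    _ ≤ _ := by gcongr

theorem mem_box_of_dist_site_le (hℓ : 0 < ℓ) {i : Fin N} {x : Pos}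
    (hx : dist x (sites N ℓ i) ≤ siteRadius N ℓ) : x ∈ box ℓ := by
  intro a
  have h1 : |x a - sites N ℓ i a| ≤ siteRadius N ℓ := by
    refine le_trans ?_ hx
    rw [dist_eq_norm]
    exact PiLp.norm_apply_le (x - sites N ℓ i) a
  have h2 : |sites N ℓ i a| ≤ ℓ * N / (N + 1) := by
    have hi : ((i : ℝ) + 1) ≤ N := by exact_mod_cast i.2
    by_cases ha : a = 0
    · subst ha
      have : sites N ℓ i 0 = ℓ * ((i : ℝ) + 1) / (N + 1) := by simp [sites]
      rw [this, abs_of_nonneg (by positivity)]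
      gcongr
    · have : sites N ℓ i a = 0 := by simp [sites, ha]
      rw [this, abs_zero]
      positivity
  have h3 : siteRadius N ℓ + ℓ * N / (N + 1) < ℓ := by
    unfold siteRadius
    rw [div_add_div _ _ (by positivity) (by positivity), div_lt_iff₀ (by positivity)]
    nlinarith [mul_pos hℓ (by positivity : (0 : ℝ) < (N : ℝ) + 1)]
  have h4 := abs_sub_abs_le_abs_sub (x a) (sites N ℓ i a)
  linarith

/-- A smooth bump localizing the `i`-th electron near the `i`-th site. -/
def siteBump (N : ℕ) {ℓ : ℝ} (hℓ : 0 < ℓ) : ContDiffBump (sites N ℓ) :=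
  ⟨siteRadius N ℓ / 2, siteRadius N ℓ, half_pos (siteRadius_pos hℓ),
    half_lt_self (siteRadius_pos hℓ)⟩

/-- The antisymmetrized bump. -/
def slater (N : ℕ) {ℓ : ℝ} (hℓ : 0 < ℓ) (r : Config N) : ℂ :=
  ∑ σ : Equiv.Perm (Fin N), ((Equiv.Perm.sign σ : ℤ) : ℂ) * ((siteBump N hℓ (r ∘ σ) : ℝ) : ℂ)

theorem contDiff_slater (hℓ : 0 < ℓ) : ContDiff ℝ ((⊤ : ℕ∞) : WithTop ℕ∞) (slater N hℓ) := by
  refine ContDiff.sum fun σ _ => contDiff_const.mul ?_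
  refine Complex.ofRealCLM.contDiff.comp ((siteBump N hℓ).contDiff.comp ?_)
  exact contDiff_pi.2 fun i => contDiff_apply ℝ Pos (σ i)

/-- Configurations in which the electrons are near distinct sites. -/
def nearSites (N : ℕ) (ℓ : ℝ) : Set (Config N) :=
  ⋃ σ : Equiv.Perm (Fin N), {r | r ∘ σ ∈ Metric.closedBall (sites N ℓ) (siteRadius N ℓ)}

theorem isClosed_nearSites : IsClosed (nearSites N ℓ) := by
  refine isClosed_iUnion_of_finite fun σ => Metric.isClosed_closedBall.preimage ?_
  exact continuous_pi fun i => continuous_apply (σ i)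

theorem exists_perm_of_mem_nearSites (hℓ : 0 < ℓ) {r : Config N} (hr : r ∈ nearSites N ℓ) :
    ∃ τ : Equiv.Perm (Fin N), ∀ j, dist (r j) (sites N ℓ (τ j)) ≤ siteRadius N ℓ := by
  obtain ⟨σ, hσ⟩ := Set.mem_iUnion.1 hr
  refine ⟨σ.symm, fun j => ?_⟩
  have h : dist (r ∘ σ) (sites N ℓ) ≤ siteRadius N ℓ := hσ
  have := (dist_pi_le_iff (siteRadius_pos hℓ).le).1 h (σ.symm j)
  simpa using this

theorem nearSites_subset (hℓ : 0 < ℓ) : nearSites N ℓ ⊆ configBox N ℓ := fun r hr => by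
  obtain ⟨τ, hτ⟩ := exists_perm_of_mem_nearSites hℓ hr
  exact fun j => mem_box_of_dist_site_le hℓ (hτ j)

theorem isBounded_configBox (N : ℕ) (ℓ : ℝ) : Bornology.IsBounded (configBox N ℓ) := by
  have : configBox N ℓ = Set.pi Set.univ fun _ => box ℓ := by ext; simp [configBox]
  rw [this]
  exact Bornology.IsBounded.pi fun _ => isBounded_box ℓ

theorem tsupport_slater_subset (hℓ : 0 < ℓ) : tsupport (slater N hℓ) ⊆ nearSites N ℓ := by
  refine closure_minimal (fun r hr => ?_) isClosed_nearSites
  obtain ⟨σ, -, hσ⟩ := Finset.exists_ne_zero_of_sum_ne_zero hr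
  refine Set.mem_iUnion.2 ⟨σ, ?_⟩
  by_contra hc
  have h : siteRadius N ℓ ≤ dist (r ∘ σ) (sites N ℓ) := by
    have : ¬ dist (r ∘ σ) (sites N ℓ) ≤ siteRadius N ℓ := hc
    exact (not_le.1 this).le
  apply hσ
  rw [(siteBump N hℓ).zero_of_le_dist h]
  simp

theorem hasCompactSupport_slater (hℓ : 0 < ℓ) : HasCompactSupport (slater N hℓ) :=
  Metric.isCompact_of_isClosed_isBounded (isClosed_tsupport _)
    ((isBounded_configBox N ℓ).subset
      ((tsupport_slater_subset hℓ).trans (nearSites_subset hℓ)))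

/-- Any other permutation moves some electron to a different site, outside the bump, so no
cancellation occurs and the state is not zero. -/
theorem slater_sites (hℓ : 0 < ℓ) : slater N hℓ (sites N ℓ) = 1 := by
  rw [slater, Finset.sum_eq_single (1 : Equiv.Perm (Fin N))]
  · have : (siteBump N hℓ) (sites N ℓ) = 1 := by
      refine (siteBump N hℓ).one_of_mem_closedBall ?_
      exact Metric.mem_closedBall_self (siteBump N hℓ).rIn_pos.le
    simp [this]
  · intro σ _ hσ
    obtain ⟨i, hi⟩ : ∃ i, σ i ≠ i := by
      by_contra hc
      push Not at hc
      exact hσ (Equiv.ext hc)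
    have h : siteRadius N ℓ ≤ dist (sites N ℓ ∘ σ) (sites N ℓ) := by
      have h1 := dist_le_pi_dist (sites N ℓ ∘ σ) (sites N ℓ) i
      have h2 := dist_sites hℓ hi
      have h3 := siteRadius_pos (N := N) hℓ
      simp only [Function.comp_apply] at h1
      linarith
    rw [(siteBump N hℓ).zero_of_le_dist h]
    simp
  · simp

theorem slater_comp_perm (hℓ : 0 < ℓ) (τ : Equiv.Perm (Fin N)) (r : Config N) :
    slater N hℓ (r ∘ τ) = ((Equiv.Perm.sign τ : ℤ) : ℂ) * slater N hℓ r := by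
  rw [slater, slater, Finset.mul_sum]
  -- The two permutations compose as `(r ∘ τ) ∘ σ = r ∘ (τ * σ)`.
  refine Fintype.sum_equiv (Equiv.mulLeft τ) _ _ fun σ => ?_
  rw [Equiv.coe_mulLeft, Equiv.Perm.sign_mul]
  have h : ((Equiv.Perm.sign τ : ℤ) : ℂ) * ((Equiv.Perm.sign τ : ℤ) : ℂ) = 1 := by
    rcases Int.units_eq_one_or (Equiv.Perm.sign τ) with h | h <;> simp [h]
  push_cast
  rw [← mul_assoc, ← mul_assoc, h, one_mul]
  rfl

theorem memLp_slater (hℓ : 0 < ℓ) : MemLp (slater N hℓ) 2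
    ((volume : Measure (Config N)).restrict (configBox N ℓ)) :=
  ((contDiff_slater hℓ).continuous.memLp_of_hasCompactSupport
    (hasCompactSupport_slater hℓ)).restrict _

theorem hasSobolevGradient_slater (hℓ : 0 < ℓ) :
    ∃ g, HasSobolevGradient N ℓ ((memLp_slater hℓ).toLp (slater N hℓ)) g := by
  have hg : ∀ i a, MemLp (fun r => fderiv ℝ (slater N hℓ) r (coordDir N i a)) 2
      ((volume : Measure (Config N)).restrict (configBox N ℓ)) := fun i a =>
    ((((contDiff_slater hℓ).continuous_fderiv (by simp)).clm_apply
      continuous_const).memLp_of_hasCompactSupport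
        ((hasCompactSupport_slater hℓ).fderiv_apply ℝ _)).restrict _
  have hconst : ∀ {f : Config N → ℂ} (hf : MemLp f 2
      ((volume : Measure (Config N)).restrict (configBox N ℓ))),
      Tendsto (fun _ : ℕ => eLpNorm (fun r => f r - MemLp.toLp f hf r) 2
        ((volume : Measure (Config N)).restrict (configBox N ℓ))) atTop (𝓝 0) := by
    intro f hf
    refine tendsto_const_nhds.congr fun k => ?_
    rw [eLpNorm_congr_ae (g := 0) (hf.coeFn_toLp.mono fun r hr => by rw [hr]; simp)]
    simp
  exact ⟨fun i a => (hg i a).toLp, fun _ => slater N hℓ, fun _ => ⟨contDiff_slater hℓ,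
    hasCompactSupport_slater hℓ, (tsupport_slater_subset hℓ).trans (nearSites_subset hℓ)⟩,
    hconst _, fun i a => hconst (hg i a)⟩

/-- The fully polarized wavefunction built from the antisymmetrized bump. -/
def slaterWave (N : ℕ) {ℓ : ℝ} (hℓ : 0 < ℓ) : WaveL2 N ℓ :=
  WithLp.toLp 2 fun s => if s = 0 then (memLp_slater hℓ).toLp else 0

theorem slaterWave_ae_eq (hℓ : 0 < ℓ) (s : Fin N → Fin 2) :
    ∀ᵐ r ∂((volume : Measure (Config N)).restrict (configBox N ℓ)),
      slaterWave N hℓ s r = if s = 0 then slater N hℓ r else 0 := by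
  by_cases hs : s = 0
  · simp only [slaterWave, hs, if_true]
    exact (memLp_slater hℓ).coeFn_toLp
  · simp only [slaterWave, hs, if_false]
    exact Lp.coeFn_zero ℂ 2 _

theorem slaterWave_mem (hℓ : 0 < ℓ) : slaterWave N hℓ ∈ finiteEnergyWaves N ℓ := by
  refine ⟨fun σ s => ?_, fun s => ?_⟩
  · filter_upwards [slaterWave_ae_eq hℓ s, (measurePreserving_comp_perm
      σ).quasiMeasurePreserving.ae (slaterWave_ae_eq hℓ (s ∘ σ))] with r h1 h2
    rw [h1, h2]
    -- The fully polarized spin configuration is fixed by permutations, so antisymmetry rests on the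
    -- spatial part alone.
    have hiff : s ∘ σ = 0 ↔ s = 0 := by
      constructor
      · intro h
        ext i
        have := congrFun h (σ.symm i)
        simpa using congrArg Fin.val this
      · rintro rfl
        rfl
    by_cases hs : s = 0
    · rw [if_pos hs, if_pos (hiff.2 hs), slater_comp_perm]
    · rw [if_neg hs, if_neg (hiff.not.2 hs), mul_zero]
  · by_cases hs : s = 0
    · simp only [slaterWave, hs, if_true]
      exact hasSobolevGradient_slater hℓ
    · simp only [slaterWave, hs, if_false]
      exact ⟨_, HasSobolevGradient.zero⟩

theorem slaterWave_ne_zero (hℓ : 0 < ℓ) : slaterWave N hℓ ≠ 0 := by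
  intro h0
  have h1 := slaterWave_ae_eq (N := N) hℓ 0
  have h2 : ∀ᵐ r ∂((volume : Measure (Config N)).restrict (configBox N ℓ)),
      slater N hℓ r = 0 := by
    have h3 := Lp.coeFn_zero ℂ 2 ((volume : Measure (Config N)).restrict (configBox N ℓ))
    filter_upwards [h1, h3] with r e1 e3
    rw [h0] at e1
    simp only [if_true] at e1
    rw [← e1]
    exact e3
  have hopen : IsOpen {r | slater N hℓ r ≠ 0} :=
    isOpen_ne_fun (contDiff_slater hℓ).continuous continuous_const
  have hsub : {r | slater N hℓ r ≠ 0} ⊆ configBox N ℓ := fun r hr =>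
    nearSites_subset hℓ (tsupport_slater_subset hℓ (subset_tsupport _ hr))
  have hpos := hopen.measure_pos (volume : Measure (Config N))
    ⟨sites N ℓ, by simp [slater_sites]⟩
  have h4 : ((volume : Measure (Config N)).restrict (configBox N ℓ))
      {r | slater N hℓ r ≠ 0} = 0 := h2
  rw [Measure.restrict_apply hopen.measurableSet, Set.inter_eq_left.2 hsub] at h4
  exact hpos.ne' h4

/-- Distinct electrons are near distinct sites, at distance at least four radii, so the electrons
stay at least two radii apart. The repulsion is thus bounded on the support, with no need for a
Hardy inequality. -/
theorem coulomb_le (hℓ : 0 < ℓ) {r : Config N} (hr : r ∈ nearSites N ℓ) :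
    coulomb N r ≤ ∑ i : Fin N, ∑ _j ∈ Finset.Ioi i, (ENNReal.ofReal (siteRadius N ℓ))⁻¹ := by
  obtain ⟨τ, hτ⟩ := exists_perm_of_mem_nearSites hℓ hr
  refine Finset.sum_le_sum fun i _ => Finset.sum_le_sum fun j hj => ?_
  rw [ENNReal.inv_le_inv, ← ofReal_norm]
  refine ENNReal.ofReal_le_ofReal ?_
  have hij : τ i ≠ τ j := fun h => (Finset.mem_Ioi.1 hj).ne (τ.injective h)
  have h1 := dist_sites hℓ hij
  have h2 := dist_triangle4 (sites N ℓ (τ i)) (r i) (r j) (sites N ℓ (τ j))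
  have h3 := hτ i
  have h4 := hτ j
  rw [dist_comm] at h3
  have h5 := siteRadius_pos (N := N) hℓ
  rw [← dist_eq_norm]
  linarith

theorem internalEnergy_slaterWave_ne_top (hℓ : 0 < ℓ) (lam : ℝ≥0) :
    internalEnergy N ℓ lam (slaterWave N hℓ) ≠ ⊤ := by
  set M : ℝ≥0∞ := ∑ i : Fin N, ∑ _j ∈ Finset.Ioi i, (ENNReal.ofReal (siteRadius N ℓ))⁻¹ with hM
  have hMtop : M ≠ ⊤ := ENNReal.sum_ne_top.2 fun i _ => ENNReal.sum_ne_top.2 fun j _ =>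
    ENNReal.inv_ne_top.2 (by simpa using siteRadius_pos hℓ)
  have hpot : potentialForm N ℓ (coulomb N) (slaterWave N hℓ)
      ≤ M * potentialForm N ℓ (fun _ => 1) (slaterWave N hℓ) := by
    rw [potentialForm, potentialForm, Finset.mul_sum]
    refine Finset.sum_le_sum fun s _ => ?_
    rw [← lintegral_const_mul' _ _ hMtop]
    refine lintegral_mono_ae ?_
    filter_upwards [slaterWave_ae_eq hℓ s] with r hr
    rw [one_mul]
    by_cases h0 : slaterWave N hℓ s r = 0
    · simp [h0]
    · gcongr
      have : slater N hℓ r ≠ 0 := by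
        intro h
        apply h0
        rw [hr, h, ite_self]
      exact coulomb_le hℓ (tsupport_slater_subset hℓ (subset_tsupport _ this))
  rw [internalEnergy_eq]
  refine ENNReal.add_ne_top.2 ⟨ENNReal.mul_ne_top (by simp)
    (kineticForm_ne_top (slaterWave_mem hℓ).2), ENNReal.mul_ne_top ENNReal.coe_ne_top ?_⟩
  refine ne_top_of_le_ne_top ?_ hpot
  rw [potentialForm_one]
  exact ENNReal.mul_ne_top hMtop (ENNReal.pow_ne_top enorm_ne_top)

theorem ensembleSet_nonempty (hℓ : 0 < ℓ) (lam : ℝ≥0) : (ensembleSet n ℓ lam).Nonempty := by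
  set c : ℂ := ((‖slaterWave (n + 1) hℓ‖⁻¹ : ℝ) : ℂ) with hc
  have hnorm : ‖slaterWave (n + 1) hℓ‖ ≠ 0 := norm_ne_zero_iff.2 (slaterWave_ne_zero hℓ)
  have hc0 : c ≠ 0 := by simpa [hc] using slaterWave_ne_zero hℓ
  have hmem : c • slaterWave (n + 1) hℓ ∈ waveSet (n + 1) ℓ := by
    refine mem_waveSet_iff.2 ⟨?_, Submodule.smul_mem _ _ (slaterWave_mem hℓ)⟩
    rw [norm_smul, hc, Complex.norm_real, norm_inv, norm_norm, inv_mul_cancel₀ hnorm]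
  refine ⟨_, mem_ensembleSet_of_mem_waveSet (lam := lam) hmem ?_⟩
  refine ne_top_of_le_ne_top ?_ (internalEnergy_smul_le hc0 lam _)
  exact ENNReal.mul_ne_top (ENNReal.pow_ne_top enorm_ne_top)
    (internalEnergy_slaterWave_ne_top hℓ lam)

end Slater

end MYKS

end

theorem mainTheorem2 (n : ℕ) (ℓ ε : ℝ) (hℓ : 0 < ℓ) (hε : 0 < ε) (vext : MYKS.DensSpace ℓ) :
    -- the functionals entering the algorithm are finite, the regularized ones differentiable
    (∀ lam : ℝ≥0, lam ≤ 1 →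
      (∀ v : MYKS.DensSpace ℓ,
        MYKS.groundEnergy n ℓ lam v ≠ ⊥ ∧ MYKS.groundEnergy n ℓ lam v ≠ ⊤) ∧
      (∀ ρ : MYKS.DensSpace ℓ,
        MYKS.moreauEnvelope ε (MYKS.universalF n ℓ lam) ρ ≠ ⊥ ∧
        MYKS.moreauEnvelope ε (MYKS.universalF n ℓ lam) ρ ≠ ⊤ ∧
        DifferentiableAt ℝ (MYKS.regF n ℓ ε lam) ρ)) ∧
    -- the initialization and the noninteracting problem can be solved
    (MYKS.superdiff (MYKS.regE n ℓ ε 0) vext).Nonempty ∧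
    (∀ v : MYKS.DensSpace ℓ, (MYKS.superdiff (MYKS.groundEnergy n ℓ 0) v).Nonempty) ∧
    -- the damping step is well defined, whatever solution of the noninteracting problem was
    -- chosen, unless the current quasidensity is already stationary
    (∀ ρ v ρt : MYKS.DensSpace ℓ, v = vext + MYKS.vHxc n ℓ ε ρ →
      ρt ∈ MYKS.superdiff (MYKS.groundEnergy n ℓ 0) v →
      gradient (MYKS.regF n ℓ ε 1) ρ + vext ≠ 0 →
      ∃ t : ℝ, MYKS.IsDamping n ℓ ε vext ρ (ρt - ε • v) t) ∧
    -- a stationary quasidensity has the exact energy, and an admissible step still exists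
    (∀ ρ v : MYKS.DensSpace ℓ, v = vext + MYKS.vHxc n ℓ ε ρ →
      gradient (MYKS.regF n ℓ ε 1) ρ + vext = 0 →
      ((MYKS.energyEstimate n ℓ ε vext ρ + ε * ‖vext‖ ^ 2 / 2 : ℝ) : EReal)
          = MYKS.groundEnergy n ℓ 1 vext ∧
      ∃ ρt ∈ MYKS.superdiff (MYKS.groundEnergy n ℓ 0) v,
        ∃ t : ℝ, MYKS.IsDamping n ℓ ε vext ρ (ρt - ε • v) t) ∧
    -- every run, finite or infinite
    (∀ (T : ℕ∞) (ρ veff ρt ρ' : ℕ → MYKS.DensSpace ℓ) (t : ℕ → ℝ),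
      MYKS.IsRun n ℓ ε vext T ρ veff ρt ρ' t →
      -- strict decrease in each iteration, unless it terminates the algorithm and started from
      -- a stationary quasidensity
      (∀ i : ℕ, (i : ℕ∞) < T →
        (veff (i + 1) ≠ vext + MYKS.vHxc n ℓ ε (ρ (i + 1)) ∨
          gradient (MYKS.regF n ℓ ε 1) (ρ i) + vext ≠ 0) →
        MYKS.energyEstimate n ℓ ε vext (ρ (i + 1)) < MYKS.energyEstimate n ℓ ε vext (ρ i)) ∧
      (∀ i : ℕ, (i : ℕ∞) < T →
        MYKS.energyEstimate n ℓ ε vext (ρ (i + 1)) ≤ MYKS.energyEstimate n ℓ ε vext (ρ i)) ∧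
      -- upper bound property of every computed energy
      (∀ i : ℕ, (i : ℕ∞) ≤ T →
        MYKS.groundEnergy n ℓ 1 vext ≤
          ((MYKS.energyEstimate n ℓ ε vext (ρ i) + ε * ‖vext‖ ^ 2 / 2 : ℝ) : EReal)) ∧
      -- strict descent, convergence and upper bound property of the limit
      (T = ⊤ →
        StrictAnti (fun i => MYKS.energyEstimate n ℓ ε vext (ρ i)) ∧
        ∃ e : ℝ, Tendsto (fun i => MYKS.energyEstimate n ℓ ε vext (ρ i)) atTop (𝓝 e) ∧
          MYKS.groundEnergy n ℓ 1 vext ≤ ((e + ε * ‖vext‖ ^ 2 / 2 : ℝ) : EReal))) :=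
  MYKS.main_of_isMoreauPair n ℓ ε hε vext
    (fun lam => ⟨MYKS.groundEnergy_finite (MYKS.ensembleSet_nonempty hℓ lam),
      MYKS.moreauEnvelope_finite hε (MYKS.ensembleSet_nonempty hℓ lam)⟩)
    fun lam => ⟨_, MYKS.isMoreauPair hε (MYKS.ensembleSet_nonempty hℓ lam)⟩
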